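/- Let $d\in\mathbb N$ and let $\mathcal H$ be a complex Hilbert space. Let $\mathbb F^d$ be the free monoid of words in $d$ letters, with unit $\emptyset$ and transpose $(i_1\cdots i_k)^T=i_k\cdots i_1$, and let $F^2_d=\ell^2(\mathbb F^d)$ be the full Fock space with left creation operators $L_k e_\alpha=e_{k\alpha}$. A formal series $F(Z)=\sum_\alpha Z^\alpha F_\alpha$ has coefficients $F_\alpha\in\mathcal L(\mathcal H)$; its transpose is $T\circ F=\sum_\alpha Z^{\alpha^T}F_\alpha$. The left product is $FG=\sum_{\alpha,\beta} Z^{\alpha\beta}F_\alpha G_\beta$ and the right product is $F\bullet_R G=\sum_{\alpha,\beta} Z^{\beta\alpha}F_\alpha G_\beta$. Let $\Omega=\coprod_n\Omega_n$ be the non-commutative unit ball: $\Omega_n$ is the set of $d$-tuples $Z$ of $n\times n$ matrices with $\sum_k Z_kZ_k^*<I$. For $Z\in\Omega_n$ put $F(Z)=\sum_k\sum_{|\alpha|=k} Z^\alpha\otimes F_\alpha$. A series is free holomorphic on $\Omega$ if it converges at all points of $\Omega$ to a graded function that respects intertwinings, is locally bounded and is G\^ateaux differentiable. * The left (right) free Schur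 class $\mathscr L_d(\mathcal H)$ ($\mathscr R_d(\mathcal H)$) is the set of series $B$ such that $f\mapsto Bf$ ($f\mapsto B\bullet_R f$) is a contraction on $F^2_d\otimes\mathcal H$. $B^L\in\mathscr L_d(\mathcal H)$ is non-unital if $I-B^L(Z)$ is invertible for all $Z\in\Omega$; $B^R\in\mathscr R_d(\mathcal H)$ is non-unital if $I-B^R$ has an inverse for the product $\bullet_R$ that is free holomorphic on $\Omega$. * With $\hat k(Z,W)=\sum_\alpha Z^\alpha (W^*)^{\alpha^T}$, the left (right) free Herglotz--Schur class $\mathscr L_d^+(\mathcal H)$ ($\mathscr R_d^+(\mathcal H)$) is the set of series $H$, free holomorphic on $\Omega$, for which $\frac12\left(H(Z)\hat k(Z,W)+\hat k(Z,W)H(W)^*\right)$ (with $\bullet_R$ in place of the left product in the right case) is a positive formal kernel, that is, its coefficients $\hat K_{\alpha,\beta}$ form a positive kernel on $\mathbb F^d\times\mathbb F^d$. * A pair is transpose-conjugate if its second entry is the transpose of its first. * $\mathcal A$ is the norm-closed unital algebra generated by $L_1,\dots,L_d$, and $CP(\mathcal A;\mathcal H)$ is the set of completely positive linear maps from the norm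 closure of $\mathcal A+\mathcal A^*$ into $\mathcal L(\mathcal H)$. **Theorem.** (1) A bijection from the transpose-conjugate pairs $B=(B^L,B^R)\in\mathscr L_d(\mathcal H)\times\mathscr R_d(\mathcal H)$ of non-unital free Schur class functions onto the transpose-conjugate pairs $H=(H^L,H^R)\in\mathscr L_d^+(\mathcal H)\times\mathscr R_d^+(\mathcal H)$ of free Herglotz--Schur functions is given by $B\mapsto H_B$, $$H_B^L(Z)=(I-B^L(Z))^{-1}(I+B^L(Z))\quad(Z\in\Omega),\qquad H_B^R=(I-B^R)^{-1}\bullet_R(I+B^R),$$ with inverse $H\mapsto B_H$, $$B_H^L(Z)=(H^L(Z)+I)^{-1}(H^L(Z)-I)\quad(Z\in\Omega),\qquad B_H^R=(H^R+I)^{-1}\bullet_R(H^R-I),$$ where the inverses in the right-hand formulas are taken for $\bullet_R$; all the inverses exist. (2) For every transpose-conjugate pair $H$ of free Herglotz--Schur functions there is exactly one $\phi=\phi_H\in CP(\mathcal A;\mathcal H)$ with $$H^L(Z)=\phi\left((I-ZL^*)^{-1}(I+ZL^*)\right)+i\,\mathrm{Im}\,H_\emptyset,\qquad H^R=T\circ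 H^L .$$ Here the formula may be read as an identity of formal series, with $(I-ZL^*)^{-1}=\sum_\alpha Z^\alpha (L^*)^\alpha$ and $\phi$ applied to the coefficients, or equivalently as an identity at each $Z\in\Omega_n$, with $ZL^*=\sum_k Z_k\otimes L_k^*$ and $\mathrm{id}_n\otimes\phi$ in place of $\phi$; $\phi_H$ is the only map satisfying it in either sense. Conversely, for $\phi\in CP(\mathcal A;\mathcal H)$ and $C=C^*\in\mathcal L(\mathcal H)$, the series $H^L=\phi\left((I-ZL^*)^{-1}(I+ZL^*)\right)+iC$ and $H^R=T\circ H^L$ form a transpose-conjugate pair of free Herglotz--Schur functions with $\phi_H=\phi$ and $\mathrm{Im}\,H_\emptyset=C$. Thus $H\mapsto\phi_H$ is a bijection modulo imaginary constants: it is onto $CP(\mathcal A;\mathcal H)$, and $\phi_H=\phi_{H'}$ if and only if $H'=(H^L+iC,\,H^R+iC)$ for some $C=C^*\in\mathcal L(\mathcal H)$. (3) For every pair $B$ as in (1), $\phi_{H_B}$ is the Aleksandrov--Clark map $\mu_B$ of $B$, that is, the unique $\mu\in CP(\mathcal A;\mathcal H)$ with $$(I-B^L(Z))^{-1}(I+B^L(Z))=(\mathrm{id}_n\otimes\mu)\left((I-ZL^*)^{-1}(I+ZL^*)\right)+i\,I_n\otimes\mathrm{Im}\left((I-B_\emptyset)^{-1}(I+B_\emptyset)\right)$$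 for all $n$ and $Z\in\Omega_n$, where $B_\emptyset:=B^L_\emptyset$. -/

import Mathlib

open scoped ComplexOrder Topology

noncomputable section

namespace FreeAC

/-! ### Words, free formal power series and their two products -/

/-- Words in the letters `1, …, d` (the free monoid, with `++` as product and `[]` as unit). The
transpose of a word is `List.reverse`. -/
abbrev Word (d : ℕ) : Type := List (Fin d)

/-- Formal power series `∑ Z^α F_α` in `d` free variables, given by their coefficients. -/
abbrev FreeSeries (d : ℕ) (R : Type*) : Type _ := Word d → R

section Series

variable {d : ℕ} {R : Type*}

/-- The constant series. -/
def const [Zero R] (a : R) : FreeSeries d R := fun α => if α = [] then a else 0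

/-- The series `∑ Z^α F_{α^T}`. -/
def transpose (F : FreeSeries d R) : FreeSeries d R := fun α => F α.reverse

/-- The product `F(Z) G(Z)`: its `γ` coefficient is `∑_{αβ = γ} F_α G_β`. The factorizations
`αβ = γ` are the pairs `(γ.take i, γ.drop i)` with `i ≤ |γ|`. -/
def lmul [Semiring R] (F G : FreeSeries d R) : FreeSeries d R := fun γ =>
  ∑ i ∈ Finset.range (γ.length + 1), F (γ.take i) * G (γ.drop i)

/-- The right product `F(Z) •_R G(Z)`: its `γ` coefficient is `∑_{βα = γ} F_α G_β`. -/
def rmul [Semiring R] (F G : FreeSeries d R) : FreeSeries d R := fun γ =>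
  ∑ i ∈ Finset.range (γ.length + 1), F (γ.drop i) * G (γ.take i)

/-- `G` is the inverse of `F` for the right product. -/
def IsRInverse [Semiring R] (F G : FreeSeries d R) : Prop :=
  rmul F G = const 1 ∧ rmul G F = const 1

end Series

/-! ### Vector-valued Fock space, the left free shift and the free disk operator system -/

/-- The Fock space `F²_d ⊗ ℋ`, as square-summable families of vectors indexed by words. -/
abbrev Fock (d : ℕ) (ℋ : Type*) [NormedAddCommGroup ℋ] [InnerProductSpace ℂ ℋ] : Type _ :=
  lp (fun _ : Word d => ℋ) 2

/-- The coefficients of `e_k ⊗ f`. -/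
def consFun {d : ℕ} (k : Fin d) (f : Word d → ℂ) : Word d → ℂ
  | [] => 0
  | j :: β => if j = k then f β else 0

theorem consFun_eq_extend {d : ℕ} (k : Fin d) (f : Word d → ℂ) :
    consFun k f = Function.extend (List.cons k) f 0 := by
  have hinj : Function.Injective (List.cons k) := List.cons_injective
  funext β
  by_cases h : ∃ γ, List.cons k γ = β
  · obtain ⟨γ, rfl⟩ := h
    rw [hinj.extend_apply]
    simp [consFun]
  · rw [Function.extend_apply' _ _ _ h]
    cases β with
    | nil => rfl
    | cons j β =>
      have : j ≠ k := fun hj => h ⟨β, by rw [hj]⟩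
      simp [consFun, this]

theorem hasSum_consFun {d : ℕ} (k : Fin d) (f : Fock d ℂ) :
    HasSum (fun β => ‖consFun k f β‖ ^ (2 : ENNReal).toReal)
      (‖f‖ ^ (2 : ENNReal).toReal) := by
  have hinj : Function.Injective (List.cons k) := List.cons_injective
  have h0 : (0 : ℝ) < (2 : ENNReal).toReal := by norm_num
  have hf := lp.hasSum_norm (p := 2) h0 f
  rw [← hinj.hasSum_iff]
  · convert hf using 1
    funext β
    simp [consFun]
  · intro β hβ
    have h : ¬ ∃ γ, List.cons k γ = β := fun ⟨γ, hγ⟩ => hβ ⟨γ, hγ⟩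
    rw [consFun_eq_extend, Function.extend_apply' _ _ _ h]
    simp

/-- The left creation operator `L_k f = e_k ⊗ f` on the full Fock space. -/
def leftCreation {d : ℕ} (k : Fin d) : Fock d ℂ →L[ℂ] Fock d ℂ :=
  LinearMap.mkContinuous
    { toFun := fun f => ⟨consFun k f,
        memℓp_gen (hasSum_consFun k f).summable⟩
      map_add' := fun f g => by
        ext β
        change consFun k (fun γ => f γ + g γ) β = consFun k f β + consFun k g β
        cases β with
        | nil => simp [consFun]
        | cons j β => by_cases h : j = k <;> simp [consFun, h]
      map_smul' := fun c f => by
        ext β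
        cases β with
        | nil => simp [consFun]
        | cons j β => by_cases h : j = k <;> simp [consFun, h] }
    1 (fun f => by
      have h0 : (0 : ℝ) < (2 : ENNReal).toReal := by norm_num
      have h := lp.hasSum_norm (p := 2) h0
        (⟨consFun k f, memℓp_gen (hasSum_consFun k f).summable⟩ : Fock d ℂ)
      have h2 := h.unique (hasSum_consFun k f)
      rw [one_mul]
      exact ((Real.rpow_left_inj (norm_nonneg _) (norm_nonneg _) h0.ne').mp h2).le)

/-- The left free disk algebra `𝒜_d`: the norm-closed unital algebra generated by the `L_k`. -/
def diskAlgebra (d : ℕ) : Subalgebra ℂ (Fock d ℂ →L[ℂ] Fock d ℂ) :=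
  (Algebra.adjoin ℂ (Set.range (leftCreation (d := d)))).topologicalClosure

/-- The free disk operator system: the norm closure of `𝒜 + 𝒜*`. -/
def diskSystem (d : ℕ) : Submodule ℂ (Fock d ℂ →L[ℂ] Fock d ℂ) :=
  (Submodule.span ℂ ((diskAlgebra d : Set (Fock d ℂ →L[ℂ] Fock d ℂ)) ∪
    star '' (diskAlgebra d : Set (Fock d ℂ →L[ℂ] Fock d ℂ)))).topologicalClosure

/-- Positivity of the operator on `E ⊕ ⋯ ⊕ E` with matrix entries `a i j`. -/
def IsPosMatrix {E : Type*} [NormedAddCommGroup E] [InnerProductSpace ℂ E] {n : ℕ}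
    (a : Matrix (Fin n) (Fin n) (E →L[ℂ] E)) : Prop :=
  ∀ x : Fin n → E, 0 ≤ ∑ i, ∑ j, inner ℂ (x i) (a i j (x j))

section

variable (d : ℕ) (ℋ : Type*) [NormedAddCommGroup ℋ] [InnerProductSpace ℂ ℋ] [CompleteSpace ℋ]

/-- The cone `CP(𝒜; ℋ)` of completely positive maps from the free disk operator system into the
bounded operators on `ℋ`. -/
def cpMaps : Set (diskSystem d →ₗ[ℂ] (ℋ →L[ℂ] ℋ)) :=
  {φ | ∀ (n : ℕ) (a : Matrix (Fin n) (Fin n) (diskSystem d)),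
    IsPosMatrix (a.map (fun x => (x : Fock d ℂ →L[ℂ] Fock d ℂ))) → IsPosMatrix (a.map φ)}

end

/-! ### Evaluation on the non-commutative unit ball, free holomorphic functions -/

section

variable {d : ℕ} {ℋ : Type*} [NormedAddCommGroup ℋ] [InnerProductSpace ℂ ℋ] [CompleteSpace ℋ]

/-- Level `n` of the NC unit ball `Ω`: the strict row contractions
`Z = (Z_1, …, Z_d) : ℂⁿ ⊗ ℂᵈ → ℂⁿ`, i.e. `Z Z^* = ∑ Z_k Z_k^* < I`. -/
def ncBall (d n : ℕ) : Set (Fin d → Matrix (Fin n) (Fin n) ℂ) :=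
  {Z | (1 - ∑ k, Z k * (Z k).conjTranspose).PosDef}

/-- `S ⊗ A`, as a matrix of operators. Bounded operators on `ℂⁿ ⊗ E` are identified with
`n × n` matrices of bounded operators on `E` (with entrywise norm convergence). -/
def tensor {m n : ℕ} {R : Type*} [SMul ℂ R] (S : Matrix (Fin m) (Fin n) ℂ) (A : R) :
    Matrix (Fin m) (Fin n) R :=
  S.map (fun c => c • A)

/-- `Z^α = Z_{i_1} ⋯ Z_{i_k}` for `α = i_1 ⋯ i_k`. -/
def wordPow {M : Type*} [Monoid M] (Z : Fin d → M) (α : Word d) : M := (α.map Z).prod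

/-- The homogeneous part `∑_{|α| = k} Z^α ⊗ F_α`. -/
def homPart (F : FreeSeries d (ℋ →L[ℂ] ℋ)) (k : ℕ) {n : ℕ}
    (Z : Fin d → Matrix (Fin n) (Fin n) ℂ) : Matrix (Fin n) (Fin n) (ℋ →L[ℂ] ℋ) :=
  ∑ w : Fin k → Fin d, tensor (wordPow Z (List.ofFn w)) (F (List.ofFn w))

/-- The value `F(Z) = ∑_α Z^α ⊗ F_α`, summed along homogeneous parts. -/
def eval (F : FreeSeries d (ℋ →L[ℂ] ℋ)) {n : ℕ}
    (Z : Fin d → Matrix (Fin n) (Fin n) ℂ) : Matrix (Fin n) (Fin n) (ℋ →L[ℂ] ℋ) :=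
  ∑' k, homPart F k Z

/-- Graded operator-valued functions on the NC universe (only the values on `Ω` matter). -/
abbrev GradedFun (d : ℕ) (ℋ : Type*) [NormedAddCommGroup ℋ] [InnerProductSpace ℂ ℋ] : Type _ :=
  ∀ n : ℕ, (Fin d → Matrix (Fin n) (Fin n) ℂ) → Matrix (Fin n) (Fin n) (ℋ →L[ℂ] ℋ)

/-- Free holomorphic functions on `Ω`: graded functions that respect intertwinings, are locally
bounded and Gâteaux differentiable. -/
structure IsFreeHolomorphicFun (f : GradedFun d ℋ) : Prop where
  intertwining : ∀ (n m : ℕ), ∀ Z ∈ ncBall d n, ∀ W ∈ ncBall d m,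
    ∀ S : Matrix (Fin m) (Fin n) ℂ, (∀ k, S * Z k = W k * S) →
      tensor S (1 : ℋ →L[ℂ] ℋ) * f n Z = f m W * tensor S (1 : ℋ →L[ℂ] ℋ)
  locally_bounded : ∀ (n : ℕ), ∀ Z ∈ ncBall d n, ∃ U ∈ 𝓝 Z, ∃ C : ℝ,
    ∀ W ∈ U ∩ ncBall d n, ∀ i j, ‖f n W i j‖ ≤ C
  gateaux : ∀ (n : ℕ), ∀ Z ∈ ncBall d n, ∀ W : Fin d → Matrix (Fin n) (Fin n) ℂ,
    ∃ D, Filter.Tendsto (fun t : ℂ => t⁻¹ • (f n (Z + t • W) - f n Z)) (𝓝[≠] 0) (𝓝 D)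

/-- The formal power series `F` converges on `Ω` and defines a free holomorphic function there. -/
def IsFreeHolomorphic (F : FreeSeries d (ℋ →L[ℂ] ℋ)) : Prop :=
  (∀ (n : ℕ), ∀ Z ∈ ncBall d n, Summable fun k => homPart F k Z) ∧
    IsFreeHolomorphicFun (fun _ Z => eval F Z)

/-! ### The free Schur classes -/

/-- The left free Schur class: contractive left multipliers of `F²_d ⊗ ℋ`. -/
def IsLeftSchur (B : FreeSeries d (ℋ →L[ℂ] ℋ)) : Prop :=
  ∃ M : Fock d ℋ →L[ℂ] Fock d ℋ, ‖M‖ ≤ 1 ∧ ∀ (f : Fock d ℋ) (γ : Word d),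
    M f γ = ∑ i ∈ Finset.range (γ.length + 1), B (γ.take i) (f (γ.drop i))

/-- The right free Schur class: contractive right multipliers of `F²_d ⊗ ℋ`. -/
def IsRightSchur (B : FreeSeries d (ℋ →L[ℂ] ℋ)) : Prop :=
  ∃ M : Fock d ℋ →L[ℂ] Fock d ℋ, ‖M‖ ≤ 1 ∧ ∀ (f : Fock d ℋ) (γ : Word d),
    M f γ = ∑ i ∈ Finset.range (γ.length + 1), B (γ.drop i) (f (γ.take i))

/-- `I - B(Z)` is invertible for all `Z ∈ Ω`. -/
def IsLeftNonUnital (B : FreeSeries d (ℋ →L[ℂ] ℋ)) : Prop :=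
  ∀ (n : ℕ), ∀ Z ∈ ncBall d n, IsUnit (1 - eval B Z)

/-- `I - B` is invertible on `Ω` for the right product: it has a `•_R`-inverse among the free
holomorphic functions on `Ω`. -/
def IsRightNonUnital (B : FreeSeries d (ℋ →L[ℂ] ℋ)) : Prop :=
  ∃ G, IsFreeHolomorphic G ∧ IsRInverse (const 1 - B) G

/-! ### The free Herglotz–Schur classes -/

/-- Positive operator-valued kernels on the set of words. -/
def IsPosKernel (K : Word d → Word d → (ℋ →L[ℂ] ℋ)) : Prop :=
  ∀ (s : Finset (Word d)) (h : Word d → ℋ),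
    0 ≤ ∑ α ∈ s, ∑ β ∈ s, inner ℂ (h α) (K α β (h β))

/-- Coefficient kernel of the free Szegő kernel. -/
def szego (α β : Word d) : ℋ →L[ℂ] ℋ := if α = β then 1 else 0

/-- The coefficient kernel of `½ (H(Z) k(Z,W) + k(Z,W) H(W)^*)`, where `k` is the free Szegő
kernel: the `Z^α (W^*)^{β^T}` coefficients of the two terms are `∑_{γδ = α} H_γ k_{δ,β}` and
`∑_{γδ = β} k_{α,δ} H_γ^*`. -/
def leftHerglotzKernel (H : FreeSeries d (ℋ →L[ℂ] ℋ)) (α β : Word d) : ℋ →L[ℂ] ℋ :=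
  (2⁻¹ : ℂ) •
    ((∑ i ∈ Finset.range (α.length + 1), H (α.take i) * szego (α.drop i) β) +
      ∑ i ∈ Finset.range (β.length + 1), szego α (β.drop i) * star (H (β.take i)))

/-- The coefficient kernel of `½ (H(Z) •_R k(Z,W) + k(Z,W) •_R H(W)^*)`: the coefficients of the
two terms are `∑_{δγ = α} H_γ k_{δ,β}` and `∑_{δγ = β} k_{α,δ} H_γ^*`. -/
def rightHerglotzKernel (H : FreeSeries d (ℋ →L[ℂ] ℋ)) (α β : Word d) : ℋ →L[ℂ] ℋ :=
  (2⁻¹ : ℂ) •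
    ((∑ i ∈ Finset.range (α.length + 1), H (α.drop i) * szego (α.take i) β) +
      ∑ i ∈ Finset.range (β.length + 1), szego α (β.take i) * star (H (β.drop i)))

/-- The left free Herglotz–Schur class. -/
def IsLeftHerglotz (H : FreeSeries d (ℋ →L[ℂ] ℋ)) : Prop :=
  IsFreeHolomorphic H ∧ IsPosKernel (leftHerglotzKernel H)

/-- The right free Herglotz–Schur class. -/
def IsRightHerglotz (H : FreeSeries d (ℋ →L[ℂ] ℋ)) : Prop :=
  IsFreeHolomorphic H ∧ IsPosKernel (rightHerglotzKernel H)

variable (d ℋ) in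
/-- Transpose-conjugate pairs `(B^L, B^R)` of non-unital free Schur class functions. -/
def schurPairs : Set (FreeSeries d (ℋ →L[ℂ] ℋ) × FreeSeries d (ℋ →L[ℂ] ℋ)) :=
  {B | IsLeftSchur B.1 ∧ IsRightSchur B.2 ∧ B.2 = transpose B.1 ∧
    IsLeftNonUnital B.1 ∧ IsRightNonUnital B.2}

variable (d ℋ) in
/-- Transpose-conjugate pairs `(H^L, H^R)` of free Herglotz–Schur functions. -/
def herglotzPairs : Set (FreeSeries d (ℋ →L[ℂ] ℋ) × FreeSeries d (ℋ →L[ℂ] ℋ)) :=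
  {H | IsLeftHerglotz H.1 ∧ IsRightHerglotz H.2 ∧ H.2 = transpose H.1}

/-! ### The Cayley transforms -/

/-- The function `Z ↦ (I - B(Z))⁻¹ (I + B(Z))`. -/
def cayleyFun (B : FreeSeries d (ℋ →L[ℂ] ℋ)) : GradedFun d ℋ := fun _ Z =>
  Ring.inverse (1 - eval B Z) * (1 + eval B Z)

/-- `H = H_B`: `H^L(Z) = (I - B^L(Z))⁻¹ (I + B^L(Z))` on `Ω`, and
`H^R = (I - B^R)⁻¹ •_R (I + B^R)` with the inverse taken for the right product. -/
def IsCayley (B H : FreeSeries d (ℋ →L[ℂ] ℋ) × FreeSeries d (ℋ →L[ℂ] ℋ)) : Prop :=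
  (∀ (n : ℕ), ∀ Z ∈ ncBall d n, IsUnit (1 - eval B.1 Z) ∧ eval H.1 Z = cayleyFun B.1 n Z) ∧
    ∃ G, IsRInverse (const 1 - B.2) G ∧ H.2 = rmul G (const 1 + B.2)

/-- `B = B_H`: `B^L(Z) = (H^L(Z) + I)⁻¹ (H^L(Z) - I)` on `Ω`, and
`B^R = (H^R + I)⁻¹ •_R (H^R - I)` with the inverse taken for the right product. -/
def IsInverseCayley (H B : FreeSeries d (ℋ →L[ℂ] ℋ) × FreeSeries d (ℋ →L[ℂ] ℋ)) : Prop :=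
  (∀ (n : ℕ), ∀ Z ∈ ncBall d n, IsUnit (eval H.1 Z + 1) ∧
      eval B.1 Z = Ring.inverse (eval H.1 Z + 1) * (eval H.1 Z - 1)) ∧
    ∃ G, IsRInverse (H.2 + const 1) G ∧ B.2 = rmul G (H.2 - const 1)

end

/-! ### The free Herglotz formula -/

section

variable {d : ℕ}

/-- The formal series `Z L^* = ∑_k Z_k L_k^*`. -/
def shiftSeries (d : ℕ) : FreeSeries d (Fock d ℂ →L[ℂ] Fock d ℂ)
  | [k] => star (leftCreation k)
  | _ => 0

/-- The free Cauchy kernel `(I - Z L^*)⁻¹ = ∑_α Z^α (L^*)^α`. -/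
def cauchySeries (d : ℕ) : FreeSeries d (Fock d ℂ →L[ℂ] Fock d ℂ) := fun α =>
  wordPow (fun k => star (leftCreation k)) α

/-- The formal series `(I - Z L^*)⁻¹ (I + Z L^*)`. -/
def herglotzSeries (d : ℕ) : FreeSeries d (Fock d ℂ →L[ℂ] Fock d ℂ) :=
  lmul (cauchySeries d) (const 1 + shiftSeries d)

theorem shiftSeries_of_length_ne_one {α : Word d} (h : α.length ≠ 1) : shiftSeries d α = 0 := by
  match α, h with
  | [], _ => rfl
  | [k], h => exact absurd rfl h
  | _ :: _ :: _, _ => rfl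

theorem cauchySeries_mul_shiftSeries (α : Word d) (hα : α ≠ []) :
    lmul (cauchySeries d) (shiftSeries d) α = cauchySeries d α := by
  induction α using List.reverseRecOn with
  | nil => exact absurd rfl hα
  | append_singleton α k =>
    unfold lmul
    rw [Finset.sum_eq_single α.length]
    · simp [cauchySeries, wordPow, shiftSeries]
    · intro i hi hne
      have hi' : i < (α ++ [k]).length + 1 := Finset.mem_range.mp hi
      rw [shiftSeries_of_length_ne_one, mul_zero]
      rw [List.length_drop]
      simp only [List.length_append, List.length_singleton] at hi' ⊢
      omega
    · intro h
      simp at h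

theorem lmul_const_one {R : Type*} [Semiring R] (F : FreeSeries d R) : lmul F (const 1) = F := by
  funext γ
  unfold lmul
  rw [Finset.sum_eq_single γ.length]
  · simp [const]
  · intro i hi hne
    have hi' : i < γ.length + 1 := Finset.mem_range.mp hi
    have : γ.drop i ≠ [] := by
      rw [Ne, List.drop_eq_nil_iff]
      omega
    simp [const, this]
  · intro h
    simp at h

theorem lmul_add' {R : Type*} [Semiring R] (F G K : FreeSeries d R) :
    lmul F (G + K) = lmul F G + lmul F K := by
  funext γ
  simp [lmul, mul_add, Finset.sum_add_distrib]

theorem cauchySeries_mul_shiftSeries_nil :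
    lmul (cauchySeries d) (shiftSeries d) [] = 0 := by
  simp [lmul, shiftSeries]

/-- `cauchySeries` is the inverse of `I - Z L^*`. -/
theorem cauchySeries_mul_one_sub :
    lmul (cauchySeries d) (const 1 - shiftSeries d) = const 1 := by
  have h := lmul_add' (cauchySeries d) (const 1 - shiftSeries d) (shiftSeries d)
  rw [sub_add_cancel, lmul_const_one] at h
  rw [← sub_eq_iff_eq_add.mpr h]
  funext α
  by_cases hα : α = []
  · subst hα
    simp [cauchySeries_mul_shiftSeries_nil, cauchySeries, wordPow, const]
  · simp [cauchySeries_mul_shiftSeries α hα, const, hα]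

theorem herglotzSeries_eq (α : Word d) :
    herglotzSeries d α = if α = [] then 1 else (2 : ℂ) • cauchySeries d α := by
  unfold herglotzSeries
  rw [lmul_add', lmul_const_one, Pi.add_apply]
  by_cases hα : α = []
  · subst hα
    simp [cauchySeries_mul_shiftSeries_nil, cauchySeries, wordPow]
  · rw [cauchySeries_mul_shiftSeries α hα, if_neg hα, two_smul]

theorem star_wordPow {M : Type*} [Monoid M] [StarMul M] (Z : Fin d → M) (α : Word d) :
    star (wordPow Z α.reverse) = wordPow (fun k => star (Z k)) α := by
  induction α with
  | nil => simp [wordPow]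
  | cons k α ih =>
    simp only [wordPow, List.reverse_cons, List.map_append, List.map_cons, List.map_nil,
      List.prod_append, List.prod_cons, List.prod_nil, mul_one, star_mul] at ih ⊢
    rw [ih]

theorem wordPow_mem_diskAlgebra (α : Word d) : wordPow leftCreation α ∈ diskAlgebra d := by
  induction α with
  | nil => exact one_mem _
  | cons k α ih =>
    have hk : leftCreation k ∈ diskAlgebra d :=
      Subalgebra.le_topologicalClosure _ (Algebra.subset_adjoin ⟨k, rfl⟩)
    simpa [wordPow] using mul_mem hk ih

theorem cauchySeries_mem (α : Word d) : cauchySeries d α ∈ diskSystem d :=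
  Submodule.le_topologicalClosure _ (Submodule.subset_span
    (Or.inr ⟨_, wordPow_mem_diskAlgebra α.reverse, star_wordPow _ α⟩))

theorem herglotzSeries_mem (α : Word d) : herglotzSeries d α ∈ diskSystem d := by
  rw [herglotzSeries_eq]
  split_ifs with h
  · have := cauchySeries_mem (d := d) []
    simpa [cauchySeries, wordPow] using this
  · exact Submodule.smul_mem _ _ (cauchySeries_mem α)

variable {ℋ : Type*} [NormedAddCommGroup ℋ] [InnerProductSpace ℂ ℋ] [CompleteSpace ℋ]

/-- The series `φ((I - Z L^*)⁻¹ (I + Z L^*)) + i C`, with `φ` applied to the coefficients. -/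
def herglotzTransform (φ : diskSystem d →ₗ[ℂ] (ℋ →L[ℂ] ℋ)) (C : ℋ →L[ℂ] ℋ) :
    FreeSeries d (ℋ →L[ℂ] ℋ) :=
  (fun α => φ ⟨herglotzSeries d α, herglotzSeries_mem α⟩) + const (Complex.I • C)

/-- The operator `Z L^* = ∑_k Z_k ⊗ L_k^*` on `ℂⁿ ⊗ F²_d`. -/
def shiftAt {n : ℕ} (Z : Fin d → Matrix (Fin n) (Fin n) ℂ) :
    Matrix (Fin n) (Fin n) (Fock d ℂ →L[ℂ] Fock d ℂ) :=
  ∑ k, tensor (Z k) (star (leftCreation k))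

/-- The Herglotz formula with values:
`f(Z) = (id_n ⊗ φ)((I - Z L^*)⁻¹ (I + Z L^*)) + i (I_n ⊗ C)` for all `Z ∈ Ω`. That the argument of
`id_n ⊗ φ` has its matrix entries in the free disk operator system is part of the assertion. -/
def HerglotzFormulaAt (φ : diskSystem d →ₗ[ℂ] (ℋ →L[ℂ] ℋ)) (C : ℋ →L[ℂ] ℋ)
    (f : GradedFun d ℋ) : Prop :=
  ∀ (n : ℕ), ∀ Z ∈ ncBall d n, IsUnit (1 - shiftAt Z) ∧
    ∃ X : Matrix (Fin n) (Fin n) (diskSystem d),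
      X.map (fun x => (x : Fock d ℂ →L[ℂ] Fock d ℂ)) =
        Ring.inverse (1 - shiftAt Z) * (1 + shiftAt Z) ∧
      f n Z = X.map φ + Complex.I • tensor 1 C

/-- `Im T = (T - T^*) / (2i)`. -/
def im (T : ℋ →L[ℂ] ℋ) : ℋ →L[ℂ] ℋ := (2 * Complex.I)⁻¹ • (T - star T)

/-- `φ` is an Aleksandrov–Clark map of `B = (B^L, B^R)`: on `Ω`,
`(I - B^L(Z))⁻¹ (I + B^L(Z)) = φ((I - Z L^*)⁻¹ (I + Z L^*)) + i C` with
`C = Im ((I - B_∅)⁻¹ (I + B_∅))`. -/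
def IsACMap (φ : diskSystem d →ₗ[ℂ] (ℋ →L[ℂ] ℋ))
    (B : FreeSeries d (ℋ →L[ℂ] ℋ) × FreeSeries d (ℋ →L[ℂ] ℋ)) : Prop :=
  HerglotzFormulaAt φ (im (Ring.inverse (1 - B.1 []) * (1 + B.1 []))) (cayleyFun B.1)

end

end FreeAC

end

open FreeAC

/-! All the analysis is reduced to formal series acting by left multiplication on arbitrary families
of vectors indexed by words. The value of such an action at `γ` involves only suffixes of `γ`, so
the action compresses to the words of length less than `N` for each `N`. A left Schur series is one
whose compressions are contractive (`IsContractiveAct`); positivity of the Herglotz kernel says that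
the compressions are accretive (`IsAccretiveAct`, `isPosKernel_leftHerglotzKernel_iff`).
Right-handed statements follow by transposition.

For (1), `B` and `H` are linked by `CayleyRel`, that is `(1 - B)(1 + H) = 2 = (1 + H)(1 - B)`. Such
a partner exists as soon as a constant coefficient is invertible, and `re_inner_cayley` exchanges
contractive and accretive. Either property bounds the columns of coefficients of each degree
(`ColBdd`). Against the geometric decay of the powers of a strict row contraction this gives locally
uniform convergence on the ball, hence free holomorphy and multiplicativity of evaluation. Nilpotent
matrix points recover the coefficients (`ColBdd.ext_eval`), so identities of series and identities
of values are interchangeable.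

For (2), the kernel `K` of `H^R` satisfies `K(iα, jβ) = δ_ij K(α, β)`. Its Kolmogorov decomposition
therefore carries a row isometry `V` with `K(∅, γ) = w^* V^γ w` (`exists_rowIsometry`). The
assignment `L^γ ↦ w^* V^γ w` extends to a completely positive map: Fejér-type means built from Gram
sums are completely positive and converge in norm on every `L^γ` (`exists_cpMap_of_rowIsometry`).
Uniqueness holds because completely positive maps are bounded and preserve adjoints, hence are
determined by the values at the `L^γ`. Conversely `φ((L^α)^* L^β)` is a positive kernel with the
same recursion (`cpMaps.rightHerglotzKernel_eq`), so every `φ` produces a Herglotz pair.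

For (3), the Cayley transform of `B` and its constant coefficient are those of the Herglotz pair, so
the two defining formulas agree. -/

noncomputable section

set_option linter.unusedSectionVars false

namespace FreeAC

/-! ### Finite sets of words -/

section Words

variable {d : ℕ} {M : Type*} [AddCommMonoid M]

/-- The words of length `k`. -/
def wordsOf (d k : ℕ) : Finset (Word d) :=
  Finset.univ.image (List.ofFn : (Fin k → Fin d) → Word d)

@[simp]
theorem mem_wordsOf {k : ℕ} {α : Word d} : α ∈ wordsOf d k ↔ α.length = k := by
  constructor
  · intro h
    obtain ⟨w, -, rfl⟩ := Finset.mem_image.mp h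
    simp
  · rintro rfl
    exact Finset.mem_image.mpr ⟨fun i => α.get i, Finset.mem_univ _, List.ofFn_get α⟩

theorem sum_ofFn (k : ℕ) (f : Word d → M) :
    ∑ w : Fin k → Fin d, f (List.ofFn w) = ∑ α ∈ wordsOf d k, f α := by
  rw [wordsOf, Finset.sum_image]
  exact fun _ _ _ _ h => List.ofFn_injective h

theorem sum_wordsOf_zero (f : Word d → M) : ∑ α ∈ wordsOf d 0, f α = f [] := by
  have : wordsOf d 0 = {[]} := by ext; simp
  rw [this, Finset.sum_singleton]

theorem sum_wordsOf_succ (k : ℕ) (f : Word d → M) :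
    ∑ α ∈ wordsOf d (k + 1), f α = ∑ i, ∑ α ∈ wordsOf d k, f (i :: α) := by
  rw [← Finset.sum_product']
  symm
  refine Finset.sum_bij (fun p _ => p.1 :: p.2) ?_ ?_ ?_ ?_
  · rintro ⟨i, α⟩ h
    simpa using h
  · rintro ⟨i, α⟩ _ ⟨j, β⟩ _ h
    simpa using h
  · rintro (_ | ⟨i, α⟩) h
    · simp at h
    · exact ⟨(i, α), by simpa using h, rfl⟩
  · intro _ _
    rfl

theorem sum_wordsOf_add (p q : ℕ) (f : Word d → Word d → M) :
    ∑ γ ∈ wordsOf d (p + q), f (γ.take p) (γ.drop p) =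
      ∑ α ∈ wordsOf d p, ∑ β ∈ wordsOf d q, f α β := by
  rw [← Finset.sum_product']
  symm
  refine Finset.sum_bij (fun x _ => x.1 ++ x.2) ?_ ?_ ?_ ?_
  · rintro ⟨α, β⟩ h
    have h := Finset.mem_product.mp h
    simp only [mem_wordsOf] at h
    simp [h.1, h.2]
  · rintro ⟨α, β⟩ h ⟨α', β'⟩ h' he
    have h := Finset.mem_product.mp h
    have h' := Finset.mem_product.mp h'
    simp only [mem_wordsOf] at h h'
    obtain ⟨h1, h2⟩ := List.append_inj he (h.1.trans h'.1.symm)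
    simp only at h1 h2
    rw [h1, h2]
  · intro γ hγ
    rw [mem_wordsOf] at hγ
    refine ⟨(γ.take p, γ.drop p), ?_, List.take_append_drop p γ⟩
    simp only [Finset.mem_product, mem_wordsOf, List.length_take, List.length_drop]
    omega
  · rintro ⟨α, β⟩ h
    have h := Finset.mem_product.mp h
    simp only [mem_wordsOf] at h
    simp [← h.1]

theorem sum_wordsOf_reverse (k : ℕ) (f : Word d → M) :
    ∑ α ∈ wordsOf d k, f α.reverse = ∑ α ∈ wordsOf d k, f α :=
  Finset.sum_nbij' List.reverse List.reverse (by simp) (by simp) (by simp) (by simp) (by simp)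

/-- The words of length less than `N`. -/
def wordsLt (d N : ℕ) : Finset (Word d) := (Finset.range N).biUnion (wordsOf d)

@[simp]
theorem mem_wordsLt {N : ℕ} {α : Word d} : α ∈ wordsLt d N ↔ α.length < N := by
  simp [wordsLt]

theorem sum_wordsLt (N : ℕ) (f : Word d → M) :
    ∑ α ∈ wordsLt d N, f α = ∑ k ∈ Finset.range N, ∑ α ∈ wordsOf d k, f α := by
  rw [wordsLt, Finset.sum_biUnion]
  intro i _ j _ hij
  refine Finset.disjoint_left.mpr fun α hi hj => hij ?_
  rw [mem_wordsOf] at hi hj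
  exact hi.symm.trans hj

theorem sum_wordsLt_reverse (N : ℕ) (f : Word d → M) :
    ∑ α ∈ wordsLt d N, f α.reverse = ∑ α ∈ wordsLt d N, f α :=
  Finset.sum_nbij' List.reverse List.reverse (by simp) (by simp) (by simp) (by simp) (by simp)

theorem exists_subset_wordsLt (s : Finset (Word d)) : ∃ N, s ⊆ wordsLt d N := by
  refine ⟨s.sup List.length + 1, fun α hα => ?_⟩
  rw [mem_wordsLt]
  exact Nat.lt_succ_of_le (Finset.le_sup (f := List.length) hα)

end Words

/-! ### The action of free series on families indexed by words -/

section Action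

variable {d : ℕ} {R : Type*} [Ring R] {M : Type*} [AddCommGroup M] [Module R M]

/-- The action of a free series by left multiplication: `(F f)_γ = ∑_{αβ = γ} F_α f_β`. -/
def lact (F : FreeSeries d R) (f : Word d → M) : Word d → M := fun γ =>
  ∑ i ∈ Finset.range (γ.length + 1), F (γ.take i) • f (γ.drop i)

theorem lmul_eq_lact (F G : FreeSeries d R) : lmul F G = lact F G := rfl

/-- The series `∑ Z^α F_{kα}`. -/
def shiftCoeff (k : Fin d) (F : Word d → M) : Word d → M := fun α => F (k :: α)

@[simp]
theorem lact_nil (F : FreeSeries d R) (f : Word d → M) : lact F f [] = F [] • f [] := by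
  simp [lact]

/-- A prefix of `k :: γ` is either empty or starts with `k`. This recursion on the first letter
takes the place of reindexing factorizations. -/
theorem lact_cons (F : FreeSeries d R) (f : Word d → M) (k : Fin d) (γ : Word d) :
    lact F f (k :: γ) = F [] • f (k :: γ) + lact (shiftCoeff k F) f γ := by
  simp only [lact, List.length_cons]
  rw [Finset.sum_range_succ', add_comm]
  simp [shiftCoeff]

theorem lact_add (F : FreeSeries d R) (f g : Word d → M) :
    lact F (f + g) = lact F f + lact F g := by
  funext γ
  simp [lact, smul_add, Finset.sum_add_distrib]

theorem lact_sub (F : FreeSeries d R) (f g : Word d → M) :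
    lact F (f - g) = lact F f - lact F g := by
  funext γ
  simp [lact, smul_sub, Finset.sum_sub_distrib]

theorem add_lact (F G : FreeSeries d R) (f : Word d → M) :
    lact (F + G) f = lact F f + lact G f := by
  funext γ
  simp [lact, add_smul, Finset.sum_add_distrib]

theorem sub_lact (F G : FreeSeries d R) (f : Word d → M) :
    lact (F - G) f = lact F f - lact G f := by
  funext γ
  simp [lact, sub_smul, Finset.sum_sub_distrib]

theorem smul_lact (a : R) (F : FreeSeries d R) (f : Word d → M) :
    lact (a • F) f = a • lact F f := by
  funext γ
  simp [lact, Finset.smul_sum, mul_smul]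

theorem lact_const (a : R) (f : Word d → M) : lact (const a) f = a • f := by
  funext γ
  rw [lact, Finset.sum_eq_single 0]
  · simp [const]
  · intro i hi h0
    have : γ.take i ≠ [] := by
      intro h
      have h1 := congrArg List.length h
      have h2 := Finset.mem_range.mp hi
      simp only [List.length_take, List.length_nil] at h1
      have h3 : γ.length = 0 ∨ i = 0 := by omega
      omega
    simp [const, this]
  · simp

theorem one_lact (f : Word d → M) : lact (const 1 : FreeSeries d R) f = f := by
  rw [lact_const, one_smul]

theorem lact_lmul (F G : FreeSeries d R) (f : Word d → M) :
    lact (lmul F G) f = lact F (lact G f) := by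
  funext γ
  -- `F` varies because removing the first letter of the word replaces `F` by `shiftCoeff k F`.
  induction γ generalizing F with
  | nil => simp [lmul_eq_lact, mul_smul]
  | cons k γ ih =>
    have h : shiftCoeff k (lmul F G) = F [] • shiftCoeff k G + lmul (shiftCoeff k F) G := by
      funext α
      exact lact_cons F G k α
    rw [lact_cons, lact_cons, h, add_lact, smul_lact, Pi.add_apply, ih, lact_cons G,
      lmul_eq_lact, lact_nil, smul_eq_mul, mul_smul, Pi.smul_apply, smul_add, add_assoc]

/-- Locality of the action: only suffixes of `γ` matter. This is what makes truncation to short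
words harmless. -/
theorem lact_congr {F : FreeSeries d R} {f g : Word d → M} {γ : Word d}
    (h : ∀ i, f (γ.drop i) = g (γ.drop i)) : lact F f γ = lact F g γ :=
  Finset.sum_congr rfl fun i _ => by rw [h]

theorem lmul_assoc (F G K : FreeSeries d R) : lmul (lmul F G) K = lmul F (lmul G K) :=
  lact_lmul F G K

theorem const_one_lmul (F : FreeSeries d R) : lmul (const 1) F = F :=
  (lmul_eq_lact _ _).trans (one_lact F)

theorem lmul_sub (F G K : FreeSeries d R) : lmul F (G - K) = lmul F G - lmul F K :=
  lact_sub F G K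

/-- The right inverse of a series with constant coefficient `a⁻¹`. -/
def invSeries (a : R) (F : FreeSeries d R) : FreeSeries d R
  | [] => a
  | k :: γ => -a * ∑ i ∈ Finset.range (γ.length + 1), F (k :: γ.take i) *
      invSeries a F (γ.drop i)
termination_by γ => γ.length
decreasing_by
  simp only [List.length_drop, List.length_cons]
  omega

theorem lmul_invSeries {a : R} {F : FreeSeries d R} (h : F [] * a = 1) :
    lmul F (invSeries a F) = const 1 := by
  funext γ
  cases γ with
  | nil => simp [lmul, invSeries, h, const]
  | cons k γ =>
    rw [lmul_eq_lact, lact_cons, invSeries, smul_eq_mul, neg_mul, mul_neg, ← mul_assoc, h,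
      one_mul]
    simp [lact, shiftCoeff, const]

theorem left_eq_right_inv {F G K : FreeSeries d R} (h : lmul G F = const 1)
    (h' : lmul F K = const 1) : G = K := by
  rw [← lmul_const_one G, ← h', ← lmul_assoc, h, const_one_lmul]

/-- The right inverse of `F` has an invertible constant coefficient, hence a right inverse of its
own, which associativity identifies with `F`. -/
theorem exists_lmul_inverse {F : FreeSeries d R} (h : IsUnit (F [])) :
    ∃ G, lmul F G = const 1 ∧ lmul G F = const 1 := by
  obtain ⟨u, hu⟩ := h
  have h1 : lmul F (invSeries (↑u⁻¹ : R) F) = const 1 :=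
    lmul_invSeries (by rw [← hu, Units.mul_inv])
  have h2 : lmul (invSeries (↑u⁻¹ : R) F) (invSeries (u : R) (invSeries (↑u⁻¹ : R) F)) = const 1 :=
    lmul_invSeries (by simp [invSeries])
  have h3 := left_eq_right_inv h1 h2
  exact ⟨_, h1, by rwa [← h3] at h2⟩

/-! ### Transposition -/

theorem transpose_const (a : R) : transpose (const a : FreeSeries d R) = const a := by
  funext α
  simp [transpose, const]

/-- Reversal turns suffixes into prefixes and the cut `i` into `|γ| - i`. The right action of the
transpose is thus the left action conjugated by reversal, and the right-handed statements reduce to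
left-handed ones through this identity. -/
theorem sum_reverse_drop (F : FreeSeries d R) (f : Word d → M) (γ : Word d) :
    ∑ i ∈ Finset.range (γ.length + 1), transpose F (γ.drop i) • f (γ.take i) =
      lact F (fun α => f α.reverse) γ.reverse := by
  rw [lact, List.length_reverse, ← Finset.sum_range_reflect]
  refine Finset.sum_congr rfl fun i hi => ?_
  have hi := Finset.mem_range.mp hi
  rw [transpose, List.reverse_drop, List.drop_reverse, List.reverse_reverse]
  congr 3
  omega

theorem rmul_transpose (F G : FreeSeries d R) :
    rmul (transpose F) (transpose G) = transpose (lmul F G) := by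
  funext γ
  refine (sum_reverse_drop F (transpose G) γ).trans ?_
  simp [transpose, lmul_eq_lact]

theorem transpose_add (F G : FreeSeries d R) :
    transpose (F + G) = transpose F + transpose G := rfl

theorem transpose_sub (F G : FreeSeries d R) :
    transpose (F - G) = transpose F - transpose G := rfl

theorem isRInverse_transpose {F G : FreeSeries d R} (h : lmul F G = const 1)
    (h' : lmul G F = const 1) : IsRInverse (transpose F) (transpose G) := by
  refine ⟨?_, ?_⟩
  · rw [rmul_transpose, h, transpose_const]
  · rw [rmul_transpose, h', transpose_const]

end Action

/-! ### Powers of strict row contractions -/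

section RowBall

open Matrix

variable {d n : ℕ}

/-- The squared Euclidean norm of the column `Z^* x`. -/
def rowSq (Z : Fin d → Matrix (Fin n) (Fin n) ℂ) (x : Fin n → ℂ) : ℝ :=
  ∑ k, ∑ i, ‖((Z k)ᴴ *ᵥ x) i‖ ^ 2

/-- Tuples with `‖Z^* x‖ ≤ r ‖x‖` for all `x`. -/
def rowBall (d n : ℕ) (r : ℝ) : Set (Fin d → Matrix (Fin n) (Fin n) ℂ) :=
  {Z | ∀ x : Fin n → ℂ, rowSq Z x ≤ r ^ 2 * ∑ i, ‖x i‖ ^ 2}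

theorem wordPow_cons {M : Type*} [Monoid M] (Z : Fin d → M) (k : Fin d) (α : Word d) :
    wordPow Z (k :: α) = Z k * wordPow Z α := by
  simp [wordPow]

theorem wordPow_append {M : Type*} [Monoid M] (Z : Fin d → M) (α β : Word d) :
    wordPow Z (α ++ β) = wordPow Z α * wordPow Z β := by
  simp [wordPow]

@[simp]
theorem wordPow_nil {M : Type*} [Monoid M] (Z : Fin d → M) : wordPow Z [] = 1 := by
  simp [wordPow]

/-- Peeling off the first letter applies the column contraction `Z^*` once more and costs a factor
`r²`. Summing squares over all words of length `m` keeps the number of words out of the bound. -/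
theorem sum_wordPow_conjTranspose_mulVec_le {Z : Fin d → Matrix (Fin n) (Fin n) ℂ} {r : ℝ}
    (hZ : Z ∈ rowBall d n r) (m : ℕ) (x : Fin n → ℂ) :
    ∑ α ∈ wordsOf d m, ∑ i, ‖((wordPow Z α)ᴴ *ᵥ x) i‖ ^ 2 ≤ (r ^ 2) ^ m * ∑ i, ‖x i‖ ^ 2 := by
  induction m generalizing x with
  | zero => simp [sum_wordsOf_zero]
  | succ m ih =>
    rw [sum_wordsOf_succ]
    calc _ = ∑ k, ∑ α ∈ wordsOf d m, ∑ i, ‖((wordPow Z α)ᴴ *ᵥ ((Z k)ᴴ *ᵥ x)) i‖ ^ 2 := by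
          simp [wordPow_cons, Matrix.conjTranspose_mul]
      _ ≤ ∑ k, (r ^ 2) ^ m * ∑ i, ‖((Z k)ᴴ *ᵥ x) i‖ ^ 2 := Finset.sum_le_sum fun k _ => ih _
      _ = (r ^ 2) ^ m * rowSq Z x := by rw [← Finset.mul_sum, rowSq]
      _ ≤ (r ^ 2) ^ m * (r ^ 2 * ∑ i, ‖x i‖ ^ 2) :=
          mul_le_mul_of_nonneg_left (hZ x) (by positivity)
      _ = _ := by ring

theorem sum_wordPow_apply_le {Z : Fin d → Matrix (Fin n) (Fin n) ℂ} {r : ℝ}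
    (hZ : Z ∈ rowBall d n r) (m : ℕ) (i j : Fin n) :
    ∑ α ∈ wordsOf d m, ‖wordPow Z α i j‖ ^ 2 ≤ (r ^ 2) ^ m := by
  have h := sum_wordPow_conjTranspose_mulVec_le hZ m (Pi.single i 1)
  have h1 : ∑ l, ‖(Pi.single i 1 : Fin n → ℂ) l‖ ^ 2 = 1 := by
    rw [Finset.sum_eq_single i] <;> simp +contextual
  rw [h1, mul_one] at h
  refine le_trans (Finset.sum_le_sum fun α _ => ?_) h
  have h2 : ‖wordPow Z α i j‖ = ‖((wordPow Z α)ᴴ *ᵥ Pi.single i 1) j‖ := by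
    simp [Matrix.conjTranspose_apply]
  rw [h2]
  exact Finset.single_le_sum
    (f := fun l => ‖((wordPow Z α)ᴴ *ᵥ (Pi.single i 1 : Fin n → ℂ)) l‖ ^ 2)
    (fun l _ => by positivity) (Finset.mem_univ j)

theorem dotProduct_one_sub_mulVec (Z : Fin d → Matrix (Fin n) (Fin n) ℂ) (x : Fin n → ℂ) :
    star x ⬝ᵥ ((1 - ∑ k, Z k * (Z k)ᴴ) *ᵥ x) = ((∑ i, ‖x i‖ ^ 2 - rowSq Z x : ℝ) : ℂ) := by
  have hsq : ∀ y : Fin n → ℂ, star y ⬝ᵥ y = ((∑ i, ‖y i‖ ^ 2 : ℝ) : ℂ) := by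
    intro y
    simp [dotProduct, Complex.conj_mul']
  have hk : ∀ k, star x ⬝ᵥ ((Z k * (Z k)ᴴ) *ᵥ x) = ((∑ i, ‖((Z k)ᴴ *ᵥ x) i‖ ^ 2 : ℝ) : ℂ) := by
    intro k
    rw [← hsq, ← Matrix.mulVec_mulVec, Matrix.dotProduct_mulVec, Matrix.star_mulVec,
      Matrix.conjTranspose_conjTranspose]
  rw [Matrix.sub_mulVec, Matrix.one_mulVec, dotProduct_sub, hsq, Matrix.sum_mulVec,
    dotProduct_sum, Finset.sum_congr rfl fun k _ => hk k, rowSq]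
  push_cast
  rfl

theorem continuous_rowSq :
    Continuous fun p : (Fin d → Matrix (Fin n) (Fin n) ℂ) × (Fin n → ℂ) => rowSq p.1 p.2 := by
  unfold rowSq
  fun_prop

theorem rowSq_smul (Z : Fin d → Matrix (Fin n) (Fin n) ℂ) (t : ℂ) (x : Fin n → ℂ) :
    rowSq Z (t • x) = ‖t‖ ^ 2 * rowSq Z x := by
  simp [rowSq, Matrix.mulVec_smul, mul_pow, Finset.mul_sum]

/-- The unit sphere of `ℂⁿ`. -/
def unitSphere (n : ℕ) : Set (Fin n → ℂ) := {x | ∑ i, ‖x i‖ ^ 2 = 1}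

theorem isCompact_unitSphere (n : ℕ) : IsCompact (unitSphere n) := by
  refine Metric.isCompact_of_isClosed_isBounded
    (isClosed_eq (by fun_prop) continuous_const) ?_
  refine (Metric.isBounded_iff_subset_closedBall 0).mpr ⟨1, fun x hx => ?_⟩
  rw [mem_closedBall_zero_iff, pi_norm_le_iff_of_nonneg zero_le_one]
  intro i
  have h1 : ‖x i‖ ^ 2 ≤ ∑ i, ‖x i‖ ^ 2 :=
    Finset.single_le_sum (f := fun i => ‖x i‖ ^ 2) (fun l _ => by positivity)
      (Finset.mem_univ i)
  rw [show ∑ i, ‖x i‖ ^ 2 = 1 from hx] at h1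
  exact (sq_le_one_iff₀ (norm_nonneg _)).mp h1

theorem mem_rowBall_of_forall_unitSphere {W : Fin d → Matrix (Fin n) (Fin n) ℂ} {r : ℝ}
    (hW : ∀ x ∈ unitSphere n, rowSq W x ≤ r ^ 2) : W ∈ rowBall d n r := by
  intro x
  by_cases hx : ∑ i, ‖x i‖ ^ 2 = 0
  · have : x = 0 := by
      funext i
      have := (Finset.sum_eq_zero_iff_of_nonneg fun i _ => by positivity).mp hx i
        (Finset.mem_univ i)
      simpa using this
    simp [this, rowSq]
  · have hpos : 0 < ∑ i, ‖x i‖ ^ 2 :=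
      lt_of_le_of_ne (Finset.sum_nonneg fun i _ => by positivity) (Ne.symm hx)
    generalize hs : ∑ i, ‖x i‖ ^ 2 = s at hx hpos ⊢
    have ht : ‖(((√s)⁻¹ : ℝ) : ℂ)‖ ^ 2 = s⁻¹ := by
      rw [Complex.norm_real, Real.norm_eq_abs, sq_abs, inv_pow, Real.sq_sqrt hpos.le]
    have hmem : ((((√s)⁻¹ : ℝ) : ℂ) • x) ∈ unitSphere n := by
      simp only [unitSphere, Set.mem_ofPred_eq, Pi.smul_apply, norm_smul, mul_pow, ht,
        ← Finset.mul_sum, hs]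
      exact inv_mul_cancel₀ hx
    have h := hW _ hmem
    rw [rowSq_smul, ht, inv_mul_le_iff₀ hpos] at h
    linarith

theorem rowSq_lt_one {Z : Fin d → Matrix (Fin n) (Fin n) ℂ} (hZ : Z ∈ ncBall d n)
    {x : Fin n → ℂ} (hx : x ∈ unitSphere n) : rowSq Z x < 1 := by
  have hx1 : ∑ i, ‖x i‖ ^ 2 = 1 := hx
  have hx0 : x ≠ 0 := by
    rintro rfl
    simp at hx1
  have h := Matrix.PosDef.dotProduct_mulVec_pos hZ hx0
  rw [dotProduct_one_sub_mulVec, Complex.zero_lt_real, hx1] at h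
  linarith

/-- On the compact unit sphere the strict inequality has a positive gap, and compactness also makes
it stable near `Z`. One radius `r < 1` then serves a whole neighbourhood. -/
theorem eventually_mem_rowBall {Z : Fin d → Matrix (Fin n) (Fin n) ℂ} (hZ : Z ∈ ncBall d n) :
    ∃ r : ℝ, 0 ≤ r ∧ r < 1 ∧ ∀ᶠ W in 𝓝 Z, W ∈ rowBall d n r := by
  have hcont : Continuous fun x : Fin n → ℂ => 1 - rowSq Z x := by
    unfold rowSq
    fun_prop
  obtain ⟨a, ha, hSa⟩ := (isCompact_unitSphere n).exists_forall_le' (a := 0) hcont.continuousOn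
    fun x hx => sub_pos.mpr (rowSq_lt_one hZ hx)
  -- The maximum with `0` covers `n = 0`: the sphere is then empty and `a` may be large.
  -- Nonnegativity of `b` is needed for its square root.
  have hb : ∃ b : ℝ, 0 ≤ b ∧ b < 1 ∧ 1 - a < b :=
    ⟨max (1 - a / 2) 0, le_max_right _ _, max_lt (by linarith) zero_lt_one,
      lt_of_lt_of_le (by linarith) (le_max_left _ _)⟩
  obtain ⟨b, hb0, hb1, hab⟩ := hb
  have hev : ∀ᶠ W in 𝓝 Z, ∀ x ∈ unitSphere n, rowSq W x < b := by
    refine (isCompact_unitSphere n).eventually_forall_of_forall_eventually fun x hx => ?_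
    exact (isOpen_lt continuous_rowSq continuous_const).mem_nhds
      (show rowSq Z x < b by linarith [hSa x hx])
  refine ⟨√b, Real.sqrt_nonneg _, by rwa [Real.sqrt_lt' one_pos, one_pow], hev.mono ?_⟩
  intro W hW
  refine mem_rowBall_of_forall_unitSphere fun x hx => ?_
  rw [Real.sq_sqrt hb0]
  exact (hW x hx).le

end RowBall

/-! ### Series with bounded homogeneous coefficient columns -/

section ColBdd

variable {d : ℕ} {ℋ : Type*} [NormedAddCommGroup ℋ] [InnerProductSpace ℂ ℋ]

/-- The columns of the coefficients of fixed degree are uniformly bounded. -/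
def ColBdd (F : FreeSeries d (ℋ →L[ℂ] ℋ)) : Prop :=
  ∃ C : ℝ, 0 ≤ C ∧ ∀ (k : ℕ) (h : ℋ), ∑ α ∈ wordsOf d k, ‖F α h‖ ^ 2 ≤ C * ‖h‖ ^ 2

theorem ColBdd.transpose {F : FreeSeries d (ℋ →L[ℂ] ℋ)} (hF : ColBdd F) :
    ColBdd (transpose F) := by
  obtain ⟨C, hC, h⟩ := hF
  refine ⟨C, hC, fun k x => ?_⟩
  rw [← sum_wordsOf_reverse]
  simpa [FreeAC.transpose] using h k x

theorem ColBdd.add {F G : FreeSeries d (ℋ →L[ℂ] ℋ)} (hF : ColBdd F) (hG : ColBdd G) :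
    ColBdd (F + G) := by
  obtain ⟨C, hC, h⟩ := hF
  obtain ⟨C', hC', h'⟩ := hG
  refine ⟨2 * C + 2 * C', by positivity, fun k x => ?_⟩
  calc _ ≤ ∑ α ∈ wordsOf d k, (2 * ‖F α x‖ ^ 2 + 2 * ‖G α x‖ ^ 2) := by
        refine Finset.sum_le_sum fun α _ => ?_
        have h1 := norm_add_le (F α x) (G α x)
        have h2 := sq_nonneg (‖F α x‖ - ‖G α x‖)
        have h3 : ‖(F + G) α x‖ ^ 2 ≤ (‖F α x‖ + ‖G α x‖) ^ 2 :=
          pow_le_pow_left₀ (norm_nonneg _) h1 2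
        nlinarith
    _ = 2 * ∑ α ∈ wordsOf d k, ‖F α x‖ ^ 2 + 2 * ∑ α ∈ wordsOf d k, ‖G α x‖ ^ 2 := by
        rw [Finset.sum_add_distrib, Finset.mul_sum, Finset.mul_sum]
    _ ≤ 2 * (C * ‖x‖ ^ 2) + 2 * (C' * ‖x‖ ^ 2) := by
        linarith [h k x, h' k x]
    _ = _ := by ring

theorem ColBdd.smul {F : FreeSeries d (ℋ →L[ℂ] ℋ)} (hF : ColBdd F) (c : ℂ) :
    ColBdd (c • F) := by
  obtain ⟨C, hC, h⟩ := hF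
  refine ⟨‖c‖ ^ 2 * C, by positivity, fun k x => ?_⟩
  simp only [Pi.smul_apply, _root_.smul_apply, norm_smul, mul_pow, ← Finset.mul_sum, mul_assoc]
  exact mul_le_mul_of_nonneg_left (h k x) (by positivity)

theorem ColBdd.sub {F G : FreeSeries d (ℋ →L[ℂ] ℋ)} (hF : ColBdd F) (hG : ColBdd G) :
    ColBdd (F - G) := by
  have := hF.add (hG.smul (-1))
  rwa [neg_one_smul, ← sub_eq_add_neg] at this

theorem colBdd_of_length_le {F : FreeSeries d (ℋ →L[ℂ] ℋ)} (N : ℕ)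
    (hF : ∀ α : Word d, N ≤ α.length → F α = 0) : ColBdd F := by
  refine ⟨∑ α ∈ wordsLt d N, ‖F α‖ ^ 2, by positivity, fun k x => ?_⟩
  rw [Finset.sum_mul]
  by_cases hk : k < N
  · have hsub : wordsOf d k ⊆ wordsLt d N := fun α hα => by
      rw [mem_wordsOf] at hα
      rw [mem_wordsLt]
      omega
    refine le_trans (Finset.sum_le_sum fun α _ => ?_)
      (Finset.sum_le_sum_of_subset_of_nonneg hsub fun α _ _ => by positivity)
    rw [← mul_pow]
    exact pow_le_pow_left₀ (norm_nonneg _) ((F α).le_opNorm x) 2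
  · rw [Finset.sum_eq_zero]
    · positivity
    · intro α hα
      rw [mem_wordsOf] at hα
      simp [hF α (by omega)]

theorem colBdd_const (a : ℋ →L[ℂ] ℋ) : ColBdd (const a : FreeSeries d (ℋ →L[ℂ] ℋ)) :=
  colBdd_of_length_le 1 fun α hα => by
    have : α ≠ [] := by
      rintro rfl
      simp at hα
    simp [const, this]

variable {n : ℕ}

theorem homPart_apply (F : FreeSeries d (ℋ →L[ℂ] ℋ)) (k : ℕ)
    (Z : Fin d → Matrix (Fin n) (Fin n) ℂ) (i j : Fin n) :
    homPart F k Z i j = ∑ α ∈ wordsOf d k, wordPow Z α i j • F α := by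
  rw [homPart, sum_ofFn k fun α => tensor (wordPow Z α) (F α), Matrix.sum_apply]
  rfl

theorem homPart_eq (F : FreeSeries d (ℋ →L[ℂ] ℋ)) (k : ℕ)
    (Z : Fin d → Matrix (Fin n) (Fin n) ℂ) :
    homPart F k Z = ∑ α ∈ wordsOf d k, tensor (wordPow Z α) (F α) :=
  sum_ofFn k fun α => tensor (wordPow Z α) (F α)

/-- After application to a vector, Cauchy–Schwarz separates the scalars `Z^α`, of square sum at most
`r^{2k}`, from the coefficient column. -/
theorem norm_homPart_apply_le {F : FreeSeries d (ℋ →L[ℂ] ℋ)} {C : ℝ}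
    (hF : ∀ (k : ℕ) (h : ℋ), ∑ α ∈ wordsOf d k, ‖F α h‖ ^ 2 ≤ C * ‖h‖ ^ 2) {r : ℝ} (hr : 0 ≤ r)
    {Z : Fin d → Matrix (Fin n) (Fin n) ℂ} (hZ : Z ∈ rowBall d n r) (k : ℕ) (i j : Fin n) :
    ‖homPart F k Z i j‖ ≤ √C * r ^ k := by
  refine ContinuousLinearMap.opNorm_le_bound _ (by positivity) fun h => ?_
  rw [homPart_apply, FunLike.coe_sum, Finset.sum_apply]
  calc _ ≤ ∑ α ∈ wordsOf d k, ‖wordPow Z α i j‖ * ‖F α h‖ := by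
        refine (norm_sum_le _ _).trans (Finset.sum_le_sum fun α _ => ?_)
        rw [_root_.smul_apply, norm_smul]
    _ ≤ √(∑ α ∈ wordsOf d k, ‖wordPow Z α i j‖ ^ 2) * √(∑ α ∈ wordsOf d k, ‖F α h‖ ^ 2) :=
        Real.sum_mul_le_sqrt_mul_sqrt _ _ _
    _ ≤ √((r ^ 2) ^ k) * √(C * ‖h‖ ^ 2) := by
        gcongr
        · exact sum_wordPow_apply_le hZ k i j
        · exact hF k h
    _ = _ := by
        rw [Real.sqrt_mul' _ (by positivity), Real.sqrt_sq (norm_nonneg _), ← pow_mul,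
          mul_comm 2 k, pow_mul, Real.sqrt_sq (by positivity)]
        ring

end ColBdd

/-! ### Evaluation of series with bounded columns -/

section Evaluation

variable {d : ℕ} {ℋ : Type*} [NormedAddCommGroup ℋ] [InnerProductSpace ℂ ℋ] [CompleteSpace ℋ]
variable {n : ℕ}

/-- A single summable majorant near `Z` serves convergence, local boundedness and, through
Weierstrass, differentiability. -/
theorem ColBdd.exists_eventually_norm_le {F : FreeSeries d (ℋ →L[ℂ] ℋ)} (hF : ColBdd F)
    {Z : Fin d → Matrix (Fin n) (Fin n) ℂ} (hZ : Z ∈ ncBall d n) :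
    ∃ u : ℕ → ℝ, Summable u ∧
      ∀ᶠ W in 𝓝 Z, ∀ k i j, ‖homPart F k W i j‖ ≤ u k := by
  obtain ⟨C, -, hC⟩ := hF
  obtain ⟨r, hr0, hr1, hev⟩ := eventually_mem_rowBall hZ
  refine ⟨fun k => √C * r ^ k, (summable_geometric_of_lt_one hr0 hr1).mul_left _,
    hev.mono fun W hW k i j => norm_homPart_apply_le hC hr0 hW k i j⟩

theorem ColBdd.summable_norm {F : FreeSeries d (ℋ →L[ℂ] ℋ)} (hF : ColBdd F)
    {Z : Fin d → Matrix (Fin n) (Fin n) ℂ} (hZ : Z ∈ ncBall d n) (i j : Fin n) :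
    Summable fun k => ‖homPart F k Z i j‖ := by
  obtain ⟨u, hu, h⟩ := hF.exists_eventually_norm_le hZ
  exact hu.of_nonneg_of_le (fun _ => norm_nonneg _) fun k => h.self_of_nhds k i j

theorem ColBdd.summable {F : FreeSeries d (ℋ →L[ℂ] ℋ)} (hF : ColBdd F)
    {Z : Fin d → Matrix (Fin n) (Fin n) ℂ} (hZ : Z ∈ ncBall d n) :
    Summable fun k => homPart F k Z :=
  Pi.summable.mpr fun i => Pi.summable.mpr fun j => (hF.summable_norm hZ i j).of_norm

theorem eval_apply_of_summable {F : FreeSeries d (ℋ →L[ℂ] ℋ)}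
    {Z : Fin d → Matrix (Fin n) (Fin n) ℂ} (h : Summable fun k => homPart F k Z) (i j : Fin n) :
    eval F Z i j = ∑' k, homPart F k Z i j := by
  have h1 : (∑' k, homPart F k Z) i = ∑' k, homPart F k Z i := tsum_apply h
  rw [eval, h1]
  exact tsum_apply (Pi.summable.mp h i)

theorem ColBdd.eval_apply {F : FreeSeries d (ℋ →L[ℂ] ℋ)} (hF : ColBdd F)
    {Z : Fin d → Matrix (Fin n) (Fin n) ℂ} (hZ : Z ∈ ncBall d n) (i j : Fin n) :
    eval F Z i j = ∑' k, homPart F k Z i j :=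
  eval_apply_of_summable (hF.summable hZ) i j

theorem tensor_mul_tensor {R : Type*} [Ring R] [Algebra ℂ R] {l m p : ℕ}
    (S : Matrix (Fin l) (Fin m) ℂ) (T : Matrix (Fin m) (Fin p) ℂ) (A B : R) :
    tensor S A * tensor T B = tensor (S * T) (A * B) := by
  ext i j
  simp only [tensor, Matrix.mul_apply, Matrix.map_apply, Finset.sum_smul, smul_mul_smul_comm]

theorem mul_wordPow_of_intertwine {n m : ℕ} {Z : Fin d → Matrix (Fin n) (Fin n) ℂ}
    {W : Fin d → Matrix (Fin m) (Fin m) ℂ} {S : Matrix (Fin m) (Fin n) ℂ}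
    (hS : ∀ k, S * Z k = W k * S) (α : Word d) : S * wordPow Z α = wordPow W α * S := by
  induction α with
  | nil => simp
  | cons k α ih =>
    rw [wordPow_cons, wordPow_cons, ← Matrix.mul_assoc, hS, Matrix.mul_assoc, ih,
      Matrix.mul_assoc]

theorem ColBdd.intertwining {F : FreeSeries d (ℋ →L[ℂ] ℋ)} (hF : ColBdd F) {n m : ℕ}
    {Z : Fin d → Matrix (Fin n) (Fin n) ℂ} (hZ : Z ∈ ncBall d n)
    {W : Fin d → Matrix (Fin m) (Fin m) ℂ} (hW : W ∈ ncBall d m)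
    {S : Matrix (Fin m) (Fin n) ℂ} (hS : ∀ k, S * Z k = W k * S) :
    tensor S (1 : ℋ →L[ℂ] ℋ) * eval F Z = eval F W * tensor S (1 : ℋ →L[ℂ] ℋ) := by
  have hk : ∀ k, tensor S (1 : ℋ →L[ℂ] ℋ) * homPart F k Z =
      homPart F k W * tensor S (1 : ℋ →L[ℂ] ℋ) := by
    intro k
    rw [homPart_eq, homPart_eq, Matrix.mul_sum, Matrix.sum_mul]
    refine Finset.sum_congr rfl fun α _ => ?_
    rw [tensor_mul_tensor, tensor_mul_tensor, mul_wordPow_of_intertwine hS, one_mul, mul_one]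
  have h1 : HasSum (fun k => tensor S (1 : ℋ →L[ℂ] ℋ) * homPart F k Z)
      (tensor S (1 : ℋ →L[ℂ] ℋ) * eval F Z) :=
    (hF.summable hZ).hasSum.map (Matrix.addMonoidHomMulLeft (tensor S (1 : ℋ →L[ℂ] ℋ)))
      (continuous_const.matrix_mul continuous_id)
  have h2 : HasSum (fun k => homPart F k W * tensor S (1 : ℋ →L[ℂ] ℋ))
      (eval F W * tensor S (1 : ℋ →L[ℂ] ℋ)) :=
    (hF.summable hW).hasSum.map (Matrix.addMonoidHomMulRight (tensor S (1 : ℋ →L[ℂ] ℋ)))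
      (continuous_id.matrix_mul continuous_const)
  simp only [hk] at h1
  exact h1.unique h2

theorem differentiable_wordPow_line (Z W : Fin d → Matrix (Fin n) (Fin n) ℂ) (α : Word d)
    (i j : Fin n) : Differentiable ℂ fun t : ℂ => wordPow (Z + t • W) α i j := by
  induction α generalizing i j with
  | nil => simp
  | cons k α ih =>
    simp only [wordPow_cons, Matrix.mul_apply, Pi.add_apply, Pi.smul_apply, Matrix.add_apply,
      Matrix.smul_apply, smul_eq_mul]
    refine Differentiable.fun_sum fun l _ => Differentiable.mul ?_ (ih l j)
    fun_prop

/-- The points `Z + tW` of a difference quotient are only known to be close to `Z`. The local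
majorant lets the series be evaluated there entry by entry, with no need of membership in the ball.
-/
theorem ncBall_mem_nhds {Z : Fin d → Matrix (Fin n) (Fin n) ℂ} (hZ : Z ∈ ncBall d n)
    {F : FreeSeries d (ℋ →L[ℂ] ℋ)} (hF : ColBdd F) :
    ∀ᶠ W in 𝓝 Z, ∀ i j, eval F W i j = ∑' k, homPart F k W i j := by
  obtain ⟨u, hu, hev⟩ := hF.exists_eventually_norm_le hZ
  refine hev.mono fun W hW i j => eval_apply_of_summable ?_ i j
  exact Pi.summable.mpr fun i => Pi.summable.mpr fun j =>
    (hu.of_nonneg_of_le (fun _ => norm_nonneg _) fun k => hW k i j).of_norm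

theorem ColBdd.gateaux {F : FreeSeries d (ℋ →L[ℂ] ℋ)} (hF : ColBdd F)
    {Z : Fin d → Matrix (Fin n) (Fin n) ℂ} (hZ : Z ∈ ncBall d n)
    (W : Fin d → Matrix (Fin n) (Fin n) ℂ) :
    ∃ D, Filter.Tendsto (fun t : ℂ => t⁻¹ • (eval F (Z + t • W) - eval F Z)) (𝓝[≠] 0) (𝓝 D) := by
  obtain ⟨u, hu, hev⟩ := hF.exists_eventually_norm_le hZ
  have hcont : Filter.Tendsto (fun t : ℂ => Z + t • W) (𝓝 0) (𝓝 Z) := by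
    have : Continuous fun t : ℂ => Z + t • W := by fun_prop
    simpa using this.tendsto 0
  obtain ⟨U, hU, hUo, h0⟩ := mem_nhds_iff.mp
    ((hcont.eventually hev).and (hcont.eventually (ncBall_mem_nhds hZ hF)))
  have hdiff : ∀ i j, DifferentiableAt ℂ (fun t : ℂ => eval F (Z + t • W) i j) 0 := by
    intro i j
    have h1 : DifferentiableOn ℂ (fun t : ℂ => ∑' k, homPart F k (Z + t • W) i j) U := by
      refine Complex.differentiableOn_tsum_of_summable_norm hu (fun k => ?_) hUo
        fun k t ht => (hU ht).1 k i j
      simp only [homPart_apply]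
      refine Differentiable.differentiableOn (Differentiable.fun_sum fun α _ => ?_)
      exact (differentiable_wordPow_line Z W α i j).smul_const _
    refine (h1.differentiableAt (hUo.mem_nhds h0)).congr_of_eventuallyEq ?_
    exact Filter.eventuallyEq_of_mem (hUo.mem_nhds h0) fun t ht => (hU ht).2 i j
  choose D hD using fun i j => (hdiff i j)
  refine ⟨fun i j => D i j 1, ?_⟩
  refine tendsto_pi_nhds.mpr fun i => tendsto_pi_nhds.mpr fun j => ?_
  have := hasDerivAt_iff_tendsto_slope_zero.mp (hD i j).hasDerivAt
  simpa using this

theorem ColBdd.isFreeHolomorphic {F : FreeSeries d (ℋ →L[ℂ] ℋ)} (hF : ColBdd F) :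
    IsFreeHolomorphic F := by
  refine ⟨fun n Z hZ => hF.summable hZ, ?_, ?_, ?_⟩
  · intro n m Z hZ W hW S hS
    exact hF.intertwining hZ hW hS
  · intro n Z hZ
    obtain ⟨u, hu, hev⟩ := hF.exists_eventually_norm_le hZ
    refine ⟨_, hev, ∑' k, u k, fun W hW i j => ?_⟩
    show ‖eval F W i j‖ ≤ _
    rw [hF.eval_apply hW.2]
    exact tsum_of_norm_bounded hu.hasSum fun k => hW.1 k i j
  · intro n Z hZ W
    exact hF.gateaux hZ W

/-! ### Multiplicativity of evaluation -/

theorem homPart_lmul (F G : FreeSeries d (ℋ →L[ℂ] ℋ)) (m : ℕ)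
    (Z : Fin d → Matrix (Fin n) (Fin n) ℂ) :
    homPart (lmul F G) m Z =
      ∑ p ∈ Finset.HasAntidiagonal.antidiagonal m, homPart F p.1 Z * homPart G p.2 Z := by
  have h : ∀ p ∈ Finset.HasAntidiagonal.antidiagonal m, homPart F p.1 Z * homPart G p.2 Z =
      ∑ γ ∈ wordsOf d m, tensor (wordPow Z γ) (F (γ.take p.1) * G (γ.drop p.1)) := by
    rintro ⟨p, q⟩ hp
    obtain rfl := Finset.HasAntidiagonal.mem_antidiagonal.mp hp
    have h2 := sum_wordsOf_add (d := d) p q fun α β =>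
      tensor (wordPow Z (α ++ β)) (F α * G β)
    simp only [List.take_append_drop] at h2
    rw [h2, homPart_eq, homPart_eq, Matrix.sum_mul]
    refine Finset.sum_congr rfl fun α _ => ?_
    rw [Matrix.mul_sum]
    refine Finset.sum_congr rfl fun β _ => ?_
    rw [tensor_mul_tensor, wordPow_append]
  rw [Finset.sum_congr rfl h, Finset.sum_comm, homPart_eq]
  refine Finset.sum_congr rfl fun γ hγ => ?_
  rw [Finset.Nat.sum_antidiagonal_eq_sum_range_succ_mk, ← mem_wordsOf.mp hγ]
  ext i j : 2
  simp [tensor, lmul, Matrix.sum_apply, Finset.smul_sum]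

theorem ColBdd.eval_lmul {F G : FreeSeries d (ℋ →L[ℂ] ℋ)} (hF : ColBdd F) (hG : ColBdd G)
    {Z : Fin d → Matrix (Fin n) (Fin n) ℂ} (hZ : Z ∈ ncBall d n) :
    eval (lmul F G) Z = eval F Z * eval G Z := by
  have hsum : ∀ i j l, HasSum (fun m => ∑ p ∈ Finset.HasAntidiagonal.antidiagonal m,
      homPart F p.1 Z i l * homPart G p.2 Z l j) (eval F Z i l * eval G Z l j) := by
    intro i j l
    rw [hF.eval_apply hZ, hG.eval_apply hZ,
      tsum_mul_tsum_eq_tsum_sum_antidiagonal_of_summable_norm (hF.summable_norm hZ i l)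
        (hG.summable_norm hZ l j)]
    exact (summable_norm_sum_mul_antidiagonal_of_summable_norm (hF.summable_norm hZ i l)
        (hG.summable_norm hZ l j)).of_norm.hasSum
  refine HasSum.tsum_eq (Pi.hasSum.mpr fun i => Pi.hasSum.mpr fun j => ?_)
  have h := hasSum_sum fun l (_ : l ∈ Finset.univ) => hsum i j l
  rw [Matrix.mul_apply]
  refine h.congr_fun ?_
  intro m
  rw [homPart_lmul, Matrix.sum_apply, Finset.sum_comm]
  simp [Matrix.mul_apply]

theorem ColBdd.eval_add {F G : FreeSeries d (ℋ →L[ℂ] ℋ)} (hF : ColBdd F) (hG : ColBdd G)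
    {Z : Fin d → Matrix (Fin n) (Fin n) ℂ} (hZ : Z ∈ ncBall d n) :
    eval (F + G) Z = eval F Z + eval G Z := by
  have h : ∀ k, homPart (F + G) k Z = homPart F k Z + homPart G k Z := by
    intro k
    ext i j : 2
    simp [homPart_apply, Finset.sum_add_distrib]
  rw [eval, funext h]
  exact ((hF.summable hZ).hasSum.add (hG.summable hZ).hasSum).tsum_eq

theorem eval_smul (c : ℂ) (F : FreeSeries d (ℋ →L[ℂ] ℋ))
    (Z : Fin d → Matrix (Fin n) (Fin n) ℂ) : eval (c • F) Z = c • eval F Z := by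
  have h : ∀ k, homPart (c • F) k Z = c • homPart F k Z := by
    intro k
    ext i j : 2
    simp [homPart_apply, Finset.smul_sum, smul_comm c]
  rw [eval, funext h]
  exact tsum_const_smul'' c

theorem ColBdd.eval_sub {F G : FreeSeries d (ℋ →L[ℂ] ℋ)} (hF : ColBdd F) (hG : ColBdd G)
    {Z : Fin d → Matrix (Fin n) (Fin n) ℂ} (hZ : Z ∈ ncBall d n) :
    eval (F - G) Z = eval F Z - eval G Z := by
  have h := hF.eval_add (hG.smul (-1)) hZ
  rwa [eval_smul, neg_one_smul, neg_one_smul, ← sub_eq_add_neg, ← sub_eq_add_neg] at h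

theorem eval_const (a : ℋ →L[ℂ] ℋ) (Z : Fin d → Matrix (Fin n) (Fin n) ℂ) :
    eval (const a) Z = tensor 1 a := by
  rw [eval, tsum_eq_single 0]
  · rw [homPart_eq, sum_wordsOf_zero]
    simp [const]
  · intro k hk
    rw [homPart_eq]
    refine Finset.sum_eq_zero fun α hα => ?_
    rw [mem_wordsOf] at hα
    have : α ≠ [] := by
      rintro rfl
      exact hk hα.symm
    ext i j : 2
    simp [const, this, tensor]

theorem eval_const_one (Z : Fin d → Matrix (Fin n) (Fin n) ℂ) :
    eval (const (1 : ℋ →L[ℂ] ℋ)) Z = 1 := by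
  rw [eval_const]
  ext i j : 2
  by_cases h : i = j <;> simp [tensor, Matrix.one_apply, h]

/-! ### Coefficients are determined by the values on the ball -/

/-- The tuple of nilpotent matrices `½ ∑_{α_i = k} E_{i,i+1}`. -/
def nilpotentTuple (α : Word d) (k : Fin d) : Matrix (Fin (α.length + 1)) (Fin (α.length + 1)) ℂ :=
  fun i j => if (i : ℕ) + 1 = j ∧ α[(i : ℕ)]? = some k then 2⁻¹ else 0

/-- The tuple is a weighted shift along the letters of `α`: the word `β` leads from position `i` to
`i + |β|` exactly when it is the factor of `α` read from `i`, and each letter costs `½`. -/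
theorem wordPow_nilpotentTuple (α β : Word d) (i j : Fin (α.length + 1)) :
    wordPow (nilpotentTuple α) β i j =
      if (i : ℕ) + β.length = j ∧ β = (α.drop i).take β.length then (2⁻¹ : ℂ) ^ β.length else 0 := by
  induction β generalizing i with
  | nil => simp [Matrix.one_apply, Fin.ext_iff]
  | cons k β ih =>
    rw [wordPow_cons, Matrix.mul_apply]
    by_cases hi : (i : ℕ) < α.length
    · rw [Finset.sum_eq_single (⟨i + 1, by omega⟩ : Fin (α.length + 1))]
      · rw [ih, List.drop_eq_getElem_cons hi]
        simp only [nilpotentTuple, List.getElem?_eq_getElem hi, Option.some.injEq, true_and,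
          List.length_cons, List.take_succ_cons, List.cons.injEq]
        by_cases hk : α[(i : ℕ)] = k
        · by_cases h2 : β = (α.drop (i + 1)).take β.length
          · rw [if_pos hk]
            by_cases h3 : (i : ℕ) + 1 + β.length = j
            · rw [if_pos ⟨h3, h2⟩, if_pos ⟨by omega, hk.symm, h2⟩, pow_succ']
            · rw [if_neg (fun h => h3 h.1), if_neg (fun h => h3 (by omega)), mul_zero]
          · simp [h2]
        · simp [hk, Ne.symm hk]
      · intro l _ hl
        have : (i : ℕ) + 1 ≠ l := fun h => hl (Fin.ext h.symm)
        simp [nilpotentTuple, this]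
      · simp
    · rw [Finset.sum_eq_zero, if_neg]
      · rintro ⟨h, -⟩
        have := j.2
        simp only [List.length_cons] at h
        omega
      · intro l _
        have : (i : ℕ) + 1 ≠ l := by
          have := l.2
          omega
        simp [nilpotentTuple, this]

/-- The row square is diagonal with entries `¼`, or `0` in the last place; the weight `½` is what
makes the contraction strict. -/
theorem nilpotentTuple_mem_ncBall (α : Word d) : nilpotentTuple α ∈ ncBall d (α.length + 1) := by
  have hsum : ∑ k, nilpotentTuple α k * (nilpotentTuple α k).conjTranspose =
      Matrix.diagonal fun i : Fin (α.length + 1) => if (i : ℕ) < α.length then (4⁻¹ : ℂ) else 0 := by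
    ext i j
    rw [Matrix.sum_apply, Matrix.diagonal_apply]
    simp only [Matrix.mul_apply, Matrix.conjTranspose_apply]
    by_cases hi : (i : ℕ) < α.length
    · rw [Finset.sum_eq_single α[(i : ℕ)],
        Finset.sum_eq_single (⟨i + 1, by omega⟩ : Fin (α.length + 1))]
      · by_cases hij : i = j
        · subst hij
          simp [nilpotentTuple, hi]
          norm_num
        · have : (j : ℕ) ≠ i := fun h => hij (Fin.ext h.symm)
          simp [nilpotentTuple, hij, this]
      · intro l _ hl
        have : (i : ℕ) + 1 ≠ l := fun h => hl (Fin.ext h.symm)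
        simp [nilpotentTuple, this]
      · simp
      · intro k _ hk
        refine Finset.sum_eq_zero fun l _ => ?_
        simp [nilpotentTuple, hi, hk.symm]
      · simp
    · rw [Finset.sum_eq_zero, if_neg hi, ite_self]
      intro k _
      refine Finset.sum_eq_zero fun l _ => ?_
      have : α.length ≤ i := by omega
      simp [nilpotentTuple, this]
  show (1 - ∑ k, nilpotentTuple α k * (nilpotentTuple α k).conjTranspose).PosDef
  rw [hsum, ← Matrix.diagonal_one, Matrix.diagonal_sub]
  refine Matrix.PosDef.diagonal fun i => ?_
  split_ifs
  · norm_num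
  · norm_num

/-- A path from the first position to the last must spell all of `α`, so this corner entry isolates
one coefficient. -/
theorem homPart_nilpotentTuple (F : FreeSeries d (ℋ →L[ℂ] ℋ)) (α : Word d) (k : ℕ) :
    homPart F k (nilpotentTuple α) 0 (Fin.last _) =
      if k = α.length then (2⁻¹ : ℂ) ^ α.length • F α else 0 := by
  rw [homPart_apply]
  split_ifs with hk
  · subst hk
    rw [Finset.sum_eq_single α]
    · simp [wordPow_nilpotentTuple]
    · intro β hβ hne
      rw [mem_wordsOf] at hβ
      simp [wordPow_nilpotentTuple, hβ, hne]
    · simp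
  · refine Finset.sum_eq_zero fun β hβ => ?_
    rw [mem_wordsOf] at hβ
    simp [wordPow_nilpotentTuple, hβ, hk]

theorem ColBdd.ext_eval {F G : FreeSeries d (ℋ →L[ℂ] ℋ)} (hF : ColBdd F) (hG : ColBdd G)
    (h : ∀ n, ∀ Z ∈ ncBall d n, eval F Z = eval G Z) : F = G := by
  funext α
  have hα := nilpotentTuple_mem_ncBall α
  have h1 := congrFun (congrFun (h _ _ hα) 0) (Fin.last _)
  rw [hF.eval_apply hα, hG.eval_apply hα, funext (homPart_nilpotentTuple F α),
    funext (homPart_nilpotentTuple G α), tsum_ite_eq, tsum_ite_eq] at h1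
  exact smul_right_injective _ (by positivity) h1

end Evaluation

/-! ### Contractive and accretive actions -/

section Positivity

variable {d : ℕ} {ℋ : Type*} [NormedAddCommGroup ℋ] [InnerProductSpace ℂ ℋ]

/-- The compressions of the action of `B` to words of bounded length are contractions. -/
def IsContractiveAct (B : FreeSeries d (ℋ →L[ℂ] ℋ)) : Prop :=
  ∀ (N : ℕ) (f : Word d → ℋ),
    ∑ γ ∈ wordsLt d N, ‖lact B f γ‖ ^ 2 ≤ ∑ γ ∈ wordsLt d N, ‖f γ‖ ^ 2

/-- The compressions of the action of `H` to words of bounded length are accretive. -/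
def IsAccretiveAct (H : FreeSeries d (ℋ →L[ℂ] ℋ)) : Prop :=
  ∀ (N : ℕ) (f : Word d → ℋ), 0 ≤ ∑ γ ∈ wordsLt d N, (inner ℂ (f γ) (lact H f γ)).re

theorem fock_sum_sq_le (f : Fock d ℋ) (s : Finset (Word d)) : ∑ γ ∈ s, ‖f γ‖ ^ 2 ≤ ‖f‖ ^ 2 := by
  have h := lp.sum_rpow_le_norm_rpow (p := 2) (by norm_num) f s
  simpa using h

/-- The truncation of a family to a finite set of words, as a vector of the Fock space. -/
def fockTrunc (s : Finset (Word d)) (f : Word d → ℋ) : Fock d ℋ :=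
  ⟨fun γ => if γ ∈ s then f γ else 0, memℓp_gen
    (summable_of_ne_finset_zero (s := s) fun γ hγ => by simp [hγ])⟩

theorem fockTrunc_apply (s : Finset (Word d)) (f : Word d → ℋ) (γ : Word d) :
    fockTrunc s f γ = if γ ∈ s then f γ else 0 := rfl

theorem norm_fockTrunc_sq (s : Finset (Word d)) (f : Word d → ℋ) :
    ‖fockTrunc s f‖ ^ 2 = ∑ γ ∈ s, ‖f γ‖ ^ 2 := by
  have h := lp.norm_rpow_eq_tsum (p := 2) (by norm_num) (fockTrunc s f)
  rw [tsum_eq_sum (s := s) fun γ hγ => by simp [fockTrunc_apply, hγ]] at h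
  simp only [ENNReal.toReal_ofNat, Real.rpow_ofNat] at h
  rw [h]
  exact Finset.sum_congr rfl fun γ hγ => by rw [fockTrunc_apply, if_pos hγ]

theorem IsLeftSchur.isContractiveAct {B : FreeSeries d (ℋ →L[ℂ] ℋ)} (hB : IsLeftSchur B) :
    IsContractiveAct B := by
  obtain ⟨M, hM, h⟩ := hB
  intro N f
  set g := fockTrunc (wordsLt d N) f
  have h1 : ∀ γ ∈ wordsLt d N, lact B f γ = M g γ := by
    intro γ hγ
    rw [h]
    refine lact_congr fun i => ?_
    rw [fockTrunc_apply, if_pos]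
    simp only [mem_wordsLt, List.length_drop] at hγ ⊢
    omega
  calc _ = ∑ γ ∈ wordsLt d N, ‖M g γ‖ ^ 2 := Finset.sum_congr rfl fun γ hγ => by rw [h1 γ hγ]
    _ ≤ ‖M g‖ ^ 2 := fock_sum_sq_le _ _
    _ ≤ ‖g‖ ^ 2 := by
        refine pow_le_pow_left₀ (norm_nonneg _) ((M.le_opNorm g).trans ?_) 2
        exact mul_le_of_le_one_left (norm_nonneg _) hM
    _ = _ := norm_fockTrunc_sq _ _

/-- Stated for an arbitrary linear map so that it serves the left action and its conjugate by
reversal alike. -/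
theorem exists_contraction_of_linearMap (T : (Word d → ℋ) →ₗ[ℂ] (Word d → ℋ))
    (hT : ∀ (N : ℕ) (f : Word d → ℋ),
      ∑ γ ∈ wordsLt d N, ‖T f γ‖ ^ 2 ≤ ∑ γ ∈ wordsLt d N, ‖f γ‖ ^ 2) :
    ∃ M : Fock d ℋ →L[ℂ] Fock d ℋ, ‖M‖ ≤ 1 ∧ ∀ (f : Fock d ℋ) (γ : Word d), M f γ = T f γ := by
  have hs : ∀ (f : Fock d ℋ) (s : Finset (Word d)), ∑ γ ∈ s, ‖T f γ‖ ^ (2 : ENNReal).toReal ≤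
      ‖f‖ ^ (2 : ENNReal).toReal := by
    intro f s
    obtain ⟨N, hN⟩ := exists_subset_wordsLt s
    simp only [ENNReal.toReal_ofNat, Real.rpow_ofNat]
    exact (Finset.sum_le_sum_of_subset_of_nonneg hN fun _ _ _ => by positivity).trans
      ((hT N f).trans (fock_sum_sq_le _ _))
  let M₀ : Fock d ℋ →ₗ[ℂ] Fock d ℋ :=
    { toFun := fun f => ⟨T f, memℓp_gen' (hs f)⟩
      map_add' := fun f g => by
        ext γ
        exact congrFun (map_add T (f : Word d → ℋ) g) γ
      map_smul' := fun c f => by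
        ext γ
        exact congrFun (map_smul T c (f : Word d → ℋ)) γ }
  refine ⟨M₀.mkContinuous 1 fun f => ?_, LinearMap.mkContinuous_norm_le _ zero_le_one _,
    fun f γ => rfl⟩
  rw [one_mul]
  exact lp.norm_le_of_forall_sum_le (by norm_num) (norm_nonneg _) (hs f)

/-- The action of a series as a linear map. -/
def lactLinear (F : FreeSeries d (ℋ →L[ℂ] ℋ)) : (Word d → ℋ) →ₗ[ℂ] (Word d → ℋ) where
  toFun := lact F
  map_add' := lact_add F
  map_smul' c f := by
    funext γ
    simp [lact, Finset.smul_sum]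

theorem IsContractiveAct.isLeftSchur {B : FreeSeries d (ℋ →L[ℂ] ℋ)} (hB : IsContractiveAct B) :
    IsLeftSchur B :=
  exists_contraction_of_linearMap (lactLinear B) hB

theorem IsContractiveAct.isRightSchur {B : FreeSeries d (ℋ →L[ℂ] ℋ)} (hB : IsContractiveAct B) :
    IsRightSchur (transpose B) := by
  let R : (Word d → ℋ) →ₗ[ℂ] (Word d → ℋ) := LinearMap.funLeft ℂ ℋ List.reverse
  have hR : ∀ f α, R f α = f α.reverse := fun _ _ => rfl
  obtain ⟨M, hM, h⟩ := exists_contraction_of_linearMap (R ∘ₗ lactLinear B ∘ₗ R) fun N f => by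
    rw [← sum_wordsLt_reverse N fun γ => ‖f γ‖ ^ 2]
    refine le_trans (le_of_eq ?_) (hB N (R f))
    exact sum_wordsLt_reverse N fun γ => ‖lact B (R f) γ‖ ^ 2
  refine ⟨M, hM, fun f γ => ?_⟩
  rw [h]
  exact (sum_reverse_drop B f γ).symm

/-! ### Bounded columns -/

theorem lact_single_nil (F : FreeSeries d (ℋ →L[ℂ] ℋ)) (x : ℋ) (γ : Word d) :
    lact F (fun α => if α = [] then x else 0) γ = F γ x := by
  rw [lact, Finset.sum_eq_single γ.length]
  · simp
  · intro i hi hne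
    have hi := Finset.mem_range.mp hi
    have : ¬ γ.length ≤ i := by omega
    simp [List.drop_eq_nil_iff, this]
  · simp

theorem IsContractiveAct.colBdd {B : FreeSeries d (ℋ →L[ℂ] ℋ)} (hB : IsContractiveAct B) :
    ColBdd B := by
  refine ⟨1, zero_le_one, fun k x => ?_⟩
  have h := hB (k + 1) fun α => if α = [] then x else 0
  simp only [lact_single_nil] at h
  have h1 : ∑ γ ∈ wordsLt d (k + 1), ‖(if γ = [] then x else 0 : ℋ)‖ ^ 2 = ‖x‖ ^ 2 := by
    rw [Finset.sum_eq_single []] <;> simp +contextual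
  rw [h1] at h
  rw [one_mul]
  refine le_trans (Finset.sum_le_sum_of_subset_of_nonneg ?_ fun _ _ _ => by positivity) h
  intro α hα
  rw [mem_wordsOf] at hα
  simp [hα]

/-- Accretivity is tested on `x` at the empty word together with `-t H_α x` at the words of length
`k`. The cross terms contribute `-t ‖H_α x‖²`, while the diagonal terms cost at most `t² ‖H_∅‖ ‖H_α
x‖²` and `‖H_∅‖ ‖x‖²`. -/
theorem IsAccretiveAct.sum_sq_le {H : FreeSeries d (ℋ →L[ℂ] ℋ)} (hH : IsAccretiveAct H)
    {k : ℕ} (hk : 0 < k) (t : ℝ) (x : ℋ) :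
    (t - t ^ 2 * ‖H []‖) * ∑ α ∈ wordsOf d k, ‖H α x‖ ^ 2 ≤ ‖H []‖ * ‖x‖ ^ 2 := by
  let f : Word d → ℋ := fun α =>
    if α = [] then x else if α.length = k then (-t : ℂ) • H α x else 0
  have hf0 : ∀ α : Word d, α ≠ [] → α.length ≠ k → f α = 0 := fun α h1 h2 => by simp [f, h1, h2]
  have hfk : ∀ α : Word d, α.length = k → f α = (-t : ℂ) • H α x := by
    intro α h
    have : α ≠ [] := by
      rintro rfl
      simp at h
      omega
    simp [f, h, this]
  have hact : ∀ α : Word d, α.length = k → lact H f α = H α x + H [] (f α) := by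
    intro α h
    -- Only the full prefix and the empty prefix survive: every other cut leaves a suffix of length
    -- strictly between `0` and `k`, where `f` vanishes.
    rw [lact, Finset.sum_range_succ', Finset.sum_eq_single (k - 1)]
    · have h1 : k - 1 + 1 = k := by omega
      rw [h1, ← h, List.take_length, List.drop_length, List.take_zero, List.drop_zero]
      rfl
    · intro i hi hne
      have hi := Finset.mem_range.mp hi
      rw [hf0, smul_zero]
      · rw [Ne, List.drop_eq_nil_iff]
        omega
      · rw [List.length_drop]
        omega
    · intro hn
      exact absurd (Finset.mem_range.mpr (by omega)) hn
  have hterm : ∀ α ∈ wordsOf d k, (inner ℂ (f α) (lact H f α)).re ≤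
      -(t - t ^ 2 * ‖H []‖) * ‖H α x‖ ^ 2 := by
    intro α hα
    rw [mem_wordsOf] at hα
    rw [hact α hα, hfk α hα, map_smul, inner_add_right, inner_smul_left, inner_smul_left,
      inner_smul_right]
    have h1 : (inner ℂ (H α x) (H [] (H α x))).re ≤ ‖H []‖ * ‖H α x‖ ^ 2 := by
      refine (Complex.re_le_norm _).trans ((norm_inner_le_norm _ _).trans ?_)
      have := (H []).le_opNorm (H α x)
      nlinarith [norm_nonneg (H α x)]
    have h2 : (inner ℂ (H α x) (H α x) : ℂ) = ((‖H α x‖ ^ 2 : ℝ) : ℂ) := by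
      rw [inner_self_eq_norm_sq_to_K]
      norm_cast
    rw [h2]
    have h3 : (starRingEnd ℂ (-t : ℂ) * ((‖H α x‖ ^ 2 : ℝ) : ℂ) + starRingEnd ℂ (-t : ℂ) *
        ((-t : ℂ) * inner ℂ (H α x) (H [] (H α x)))).re =
        -t * ‖H α x‖ ^ 2 + t ^ 2 * (inner ℂ (H α x) (H [] (H α x))).re := by
      rw [map_neg, Complex.conj_ofReal, ← mul_assoc, neg_mul_neg, Complex.add_re,
        ← Complex.ofReal_neg, ← Complex.ofReal_mul, ← Complex.ofReal_mul, Complex.re_ofReal_mul,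
        Complex.ofReal_re]
      ring
    rw [h3]
    nlinarith [mul_le_mul_of_nonneg_left h1 (sq_nonneg t)]
  have h := hH (k + 1) f
  rw [sum_wordsLt, Finset.sum_range_succ, Finset.sum_eq_single 0] at h
  · rw [sum_wordsOf_zero] at h
    have h0 : (inner ℂ (f []) (lact H f [])).re ≤ ‖H []‖ * ‖x‖ ^ 2 := by
      rw [lact_nil]
      refine (Complex.re_le_norm _).trans ((norm_inner_le_norm _ _).trans ?_)
      have := (H []).le_opNorm x
      have h2 : H [] • f [] = H [] x := rfl
      have h3 : f [] = x := rfl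
      rw [h2, h3]
      nlinarith [norm_nonneg x]
    have hs := Finset.sum_le_sum hterm
    rw [← Finset.mul_sum] at hs
    linarith
  · intro m hm hm0
    have hm := Finset.mem_range.mp hm
    refine Finset.sum_eq_zero fun α hα => ?_
    rw [mem_wordsOf] at hα
    rw [hf0 α _ (by omega), inner_zero_left, Complex.zero_re]
    rintro rfl
    exact hm0 (by simpa using hα.symm)
  · intro hn
    exact absurd (Finset.mem_range.mpr hk) hn

theorem IsAccretiveAct.colBdd {H : FreeSeries d (ℋ →L[ℂ] ℋ)} (hH : IsAccretiveAct H) :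
    ColBdd H := by
  set M : ℝ := ‖H []‖ + 1 with hM
  have hM0 : 0 < M := by positivity
  refine ⟨4 * M ^ 2, by positivity, fun k x => ?_⟩
  rcases Nat.eq_zero_or_pos k with rfl | hk
  · rw [sum_wordsOf_zero]
    have h1 : ‖H [] x‖ ≤ M * ‖x‖ := by
      refine ((H []).le_opNorm x).trans ?_
      gcongr
      linarith
    calc ‖H [] x‖ ^ 2 ≤ (M * ‖x‖) ^ 2 := by gcongr
      _ ≤ 4 * M ^ 2 * ‖x‖ ^ 2 := by
        rw [mul_pow]
        nlinarith [mul_nonneg (sq_nonneg M) (sq_nonneg ‖x‖)]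
  -- With `M = ‖H_∅‖ + 1` this `t` makes `t - t² ‖H_∅‖` at least `1 / (4M)`; the added `1` keeps `M`
  -- positive.
  · have h := hH.sum_sq_le hk (2 * M)⁻¹ x
    set S := ∑ α ∈ wordsOf d k, ‖H α x‖ ^ 2
    have hS : 0 ≤ S := Finset.sum_nonneg fun _ _ => by positivity
    have h1 : (4 * M)⁻¹ ≤ (2 * M)⁻¹ - (2 * M)⁻¹ ^ 2 * ‖H []‖ := by
      have : ‖H []‖ = M - 1 := by linarith
      rw [this]
      have h2 : (2 * M)⁻¹ - (2 * M)⁻¹ ^ 2 * (M - 1) = (4 * M)⁻¹ + (2 * M)⁻¹ ^ 2 := by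
        field_simp
        ring
      rw [h2]
      have : 0 ≤ (2 * M)⁻¹ ^ 2 := by positivity
      linarith
    have h2 : (4 * M)⁻¹ * S ≤ M * ‖x‖ ^ 2 := by
      refine (mul_le_mul_of_nonneg_right h1 hS).trans (h.trans ?_)
      gcongr
      linarith
    rw [inv_mul_le_iff₀ (by positivity)] at h2
    linarith

end Positivity

/-! ### The Herglotz kernels -/

section Kernel

variable {d : ℕ} {ℋ : Type*} [NormedAddCommGroup ℋ] [InnerProductSpace ℂ ℋ] [CompleteSpace ℋ]

/-- The Szegő coefficients are Kronecker deltas and collapse one of the two sums. No term is lost,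
since words of bounded length are closed under suffixes. The two halves become `⟨h, Hh⟩` and its
conjugate. -/
theorem sum_sum_leftHerglotzKernel (H : FreeSeries d (ℋ →L[ℂ] ℋ)) (N : ℕ) (h : Word d → ℋ) :
    ∑ α ∈ wordsLt d N, ∑ β ∈ wordsLt d N, inner ℂ (h α) (leftHerglotzKernel H α β (h β)) =
      ((∑ γ ∈ wordsLt d N, (inner ℂ (h γ) (lact H h γ)).re : ℝ) : ℂ) := by
  have hdrop : ∀ α ∈ wordsLt d N, ∀ i, α.drop i ∈ wordsLt d N := by
    intro α hα i
    simp only [mem_wordsLt, List.length_drop] at hα ⊢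
    omega
  have h1 : ∀ α ∈ wordsLt d N, ∑ β ∈ wordsLt d N, inner ℂ (h α)
      ((∑ i ∈ Finset.range (α.length + 1), H (α.take i) * szego (α.drop i) β :
        ℋ →L[ℂ] ℋ) (h β)) =
      inner ℂ (h α) (lact H h α) := by
    intro α hα
    rw [← inner_sum]
    congr 1
    simp only [_root_.sum_apply, mul_apply_eq_comp]
    rw [Finset.sum_comm, lact]
    refine Finset.sum_congr rfl fun i _ => ?_
    rw [Finset.sum_eq_single (α.drop i)]
    · simp [szego]
    · intro β _ hβ
      simp [szego, hβ.symm]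
    · exact fun hn => absurd (hdrop α hα i) hn
  have h2 : ∀ β ∈ wordsLt d N, ∑ α ∈ wordsLt d N, inner ℂ (h α)
      ((∑ i ∈ Finset.range (β.length + 1), szego α (β.drop i) * star (H (β.take i)) :
        ℋ →L[ℂ] ℋ) (h β)) =
      inner ℂ (lact H h β) (h β) := by
    intro β hβ
    simp only [_root_.sum_apply, mul_apply_eq_comp, inner_sum]
    rw [Finset.sum_comm, lact, sum_inner]
    refine Finset.sum_congr rfl fun i _ => ?_
    rw [Finset.sum_eq_single (β.drop i)]
    · simp [szego, ContinuousLinearMap.star_eq_adjoint, ContinuousLinearMap.adjoint_inner_right]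
    · intro α _ hα
      simp [szego, hα]
    · exact fun hn => absurd (hdrop β hβ i) hn
  simp only [leftHerglotzKernel, _root_.smul_apply, _root_.add_apply, inner_smul_right,
    inner_add_right]
  simp only [← Finset.mul_sum, Finset.sum_add_distrib]
  rw [Finset.sum_congr rfl h1, Finset.sum_comm, Finset.sum_congr rfl h2, ← Finset.sum_add_distrib,
    Finset.mul_sum, Complex.ofReal_sum]
  refine Finset.sum_congr rfl fun γ _ => ?_
  rw [← inner_conj_symm (lact H h γ) (h γ), Complex.add_conj]
  push_cast
  ring

theorem isPosKernel_leftHerglotzKernel_iff (H : FreeSeries d (ℋ →L[ℂ] ℋ)) :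
    IsPosKernel (leftHerglotzKernel H) ↔ IsAccretiveAct H := by
  constructor
  · intro hK N f
    have h := hK (wordsLt d N) f
    rw [sum_sum_leftHerglotzKernel] at h
    exact Complex.zero_le_real.mp h
  · intro hH s h
    obtain ⟨N, hN⟩ := exists_subset_wordsLt s
    have h1 : ∑ α ∈ s, ∑ β ∈ s, inner ℂ (h α) (leftHerglotzKernel H α β (h β)) =
        ∑ α ∈ wordsLt d N, ∑ β ∈ wordsLt d N, inner ℂ (if α ∈ s then h α else 0)
          (leftHerglotzKernel H α β (if β ∈ s then h β else 0)) := by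
      rw [← Finset.sum_subset hN fun α _ hα => by simp [hα]]
      refine Finset.sum_congr rfl fun α hα => ?_
      rw [← Finset.sum_subset hN fun β _ hβ => by simp [hβ]]
      refine Finset.sum_congr rfl fun β hβ => ?_
      rw [if_pos hα, if_pos hβ]
    rw [h1, sum_sum_leftHerglotzKernel H N fun γ => if γ ∈ s then h γ else 0]
    exact Complex.zero_le_real.mpr (hH N _)

theorem rightHerglotzKernel_transpose (H : FreeSeries d (ℋ →L[ℂ] ℋ)) (α β : Word d) :
    rightHerglotzKernel (transpose H) α β = leftHerglotzKernel H α.reverse β.reverse := by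
  have hs : ∀ γ δ : Word d, (szego γ δ : ℋ →L[ℂ] ℋ) = szego γ.reverse δ.reverse := by
    intro γ δ
    simp [szego]
  have h1 : ∀ (γ δ : Word d), ∑ i ∈ Finset.range (γ.length + 1),
      transpose H (γ.drop i) * szego (γ.take i) δ = ∑ i ∈ Finset.range (γ.reverse.length + 1),
        H (γ.reverse.take i) * szego (γ.reverse.drop i) δ.reverse := by
    intro γ δ
    refine (sum_reverse_drop H (fun ε => szego ε δ) γ).trans ?_
    simp only [lact, smul_eq_mul]
    refine Finset.sum_congr rfl fun i _ => ?_
    rw [hs _ δ, List.reverse_reverse]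
  have hstar : ∀ γ δ : Word d, star (szego γ δ : ℋ →L[ℂ] ℋ) = szego δ γ := by
    intro γ δ
    by_cases h : γ = δ
    · simp [szego, h]
    · simp [szego, h, Ne.symm h]
  -- The second half of the kernel is the adjoint of the first half with the two words exchanged.
  have h2 := congrArg star (h1 β α)
  simp only [star_sum, star_mul, hstar] at h2
  rw [rightHerglotzKernel, leftHerglotzKernel, h1 α β, h2]

theorem isPosKernel_rightHerglotzKernel {H : FreeSeries d (ℋ →L[ℂ] ℋ)}
    (hH : IsPosKernel (leftHerglotzKernel H)) :
    IsPosKernel (rightHerglotzKernel (transpose H)) := by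
  intro s h
  have h1 := hH (s.map ⟨List.reverse, List.reverse_injective⟩) fun α => h α.reverse
  simpa [rightHerglotzKernel_transpose] using h1

/-! ### The Cayley transform of formal series -/

theorem smul_lmul (c : ℂ) (F G : FreeSeries d (ℋ →L[ℂ] ℋ)) :
    lmul (c • F) G = c • lmul F G := by
  funext γ
  simp [lmul, Finset.smul_sum]

theorem lmul_smul (c : ℂ) (F G : FreeSeries d (ℋ →L[ℂ] ℋ)) :
    lmul F (c • G) = c • lmul F G := by
  funext γ
  simp [lmul, Finset.smul_sum]

/-- `(1 - B)(1 + H) = 2 = (1 + H)(1 - B)`. -/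
def CayleyRel (B H : FreeSeries d (ℋ →L[ℂ] ℋ)) : Prop :=
  lmul (const 1 - B) (const 1 + H) = (2 : ℂ) • const 1 ∧
    lmul (const 1 + H) (const 1 - B) = (2 : ℂ) • const 1

theorem exists_cayleyRel_of_isUnit_one_sub {B : FreeSeries d (ℋ →L[ℂ] ℋ)}
    (hB : IsUnit (1 - B [])) : ∃ H, CayleyRel B H := by
  obtain ⟨G, h1, h2⟩ := exists_lmul_inverse (F := const 1 - B) (by simpa [const] using hB)
  refine ⟨(2 : ℂ) • G - const 1, ?_, ?_⟩
  · rw [add_sub_cancel, lmul_smul, h1]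
  · rw [add_sub_cancel, smul_lmul, h2]

theorem exists_cayleyRel_of_isUnit_one_add {H : FreeSeries d (ℋ →L[ℂ] ℋ)}
    (hH : IsUnit (1 + H [])) : ∃ B, CayleyRel B H := by
  obtain ⟨G, h1, h2⟩ := exists_lmul_inverse (F := const 1 + H) (by simpa [const] using hH)
  refine ⟨const 1 - (2 : ℂ) • G, ?_, ?_⟩
  · rw [sub_sub_cancel, smul_lmul, h2]
  · rw [sub_sub_cancel, lmul_smul, h1]

theorem eq_of_lmul_eq_two {F G K : FreeSeries d (ℋ →L[ℂ] ℋ)}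
    (h : lmul G F = (2 : ℂ) • const 1) (h' : lmul F K = (2 : ℂ) • const 1) : G = K := by
  have h1 := lmul_assoc G F K
  rw [h, h', smul_lmul, lmul_smul, const_one_lmul, lmul_const_one] at h1
  exact (smul_right_injective _ two_ne_zero h1).symm

theorem CayleyRel.right_unique {B H H' : FreeSeries d (ℋ →L[ℂ] ℋ)} (h : CayleyRel B H)
    (h' : CayleyRel B H') : H = H' :=
  add_left_cancel (eq_of_lmul_eq_two h.2 h'.1)

theorem CayleyRel.left_unique {B B' H : FreeSeries d (ℋ →L[ℂ] ℋ)} (h : CayleyRel B H)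
    (h' : CayleyRel B' H) : B = B' :=
  sub_right_injective (eq_of_lmul_eq_two h.1 h'.2)

/-- With `g = (1 + H)f` the Cayley relation gives `Bg = g - 2f` and `Hf = g - f`: the contractivity
defect of `B` at `g` is four times the real part of `⟨f, Hf⟩`. -/
theorem re_inner_cayley (f g : ℋ) :
    ‖g‖ ^ 2 - ‖g - (2 : ℂ) • f‖ ^ 2 = 4 * (inner ℂ f (g - f)).re := by
  have h1 : ‖g - (2 : ℂ) • f‖ ^ 2 = ‖g‖ ^ 2 - 2 * (inner ℂ g ((2 : ℂ) • f)).re +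
      ‖(2 : ℂ) • f‖ ^ 2 := norm_sub_sq (𝕜 := ℂ) g _
  have h2 : (inner ℂ f f : ℂ).re = ‖f‖ ^ 2 := inner_self_eq_norm_sq (𝕜 := ℂ) f
  have h3 : (inner ℂ g f : ℂ).re = (inner ℂ f g).re := inner_re_symm (𝕜 := ℂ) g f
  rw [h1, inner_sub_right, Complex.sub_re, h2, inner_smul_right, norm_smul]
  simp only [Complex.mul_re, Complex.re_ofNat, Complex.im_ofNat, zero_mul, sub_zero, h3,
    Complex.norm_ofNat]
  ring

theorem CayleyRel.isAccretiveAct {B H : FreeSeries d (ℋ →L[ℂ] ℋ)} (h : CayleyRel B H)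
    (hB : IsContractiveAct B) : IsAccretiveAct H := by
  intro N f
  have h1 := lact_lmul (const 1 - B) (const 1 + H) f
  rw [h.1, sub_lact, one_lact] at h1
  have h0 : lact ((2 : ℂ) • const (1 : ℋ →L[ℂ] ℋ)) f = (2 : ℂ) • f := by
    rw [show (2 : ℂ) • const (1 : ℋ →L[ℂ] ℋ) = const (d := d) ((2 : ℂ) • 1) by
      funext α; simp [const], lact_const]
    funext γ
    simp
  rw [h0] at h1
  set g := lact (const 1 + H) f with hg
  rw [add_lact, one_lact] at hg
  have h2 : lact B g = g - (2 : ℂ) • f := by rw [h1, sub_sub_cancel]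
  have h3 := hB N g
  rw [h2, ← sub_nonneg, ← Finset.sum_sub_distrib] at h3
  have h4 : ∀ γ, ‖g γ‖ ^ 2 - ‖(g - (2 : ℂ) • f) γ‖ ^ 2 =
      4 * (inner ℂ (f γ) (lact H f γ)).re := by
    intro γ
    rw [show lact H f γ = g γ - f γ by simp [hg], ← re_inner_cayley]
    rfl
  simp only [h4, ← Finset.mul_sum] at h3
  linarith

theorem CayleyRel.isContractiveAct {B H : FreeSeries d (ℋ →L[ℂ] ℋ)} (h : CayleyRel B H)
    (hH : IsAccretiveAct H) : IsContractiveAct B := by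
  intro N f
  have h1 := lact_lmul (const 1 + H) (const 1 - B) f
  rw [h.2, add_lact, one_lact] at h1
  have h0 : lact ((2 : ℂ) • const (1 : ℋ →L[ℂ] ℋ)) f = (2 : ℂ) • f := by
    rw [show (2 : ℂ) • const (1 : ℋ →L[ℂ] ℋ) = const (d := d) ((2 : ℂ) • 1) by
      funext α; simp [const], lact_const]
    funext γ
    simp
  rw [h0] at h1
  set g := lact (const 1 - B) f with hg
  rw [sub_lact, one_lact] at hg
  have h3 := hH N g
  rw [← sub_nonneg, ← Finset.sum_sub_distrib]
  have h4 : ∀ γ, ‖f γ‖ ^ 2 - ‖lact B f γ‖ ^ 2 = (inner ℂ (g γ) (lact H g γ)).re := by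
    intro γ
    have h5 : lact H g γ = (2 : ℂ) • f γ - g γ := by
      have := congrFun h1 γ
      simp only [Pi.smul_apply, Pi.add_apply] at this
      rw [this, add_sub_cancel_left]
    have h6 : lact B f γ = f γ - g γ := by simp [hg]
    -- Here `g = (1 - B)f`, so `(1 + H)g = 2f`. The identity is used with `g` and `2f` in the roles
    -- of its two vectors.
    have h7 := re_inner_cayley (g γ) ((2 : ℂ) • f γ)
    rw [← smul_sub, norm_smul, norm_smul, mul_pow, mul_pow, ← h5] at h7
    rw [h6]
    norm_num at h7
    linarith
  simp only [h4]
  exact h3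

/-- Accretivity makes `1 + T` coercive: `‖x‖² ≤ Re ⟨x, (1 + T)x⟩`. -/
theorem isUnit_one_add_of_accretive {T : ℋ →L[ℂ] ℋ} (hT : ∀ x, 0 ≤ (inner ℂ x (T x)).re) :
    IsUnit (1 + T) := by
  refine ContinuousLinearMap.isUnit_of_forall_le_norm_inner_map (c := 1) _ one_pos fun x => ?_
  have h1 : ‖x‖ ^ 2 ≤ (inner ℂ x ((1 + T) x)).re := by
    have h2 : (inner ℂ x x : ℂ).re = ‖x‖ ^ 2 := inner_self_eq_norm_sq (𝕜 := ℂ) x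
    rw [_root_.add_apply, inner_add_right, Complex.add_re, one_apply_eq_self, h2]
    linarith [hT x]
  rw [norm_inner_symm, NNReal.coe_one, mul_one]
  exact h1.trans (Complex.re_le_norm _)

theorem IsAccretiveAct.isUnit {H : FreeSeries d (ℋ →L[ℂ] ℋ)} (hH : IsAccretiveAct H) :
    IsUnit (1 + H []) := by
  refine isUnit_one_add_of_accretive fun x => ?_
  have h := hH 1 fun _ => x
  rw [sum_wordsLt, Finset.sum_range_one, sum_wordsOf_zero, lact_nil] at h
  exact h

/-! ### The Cayley transform of values -/

/-- The relation displays `½(1 + b)` as the inverse of `1 - a`; then `1 + a = 2 - (1 - a)` gives the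
formula. The generality covers both matrices of operators and constant coefficients. -/
theorem cayley_of_mul_eq_two {A : Type*} [Ring A] [Algebra ℂ A] {a b : A}
    (h : (1 - a) * (1 + b) = (2 : ℂ) • 1) (h' : (1 + b) * (1 - a) = (2 : ℂ) • 1) :
    (IsUnit (1 - a) ∧ b = Ring.inverse (1 - a) * (1 + a)) ∧
      (IsUnit (b + 1) ∧ a = Ring.inverse (b + 1) * (b - 1)) := by
  have h2 : (2 : ℂ)⁻¹ • (2 : ℂ) • (1 : A) = 1 := by
    rw [smul_smul, inv_mul_cancel₀ two_ne_zero, one_smul]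
  let u : Aˣ := ⟨1 - a, (2 : ℂ)⁻¹ • (1 + b), by rw [mul_smul_comm, h, h2],
    by rw [smul_mul_assoc, h', h2]⟩
  let v : Aˣ := ⟨1 + b, (2 : ℂ)⁻¹ • (1 - a), by rw [mul_smul_comm, h', h2],
    by rw [smul_mul_assoc, h, h2]⟩
  have hu : Ring.inverse (1 - a) = (2 : ℂ)⁻¹ • (1 + b) := Ring.inverse_unit u
  have hv : Ring.inverse (1 + b) = (2 : ℂ)⁻¹ • (1 - a) := Ring.inverse_unit v
  refine ⟨⟨⟨u, rfl⟩, ?_⟩, ?_⟩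
  · rw [hu, show 1 + a = (2 : ℂ) • 1 - (1 - a) by rw [two_smul]; abel, mul_sub, smul_mul_assoc,
      smul_mul_assoc, h', h2, mul_smul_comm, smul_smul, inv_mul_cancel₀ two_ne_zero, one_smul,
      mul_one, add_sub_cancel_left]
  · rw [add_comm b 1]
    refine ⟨⟨v, rfl⟩, ?_⟩
    rw [hv, show b - 1 = (1 + b) - (2 : ℂ) • 1 by rw [two_smul]; abel, mul_sub, smul_mul_assoc,
      smul_mul_assoc, h, h2, mul_smul_comm, smul_smul, inv_mul_cancel₀ two_ne_zero, one_smul,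
      mul_one, sub_sub_cancel]

theorem CayleyRel.eval {B H : FreeSeries d (ℋ →L[ℂ] ℋ)} (h : CayleyRel B H) (hB : ColBdd B)
    (hH : ColBdd H) {n : ℕ} {Z : Fin d → Matrix (Fin n) (Fin n) ℂ} (hZ : Z ∈ ncBall d n) :
    (1 - eval B Z) * (1 + eval H Z) = (2 : ℂ) • 1 ∧
      (1 + eval H Z) * (1 - eval B Z) = (2 : ℂ) • 1 := by
  have h1 := colBdd_const (d := d) (1 : ℋ →L[ℂ] ℋ)
  have hsub := h1.eval_sub hB hZ
  have hadd := h1.eval_add hH hZ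
  rw [eval_const_one] at hsub hadd
  rw [← hsub, ← hadd, ← (h1.sub hB).eval_lmul (h1.add hH) hZ,
    ← (h1.add hH).eval_lmul (h1.sub hB) hZ, h.1, h.2, eval_smul, eval_const_one]
  exact ⟨rfl, rfl⟩

theorem CayleyRel.isRInverse {B H : FreeSeries d (ℋ →L[ℂ] ℋ)} (h : CayleyRel B H) :
    IsRInverse (const 1 - transpose B) (transpose ((2 : ℂ)⁻¹ • (const 1 + H))) := by
  rw [show const 1 - transpose B = transpose (const 1 - B) by
    rw [transpose_sub, transpose_const]]
  refine isRInverse_transpose ?_ ?_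
  · rw [lmul_smul, h.1, smul_smul, inv_mul_cancel₀ two_ne_zero, one_smul]
  · rw [smul_lmul, h.2, smul_smul, inv_mul_cancel₀ two_ne_zero, one_smul]

theorem CayleyRel.isRInverse' {B H : FreeSeries d (ℋ →L[ℂ] ℋ)} (h : CayleyRel B H) :
    IsRInverse (transpose H + const 1) (transpose ((2 : ℂ)⁻¹ • (const 1 - B))) := by
  rw [show transpose H + const 1 = transpose (const 1 + H) by
    rw [transpose_add, transpose_const, add_comm]]
  refine isRInverse_transpose ?_ ?_
  · rw [lmul_smul, h.2, smul_smul, inv_mul_cancel₀ two_ne_zero, one_smul]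
  · rw [smul_lmul, h.1, smul_smul, inv_mul_cancel₀ two_ne_zero, one_smul]

theorem CayleyRel.isCayley {B H : FreeSeries d (ℋ →L[ℂ] ℋ)} (h : CayleyRel B H) (hB : ColBdd B)
    (hH : ColBdd H) : IsCayley (B, transpose B) (H, transpose H) := by
  refine ⟨fun n Z hZ => ?_, _, h.isRInverse, ?_⟩
  · obtain ⟨h1, h2⟩ := h.eval hB hH hZ
    exact (cayley_of_mul_eq_two h1 h2).1
  · show transpose H = rmul _ (const 1 + transpose B)
    rw [show const 1 + transpose B = transpose (const 1 + B) by
        rw [transpose_add, transpose_const], rmul_transpose,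
      show const 1 + B = (2 : ℂ) • const 1 - (const 1 - B) by rw [two_smul]; abel, lmul_sub,
      smul_lmul, smul_lmul, h.2, lmul_smul, lmul_const_one, smul_smul, smul_smul,
      inv_mul_cancel₀ two_ne_zero, one_smul, one_smul, add_sub_cancel_left]

theorem CayleyRel.isInverseCayley {B H : FreeSeries d (ℋ →L[ℂ] ℋ)} (h : CayleyRel B H)
    (hB : ColBdd B) (hH : ColBdd H) : IsInverseCayley (H, transpose H) (B, transpose B) := by
  refine ⟨fun n Z hZ => ?_, _, h.isRInverse', ?_⟩
  · obtain ⟨h1, h2⟩ := h.eval hB hH hZ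
    exact (cayley_of_mul_eq_two h1 h2).2
  · show transpose B = rmul _ (transpose H - const 1)
    rw [show transpose H - const 1 = transpose (H - const 1) by
        rw [transpose_sub, transpose_const], rmul_transpose,
      show H - const 1 = (const 1 + H) - (2 : ℂ) • const 1 by rw [two_smul]; abel, lmul_sub,
      smul_lmul, smul_lmul, h.1, lmul_smul, lmul_const_one, smul_smul, smul_smul,
      inv_mul_cancel₀ two_ne_zero, one_smul, one_smul, sub_sub_cancel]

/-! ### The bijection of pairs -/

theorem isUnit_apply_zero_zero {R : Type*} [Ring R] {M : Matrix (Fin 1) (Fin 1) R}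
    (hM : IsUnit M) : IsUnit (M 0 0) := by
  obtain ⟨u, rfl⟩ := hM
  refine ⟨⟨_, (↑u⁻¹ : Matrix (Fin 1) (Fin 1) R) 0 0, ?_, ?_⟩, rfl⟩
  · simpa [Matrix.mul_apply] using congrFun (congrFun u.mul_inv 0) 0
  · simpa [Matrix.mul_apply] using congrFun (congrFun u.inv_mul 0) 0

/-- The constant coefficient is the value at the zero tuple of size one, which is `nilpotentTuple
[]`. -/
theorem ColBdd.isUnit_one_sub_nil {B : FreeSeries d (ℋ →L[ℂ] ℋ)} (hB : ColBdd B)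
    (h : IsLeftNonUnital B) : IsUnit (1 - B []) := by
  have hmem := nilpotentTuple_mem_ncBall (d := d) []
  have h1 : eval B (nilpotentTuple []) 0 0 = B [] := by
    have h2 := hB.eval_apply hmem 0 (Fin.last _)
    rw [funext (homPart_nilpotentTuple B []), tsum_ite_eq] at h2
    simpa using h2
  have h3 := isUnit_apply_zero_zero (h _ _ hmem)
  rwa [Matrix.sub_apply, h1, Matrix.one_apply_eq] at h3

/-- The right inverse required of `1 - B^R` is the transpose of `½(1 + H)`, whose bounded columns
make it free holomorphic. -/
theorem mem_schurPairs_of_cayleyRel {B H : FreeSeries d (ℋ →L[ℂ] ℋ)} (h : CayleyRel B H)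
    (hB : IsContractiveAct B) (hH : IsAccretiveAct H) :
    (B, transpose B) ∈ schurPairs d ℋ := by
  refine ⟨hB.isLeftSchur, hB.isRightSchur, rfl, fun n Z hZ => ?_, _, ?_, h.isRInverse⟩
  · obtain ⟨h1, h2⟩ := h.eval hB.colBdd hH.colBdd hZ
    exact (cayley_of_mul_eq_two h1 h2).1.1
  · exact (((colBdd_const 1).add hH.colBdd).smul _).transpose.isFreeHolomorphic

theorem mem_herglotzPairs {H : FreeSeries d (ℋ →L[ℂ] ℋ)} (hH : IsAccretiveAct H) :
    (H, transpose H) ∈ herglotzPairs d ℋ := by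
  have h := (isPosKernel_leftHerglotzKernel_iff H).mpr hH
  exact ⟨⟨hH.colBdd.isFreeHolomorphic, h⟩,
    ⟨hH.colBdd.transpose.isFreeHolomorphic, isPosKernel_rightHerglotzKernel h⟩, rfl⟩

theorem isAccretiveAct_of_mem_herglotzPairs (H : herglotzPairs d ℋ) : IsAccretiveAct H.1.1 :=
  (isPosKernel_leftHerglotzKernel_iff _).mp H.2.1.2

theorem herglotzPairs_ext {H H' : herglotzPairs d ℋ} (h : H.1.1 = H'.1.1) : H = H' :=
  Subtype.ext (Prod.ext h (by rw [H.2.2.2, H'.2.2.2, h]))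

theorem schurPairs_ext {B B' : schurPairs d ℋ} (h : B.1.1 = B'.1.1) : B = B' :=
  Subtype.ext (Prod.ext h (by rw [B.2.2.2.1, B'.2.2.2.1, h]))

theorem exists_cayleyRel_of_schurPair (B : schurPairs d ℋ) :
    ∃ H : herglotzPairs d ℋ, CayleyRel B.1.1 H.1.1 := by
  have hB := B.2.1.isContractiveAct
  obtain ⟨H, hH⟩ := exists_cayleyRel_of_isUnit_one_sub
    (hB.colBdd.isUnit_one_sub_nil B.2.2.2.2.1)
  exact ⟨⟨_, mem_herglotzPairs (hH.isAccretiveAct hB)⟩, hH⟩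

theorem exists_cayleyRel_of_herglotzPair (H : herglotzPairs d ℋ) :
    ∃ B : schurPairs d ℋ, CayleyRel B.1.1 H.1.1 := by
  have hH := isAccretiveAct_of_mem_herglotzPairs H
  obtain ⟨B, hB⟩ := exists_cayleyRel_of_isUnit_one_add hH.isUnit
  exact ⟨⟨_, mem_schurPairs_of_cayleyRel hB (hB.isContractiveAct hH) hH⟩, hB⟩

variable (d ℋ) in
/-- The Cayley transform of transpose-conjugate pairs. -/
def cayleyEquiv : schurPairs d ℋ ≃ herglotzPairs d ℋ where
  toFun B := (exists_cayleyRel_of_schurPair B).choose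
  invFun H := (exists_cayleyRel_of_herglotzPair H).choose
  left_inv B := schurPairs_ext ((exists_cayleyRel_of_herglotzPair _).choose_spec.left_unique
    (exists_cayleyRel_of_schurPair B).choose_spec)
  right_inv H := herglotzPairs_ext ((exists_cayleyRel_of_schurPair _).choose_spec.right_unique
    (exists_cayleyRel_of_herglotzPair H).choose_spec)

theorem cayleyRel_cayleyEquiv (B : schurPairs d ℋ) :
    CayleyRel B.1.1 (cayleyEquiv d ℋ B).1.1 :=
  (exists_cayleyRel_of_schurPair B).choose_spec

theorem isCayley_cayleyEquiv (B : schurPairs d ℋ) : IsCayley B.1 (cayleyEquiv d ℋ B).1 := by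
  have h := (cayleyRel_cayleyEquiv B).isCayley B.2.1.isContractiveAct.colBdd
    (isAccretiveAct_of_mem_herglotzPairs _).colBdd
  rwa [← B.2.2.2.1, ← (cayleyEquiv d ℋ B).2.2.2] at h

theorem isInverseCayley_cayleyEquiv_symm (H : herglotzPairs d ℋ) :
    IsInverseCayley H.1 ((cayleyEquiv d ℋ).symm H).1 := by
  obtain ⟨B, rfl⟩ := (cayleyEquiv d ℋ).surjective H
  rw [Equiv.symm_apply_apply]
  have h := (cayleyRel_cayleyEquiv B).isInverseCayley B.2.1.isContractiveAct.colBdd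
    (isAccretiveAct_of_mem_herglotzPairs _).colBdd
  rwa [← B.2.2.2.1, ← (cayleyEquiv d ℋ B).2.2.2] at h

end Kernel

/-! ### Row isometries -/

section RowIsometry

variable {d : ℕ} {𝒦 : Type*} [NormedAddCommGroup 𝒦] [InnerProductSpace ℂ 𝒦] [CompleteSpace 𝒦]

/-- Isometries with pairwise orthogonal ranges. -/
def IsRowIsometry (V : Fin d → 𝒦 →L[ℂ] 𝒦) : Prop :=
  ∀ i j, star (V i) * V j = if i = j then 1 else 0

theorem inner_star_left (T : 𝒦 →L[ℂ] 𝒦) (x y : 𝒦) :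
    inner ℂ (star T x) y = inner ℂ x (T y) := by
  rw [ContinuousLinearMap.star_eq_adjoint, ContinuousLinearMap.adjoint_inner_left]

theorem inner_star_right (T : 𝒦 →L[ℂ] 𝒦) (x y : 𝒦) :
    inner ℂ x (star T y) = inner ℂ (T x) y := by
  rw [ContinuousLinearMap.star_eq_adjoint, ContinuousLinearMap.adjoint_inner_right]

/-- Bessel's inequality: `y` is the orthogonal projection of `x` onto the sum of the ranges, and the
left side is `‖y‖²`. -/
theorem IsRowIsometry.sum_norm_star_apply_sq_le {V : Fin d → 𝒦 →L[ℂ] 𝒦} (hV : IsRowIsometry V)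
    (x : 𝒦) : ∑ i, ‖star (V i) x‖ ^ 2 ≤ ‖x‖ ^ 2 := by
  set y := ∑ i, V i (star (V i) x) with hy
  have h1 : (inner ℂ x y : ℂ) = ((∑ i, ‖star (V i) x‖ ^ 2 : ℝ) : ℂ) := by
    rw [hy, inner_sum]
    push_cast
    refine Finset.sum_congr rfl fun i _ => ?_
    rw [← inner_star_left, inner_self_eq_norm_sq_to_K]
    rfl
  have h2 : ∀ j, star (V j) y = star (V j) x := by
    intro j
    rw [hy, map_sum, Finset.sum_eq_single j]
    · rw [← mul_apply_eq_comp, hV, if_pos rfl, one_apply_eq_self]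
    · intro i _ hij
      rw [← mul_apply_eq_comp, hV, if_neg hij.symm]
      rfl
    · simp
  have h3 : (inner ℂ y y : ℂ) = inner ℂ x y := by
    conv_lhs => rw [hy]
    conv_rhs => rw [hy]
    rw [sum_inner, inner_sum]
    refine Finset.sum_congr rfl fun i _ => ?_
    rw [← inner_star_right, h2, inner_star_left]
  have h4 := norm_sub_sq (𝕜 := ℂ) x y
  have h5 : ‖y‖ ^ 2 = (inner ℂ y y : ℂ).re := (inner_self_eq_norm_sq (𝕜 := ℂ) y).symm
  rw [h5, h3, h1] at h4
  have h6 : RCLike.re ((∑ i, ‖star (V i) x‖ ^ 2 : ℝ) : ℂ) = ∑ i, ‖star (V i) x‖ ^ 2 :=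
    Complex.ofReal_re _
  rw [h6, Complex.ofReal_re] at h4
  have := sq_nonneg ‖x - y‖
  linarith

theorem IsRowIsometry.sum_norm_star_wordPow_sq_le {V : Fin d → 𝒦 →L[ℂ] 𝒦} (hV : IsRowIsometry V)
    (k : ℕ) (x : 𝒦) : ∑ α ∈ wordsOf d k, ‖star (wordPow V α) x‖ ^ 2 ≤ ‖x‖ ^ 2 := by
  induction k generalizing x with
  | zero => simp [sum_wordsOf_zero]
  | succ k ih =>
    rw [sum_wordsOf_succ]
    refine le_trans (Finset.sum_le_sum fun i _ => ?_) (hV.sum_norm_star_apply_sq_le x)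
    simp only [wordPow_cons, star_mul, mul_apply_eq_comp]
    exact ih _

end RowIsometry

/-! ### The left free shift -/

section LeftCreation

variable {d : ℕ}

theorem leftCreation_apply (k : Fin d) (f : Fock d ℂ) (β : Word d) :
    leftCreation k f β = consFun k f β := rfl

theorem norm_leftCreation_apply (k : Fin d) (f : Fock d ℂ) : ‖leftCreation k f‖ = ‖f‖ := by
  have h0 : (0 : ℝ) < (2 : ENNReal).toReal := by norm_num
  have h := (lp.hasSum_norm (p := 2) h0 (leftCreation k f)).unique (hasSum_consFun k f)
  exact (Real.rpow_left_inj (norm_nonneg _) (norm_nonneg _) h0.ne').mp h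

theorem isRowIsometry_leftCreation : IsRowIsometry (leftCreation (d := d)) := by
  intro i j
  refine ContinuousLinearMap.ext fun f => ext_inner_left ℂ fun g => ?_
  rw [mul_apply_eq_comp, inner_star_right]
  split_ifs with h
  · subst h
    exact (LinearMap.norm_map_iff_inner_map_map (leftCreation i)).mp
      (norm_leftCreation_apply i) g f
  · rw [_root_.zero_apply, inner_zero_right, lp.inner_eq_tsum]
    refine (tsum_congr fun β => ?_).trans tsum_zero
    rw [leftCreation_apply, leftCreation_apply]
    cases β with
    | nil => simp [consFun]
    | cons k β =>
      by_cases hk : k = i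
      · have : k ≠ j := fun hj => h (hk.symm.trans hj)
        simp [consFun, this]
      · simp [consFun, hk]

/-- The standard basis vectors of the Fock space. -/
def fockBasis (α : Word d) : Fock d ℂ := lp.single 2 α (1 : ℂ)

theorem fockBasis_apply (α β : Word d) : fockBasis α β = if β = α then 1 else 0 := by
  rw [fockBasis, lp.single_apply]
  split_ifs with h
  · subst h
    simp
  · simp [h]

theorem inner_fockBasis (α β : Word d) :
    (inner ℂ (fockBasis α) (fockBasis β) : ℂ) = if α = β then 1 else 0 := by
  rw [fockBasis, lp.inner_single_left, fockBasis_apply]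
  simp

theorem leftCreation_fockBasis (k : Fin d) (α : Word d) :
    leftCreation k (fockBasis α) = fockBasis (k :: α) := by
  ext β
  rw [leftCreation_apply, fockBasis_apply]
  cases β with
  | nil => simp [consFun]
  | cons j β =>
    simp only [consFun, fockBasis_apply, List.cons.injEq]
    by_cases h : j = k <;> simp [h]

theorem wordPow_leftCreation_fockBasis (γ α : Word d) :
    wordPow leftCreation γ (fockBasis α) = fockBasis (γ ++ α) := by
  induction γ with
  | nil => simp
  | cons k γ ih => rw [wordPow_cons, mul_apply_eq_comp, ih, leftCreation_fockBasis,
      List.cons_append]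

/-- The coefficient `(L^*)^α` is the adjoint of `L` raised to the reversed word. Reversal permutes
the words of each length, so Bessel's inequality for the row isometry applies. -/
theorem colBdd_cauchySeries : ColBdd (cauchySeries d) := by
  refine ⟨1, zero_le_one, fun k x => ?_⟩
  rw [one_mul, ← sum_wordsOf_reverse]
  have h := isRowIsometry_leftCreation.sum_norm_star_wordPow_sq_le k x
  refine le_trans (le_of_eq (Finset.sum_congr rfl fun α _ => ?_)) h
  rw [cauchySeries, ← star_wordPow, List.reverse_reverse]

/-! ### The free disk operator system -/

/-- The operators whose adjoint lies in `P`. -/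
def starComap (P : Submodule ℂ (Fock d ℂ →L[ℂ] Fock d ℂ)) :
    Submodule ℂ (Fock d ℂ →L[ℂ] Fock d ℂ) where
  carrier := star ⁻¹' P
  add_mem' {x y} hx hy := by
    rw [Set.mem_preimage, star_add]
    exact P.add_mem hx hy
  zero_mem' := by
    rw [Set.mem_preimage, star_zero]
    exact P.zero_mem
  smul_mem' c x hx := by
    rw [Set.mem_preimage, star_smul]
    exact P.smul_mem _ hx

theorem mem_starComap {P : Submodule ℂ (Fock d ℂ →L[ℂ] Fock d ℂ)}
    {x : Fock d ℂ →L[ℂ] Fock d ℂ} : x ∈ starComap P ↔ star x ∈ P := Iff.rfl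

theorem isClosed_starComap {P : Submodule ℂ (Fock d ℂ →L[ℂ] Fock d ℂ)}
    (hP : IsClosed (P : Set (Fock d ℂ →L[ℂ] Fock d ℂ))) :
    IsClosed (starComap P : Set (Fock d ℂ →L[ℂ] Fock d ℂ)) :=
  hP.preimage continuous_star

theorem diskAlgebra_le {P : Submodule ℂ (Fock d ℂ →L[ℂ] Fock d ℂ)}
    (hP : IsClosed (P : Set (Fock d ℂ →L[ℂ] Fock d ℂ)))
    (h : ∀ α, wordPow leftCreation α ∈ P) :
    (diskAlgebra d : Set (Fock d ℂ →L[ℂ] Fock d ℂ)) ⊆ P := by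
  rw [diskAlgebra, Subalgebra.topologicalClosure_coe]
  refine closure_minimal ?_ hP
  have h1 : Subalgebra.toSubmodule (Algebra.adjoin ℂ (Set.range (leftCreation (d := d)))) ≤ P := by
    rw [Algebra.adjoin_eq_span, Submodule.span_le]
    intro a ha
    have : ∃ α, wordPow leftCreation α = a := by
      induction ha using Submonoid.closure_induction with
      | mem x hx =>
        obtain ⟨k, rfl⟩ := hx
        exact ⟨[k], by simp [wordPow]⟩
      | one => exact ⟨[], wordPow_nil _⟩
      | mul x y _ _ hx hy =>
        obtain ⟨α, rfl⟩ := hx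
        obtain ⟨β, rfl⟩ := hy
        exact ⟨α ++ β, wordPow_append _ _ _⟩
    obtain ⟨α, rfl⟩ := this
    exact h α
  exact h1

theorem diskSystem_le {P : Submodule ℂ (Fock d ℂ →L[ℂ] Fock d ℂ)}
    (hP : IsClosed (P : Set (Fock d ℂ →L[ℂ] Fock d ℂ)))
    (h : ∀ α, wordPow leftCreation α ∈ P) (h' : ∀ α, star (wordPow leftCreation α) ∈ P) :
    diskSystem d ≤ P := by
  refine Submodule.topologicalClosure_minimal _ (Submodule.span_le.mpr ?_) hP
  rintro a (ha | ⟨b, hb, rfl⟩)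
  · exact diskAlgebra_le hP h ha
  · exact diskAlgebra_le (isClosed_starComap hP) h' hb

theorem isClosed_diskSystem :
    IsClosed (diskSystem d : Set (Fock d ℂ →L[ℂ] Fock d ℂ)) :=
  Submodule.isClosed_topologicalClosure _

theorem wordPow_mem_diskSystem (α : Word d) : wordPow leftCreation α ∈ diskSystem d :=
  Submodule.le_topologicalClosure _ (Submodule.subset_span (Or.inl (wordPow_mem_diskAlgebra α)))

theorem star_wordPow_mem_diskSystem (α : Word d) :
    star (wordPow leftCreation α) ∈ diskSystem d :=
  Submodule.le_topologicalClosure _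
    (Submodule.subset_span (Or.inr ⟨_, wordPow_mem_diskAlgebra α, rfl⟩))

theorem one_mem_diskSystem : (1 : Fock d ℂ →L[ℂ] Fock d ℂ) ∈ diskSystem d := by
  simpa using wordPow_mem_diskSystem (d := d) []

theorem star_mem_diskSystem {a : Fock d ℂ →L[ℂ] Fock d ℂ} (ha : a ∈ diskSystem d) :
    star a ∈ diskSystem d := by
  have h : diskSystem d ≤ starComap (diskSystem d) := by
    refine diskSystem_le (isClosed_starComap isClosed_diskSystem)
      (fun α => mem_starComap.mpr (star_wordPow_mem_diskSystem α)) fun α => ?_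
    rw [mem_starComap, star_star]
    exact wordPow_mem_diskSystem α
  exact mem_starComap.mp (h ha)

end LeftCreation

/-! ### Completely positive maps on the free disk operator system -/

section CPMaps

variable {d : ℕ} {ℋ : Type*} [NormedAddCommGroup ℋ] [InnerProductSpace ℂ ℋ] [CompleteSpace ℋ]

/-- The unit of the free disk operator system. -/
def diskOne (d : ℕ) : diskSystem d := ⟨1, one_mem_diskSystem⟩

/-- The involution of the free disk operator system. -/
def diskStar (a : diskSystem d) : diskSystem d := ⟨star a.1, star_mem_diskSystem a.2⟩

theorem cpMaps.inner_one_nonneg {φ : diskSystem d →ₗ[ℂ] (ℋ →L[ℂ] ℋ)} (hφ : φ ∈ cpMaps d ℋ)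
    (x : ℋ) : 0 ≤ (inner ℂ x (φ (diskOne d) x) : ℂ) := by
  have h := hφ 1 (Matrix.of fun _ _ => diskOne d) (fun y => by
    have h0 : (inner ℂ (y 0) (y 0) : ℂ) = ((‖y 0‖ ^ 2 : ℝ) : ℂ) := by
      rw [inner_self_eq_norm_sq_to_K]
      norm_cast
    simp only [Fin.sum_univ_one, Matrix.map_apply, Matrix.of_apply, diskOne, one_apply_eq_self]
    rw [h0, Complex.zero_le_real]
    positivity) fun _ => x
  simpa only [Fin.sum_univ_one, Matrix.map_apply, Matrix.of_apply] using h

/-- The matrix with rows `(‖a‖, a)` and `(a^*, ‖a‖)` is positive. This single instance of complete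
positivity yields both compatibility with adjoints and boundedness. -/
theorem cpMaps.nonneg_two {φ : diskSystem d →ₗ[ℂ] (ℋ →L[ℂ] ℋ)} (hφ : φ ∈ cpMaps d ℋ)
    (a : diskSystem d) (x y : ℋ) :
    0 ≤ (‖a‖ : ℂ) * inner ℂ x (φ (diskOne d) x) + inner ℂ x (φ a y) +
      (inner ℂ y (φ (diskStar a) x) + (‖a‖ : ℂ) * inner ℂ y (φ (diskOne d) y)) := by
  have hpos : IsPosMatrix ((Matrix.of ![![(‖a‖ : ℂ) • diskOne d, a],
      ![diskStar a, (‖a‖ : ℂ) • diskOne d]]).map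
        (fun x => (x : Fock d ℂ →L[ℂ] Fock d ℂ))) := by
    intro z
    simp only [Fin.sum_univ_two, Matrix.map_apply, Matrix.of_apply, Matrix.cons_val_zero,
      Matrix.cons_val_one, Submodule.coe_smul, _root_.smul_apply,
      inner_smul_right]
    show 0 ≤ (‖a‖ : ℂ) * inner ℂ (z 0) (z 0) + inner ℂ (z 0) (a.1 (z 1)) +
      (inner ℂ (z 1) (star a.1 (z 0)) + (‖a‖ : ℂ) * inner ℂ (z 1) (z 1))
    rw [inner_star_right, ← inner_conj_symm (a.1 (z 1)) (z 0), inner_self_eq_norm_sq_to_K,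
      inner_self_eq_norm_sq_to_K]
    have h1 : (‖a‖ : ℂ) * ((‖z 0‖ : ℝ) : ℂ) ^ 2 + inner ℂ (z 0) (a.1 (z 1)) +
        (starRingEnd ℂ (inner ℂ (z 0) (a.1 (z 1))) + (‖a‖ : ℂ) * ((‖z 1‖ : ℝ) : ℂ) ^ 2) =
        ((‖a‖ * ‖z 0‖ ^ 2 + 2 * (inner ℂ (z 0) (a.1 (z 1))).re + ‖a‖ * ‖z 1‖ ^ 2 : ℝ) : ℂ) := by
      have h2 := Complex.add_conj (inner ℂ (z 0) (a.1 (z 1)))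
      push_cast at h2 ⊢
      linear_combination h2
    refine le_of_le_of_eq ?_ h1.symm
    rw [Complex.zero_le_real]
    have h3 : -(inner ℂ (z 0) (a.1 (z 1)) : ℂ).re ≤ ‖z 0‖ * (‖a‖ * ‖z 1‖) := by
      refine (neg_le_abs _).trans ((Complex.abs_re_le_norm _).trans
        ((norm_inner_le_norm _ _).trans ?_))
      exact mul_le_mul_of_nonneg_left (a.1.le_opNorm _) (norm_nonneg _)
    nlinarith [mul_nonneg (norm_nonneg a) (sq_nonneg (‖z 0‖ - ‖z 1‖))]
  have h := hφ 2 _ hpos ![x, y]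
  simpa [Fin.sum_univ_two, inner_smul_right] using h

theorem cpMaps.map_star {φ : diskSystem d →ₗ[ℂ] (ℋ →L[ℂ] ℋ)} (hφ : φ ∈ cpMaps d ℋ)
    (a : diskSystem d) : φ (diskStar a) = star (φ a) := by
  have him : ∀ x y : ℋ, (inner ℂ x (φ a y) + inner ℂ y (φ (diskStar a) x) : ℂ).im = 0 := by
    intro x y
    have h1 := (Complex.nonneg_iff.mp (cpMaps.nonneg_two hφ a x y)).2
    have h2 := (Complex.nonneg_iff.mp (cpMaps.inner_one_nonneg hφ x)).2
    have h3 := (Complex.nonneg_iff.mp (cpMaps.inner_one_nonneg hφ y)).2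
    simp only [Complex.add_im, Complex.im_ofReal_mul, ← h2, ← h3] at h1 ⊢
    linarith
  refine ContinuousLinearMap.ext fun x => ext_inner_left ℂ fun y => ?_
  rw [inner_star_right, ← inner_conj_symm]
  have h1 := him x y
  -- The vector `y` shows that the imaginary parts are opposite; `i y` shows that the real parts
  -- agree.
  have h2 := him x (Complex.I • y)
  rw [map_smul, inner_smul_right, inner_smul_left] at h2
  simp only [Complex.add_im, Complex.mul_im, Complex.conj_I, Complex.neg_re, Complex.neg_im,
    Complex.I_re, Complex.I_im] at h1 h2
  have h3 := inner_conj_symm (𝕜 := ℂ) (φ a y) x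
  rw [inner_conj_symm, ← h3]
  apply Complex.ext
  · rw [Complex.conj_re]
    linarith
  · rw [Complex.conj_im]
    linarith

theorem cpMaps.norm_apply_le {φ : diskSystem d →ₗ[ℂ] (ℋ →L[ℂ] ℋ)} (hφ : φ ∈ cpMaps d ℋ)
    (a : diskSystem d) : ‖φ a‖ ≤ ‖φ (diskOne d)‖ * ‖a‖ := by
  refine ContinuousLinearMap.opNorm_le_bound _ (by positivity) fun y => ?_
  by_cases hy : ‖y‖ = 0
  · rw [norm_eq_zero.mp hy]
    simp
  by_cases hz : ‖φ a y‖ = 0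
  · rw [hz]
    positivity
  set z := φ a y with hz'
  -- The vector `-s z` has the norm of `y` and is opposed to `z = φ(a) y`, so 2-positivity at the
  -- pair `(-s z, y)` bounds `‖y‖ ‖z‖`.
  set s : ℝ := ‖y‖ / ‖z‖ with hs
  have hone : ∀ x : ℋ, (inner ℂ x (φ (diskOne d) x) : ℂ).re ≤ ‖φ (diskOne d)‖ * ‖x‖ ^ 2 := by
    intro x
    refine (Complex.re_le_norm _).trans ((norm_inner_le_norm _ _).trans ?_)
    have := (φ (diskOne d)).le_opNorm x
    nlinarith [norm_nonneg x]
  have h := (Complex.nonneg_iff.mp (cpMaps.nonneg_two hφ a ((-s : ℂ) • z) y)).1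
  rw [cpMaps.map_star hφ, inner_star_right, ← hz', ← inner_conj_symm z, Complex.add_re,
    Complex.add_re, Complex.add_re, Complex.conj_re, Complex.re_ofReal_mul,
    Complex.re_ofReal_mul] at h
  have h1 : (inner ℂ ((-s : ℂ) • z) z : ℂ).re = -(‖y‖ * ‖z‖) := by
    have h2 : (inner ℂ z z : ℂ) = ((‖z‖ ^ 2 : ℝ) : ℂ) := by
      rw [inner_self_eq_norm_sq_to_K]
      norm_cast
    rw [inner_smul_left, h2, map_neg, Complex.conj_ofReal, ← Complex.ofReal_neg,
      ← Complex.ofReal_mul, Complex.ofReal_re, hs]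
    field_simp
  have h2 : ‖(-s : ℂ) • z‖ = ‖y‖ := by
    rw [norm_smul, norm_neg, Complex.norm_real, Real.norm_of_nonneg (by positivity), hs]
    field_simp
  have h3 := hone ((-s : ℂ) • z)
  have h4 := hone y
  rw [h2] at h3
  rw [h1] at h
  have h5 := mul_le_mul_of_nonneg_left h3 (norm_nonneg a)
  have h6 := mul_le_mul_of_nonneg_left h4 (norm_nonneg a)
  have hy0 : 0 < ‖y‖ := lt_of_le_of_ne (norm_nonneg _) (Ne.symm hy)
  have h7 : ‖y‖ * ‖z‖ ≤ ‖y‖ * (‖φ (diskOne d)‖ * ‖a‖ * ‖y‖) := by nlinarith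
  exact le_of_mul_le_mul_left h7 hy0

theorem cpMaps.continuous {φ : diskSystem d →ₗ[ℂ] (ℋ →L[ℂ] ℋ)} (hφ : φ ∈ cpMaps d ℋ) :
    Continuous φ :=
  AddMonoidHomClass.continuous_of_bound φ _ (cpMaps.norm_apply_le hφ)

/-- A closed subspace of the free disk operator system that is stable under the involution and
contains the powers of the left free shift is everything. -/
theorem diskSystem_eq_top {Q : Submodule ℂ (diskSystem d)} (hQ : IsClosed (Q : Set (diskSystem d)))
    (h : ∀ α, (⟨_, wordPow_mem_diskSystem α⟩ : diskSystem d) ∈ Q)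
    (h' : ∀ α, (⟨_, star_wordPow_mem_diskSystem α⟩ : diskSystem d) ∈ Q) (a : diskSystem d) :
    a ∈ Q := by
  have hcl : IsClosed ((Q.map (diskSystem d).subtype :
      Submodule ℂ (Fock d ℂ →L[ℂ] Fock d ℂ)) : Set (Fock d ℂ →L[ℂ] Fock d ℂ)) := by
    rw [Submodule.map_coe]
    exact isClosed_diskSystem.isClosedEmbedding_subtypeVal.isClosedMap _ hQ
  obtain ⟨b, hb, hba⟩ := diskSystem_le hcl (fun α => ⟨_, h α, rfl⟩) (fun α => ⟨_, h' α, rfl⟩) a.2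
  rwa [← Subtype.ext (a1 := b) (a2 := a) hba]

theorem cpMaps.ext_wordPow {φ ψ : diskSystem d →ₗ[ℂ] (ℋ →L[ℂ] ℋ)} (hφ : φ ∈ cpMaps d ℋ)
    (hψ : ψ ∈ cpMaps d ℋ)
    (h : ∀ α, φ ⟨_, wordPow_mem_diskSystem α⟩ = ψ ⟨_, wordPow_mem_diskSystem α⟩) : φ = ψ := by
  refine LinearMap.ext fun a => ?_
  have hcl : IsClosed ((LinearMap.eqLocus φ ψ : Submodule ℂ (diskSystem d)) :
      Set (diskSystem d)) :=
    isClosed_eq (cpMaps.continuous hφ) (cpMaps.continuous hψ)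
  refine diskSystem_eq_top hcl h (fun α => ?_) a
  have h1 := cpMaps.map_star hφ ⟨_, wordPow_mem_diskSystem α⟩
  rw [h, ← cpMaps.map_star hψ] at h1
  exact h1

/-- The values at the unit bound all the norms uniformly, so the elements on which the sequence is
Cauchy form a closed subspace. It contains the words and, by compatibility with adjoints, their
adjoints. Positivity passes to pointwise limits. -/
theorem cpMaps.exists_limit {S : ℕ → diskSystem d →ₗ[ℂ] (ℋ →L[ℂ] ℋ)}
    (hS : ∀ N, S N ∈ cpMaps d ℋ) {C : ℝ} (hC : ∀ N, ‖S N (diskOne d)‖ ≤ C)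
    (l : Word d → (ℋ →L[ℂ] ℋ))
    (hl : ∀ α, Filter.Tendsto (fun N => S N ⟨_, wordPow_mem_diskSystem α⟩) Filter.atTop
      (𝓝 (l α))) :
    ∃ φ ∈ cpMaps d ℋ, ∀ α, φ ⟨_, wordPow_mem_diskSystem α⟩ = l α := by
  have hC0 : 0 ≤ C := (norm_nonneg _).trans (hC 0)
  have hbound : ∀ N a, ‖S N a‖ ≤ C * ‖a‖ := fun N a =>
    (cpMaps.norm_apply_le (hS N) a).trans (mul_le_mul_of_nonneg_right (hC N) (norm_nonneg _))
  let Q : Submodule ℂ (diskSystem d) :=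
    { carrier := {a | CauchySeq fun N => S N a}
      add_mem' := fun {a b} ha hb => by
        have := CauchySeq.add ha hb
        simpa [Pi.add_def] using this
      zero_mem' := by
        simpa using cauchySeq_const (0 : ℋ →L[ℂ] ℋ)
      smul_mem' := fun c a ha => by
        have := (uniformContinuous_const_smul c).comp_cauchySeq ha
        simpa [Function.comp_def] using this }
  have hQ : IsClosed (Q : Set (diskSystem d)) := by
    refine isClosed_of_closure_subset fun a ha => ?_
    refine Metric.cauchySeq_iff'.mpr fun ε hε => ?_
    obtain ⟨b, hb, hab⟩ := Metric.mem_closure_iff.mp ha (ε / (3 * (C + 1))) (by positivity)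
    obtain ⟨N, hN⟩ := Metric.cauchySeq_iff'.mp hb (ε / 3) (by positivity)
    refine ⟨N, fun n hn => ?_⟩
    have h1 : ∀ m, dist (S m a) (S m b) < ε / 3 := by
      intro m
      rw [dist_eq_norm, ← map_sub]
      rw [dist_eq_norm] at hab
      calc _ ≤ C * ‖a - b‖ := hbound m _
        _ ≤ (C + 1) * ‖a - b‖ := by gcongr; linarith
        _ < (C + 1) * (ε / (3 * (C + 1))) := mul_lt_mul_of_pos_left hab (by positivity)
        _ = ε / 3 := by field_simp
    calc _ ≤ dist (S n a) (S n b) + dist (S n b) (S N b) + dist (S N b) (S N a) :=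
          dist_triangle4 _ _ _ _
      _ < ε / 3 + ε / 3 + ε / 3 := by
          have := h1 N
          rw [dist_comm] at this
          linarith [h1 n, hN n hn]
      _ = ε := by ring
  have hall : ∀ a, CauchySeq fun N => S N a := by
    refine diskSystem_eq_top hQ (fun α => (hl α).cauchySeq) fun α => ?_
    have h1 : ∀ N, S N ⟨_, star_wordPow_mem_diskSystem α⟩ =
        star (S N ⟨_, wordPow_mem_diskSystem α⟩) := fun N =>
      cpMaps.map_star (hS N) ⟨_, wordPow_mem_diskSystem α⟩
    show CauchySeq _
    simp only [h1]
    exact ((continuous_star.tendsto _).comp (hl α)).cauchySeq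
  choose f hf using fun a => cauchySeq_tendsto_of_complete (hall a)
  let φ : diskSystem d →ₗ[ℂ] (ℋ →L[ℂ] ℋ) :=
    { toFun := f
      map_add' := fun a b => tendsto_nhds_unique (hf (a + b)) (by
        simpa using (hf a).add (hf b))
      map_smul' := fun c a => tendsto_nhds_unique (hf (c • a)) (by
        simpa using (hf a).const_smul c) }
  refine ⟨φ, fun n a ha x => ?_, fun α => tendsto_nhds_unique (hf _) (hl α)⟩
  have htend : Filter.Tendsto (fun N => ∑ i, ∑ j, inner ℂ (x i) (S N (a i j) (x j)))
      Filter.atTop (𝓝 (∑ i, ∑ j, inner ℂ (x i) (f (a i j) (x j)))) := by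
    refine tendsto_finsetSum _ fun i _ => tendsto_finsetSum _ fun j _ => ?_
    have hc : Continuous fun T : ℋ →L[ℂ] ℋ => (inner ℂ (x i) (T (x j)) : ℂ) := by fun_prop
    exact (hc.tendsto _).comp (hf (a i j))
  exact ge_of_tendsto' htend fun N => hS N n a ha x

theorem cpMaps.add_mem {φ ψ : diskSystem d →ₗ[ℂ] (ℋ →L[ℂ] ℋ)} (hφ : φ ∈ cpMaps d ℋ)
    (hψ : ψ ∈ cpMaps d ℋ) : φ + ψ ∈ cpMaps d ℋ := by
  intro n a ha x
  have h := add_nonneg (hφ n a ha x) (hψ n a ha x)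
  simpa [inner_add_right, Finset.sum_add_distrib] using h

theorem cpMaps.zero_mem : (0 : diskSystem d →ₗ[ℂ] (ℋ →L[ℂ] ℋ)) ∈ cpMaps d ℋ := by
  intro n a ha x
  simp

theorem cpMaps.sum_mem {ι : Type*} (s : Finset ι) {φ : ι → diskSystem d →ₗ[ℂ] (ℋ →L[ℂ] ℋ)}
    (hφ : ∀ i ∈ s, φ i ∈ cpMaps d ℋ) : ∑ i ∈ s, φ i ∈ cpMaps d ℋ := by
  classical
  induction s using Finset.induction_on with
  | empty => simpa using cpMaps.zero_mem
  | insert i s hi ih =>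
    rw [Finset.sum_insert hi]
    exact cpMaps.add_mem (hφ i (Finset.mem_insert_self i s))
      (ih fun j hj => hφ j (Finset.mem_insert_of_mem hj))

theorem cpMaps.smul_mem {φ : diskSystem d →ₗ[ℂ] (ℋ →L[ℂ] ℋ)} (hφ : φ ∈ cpMaps d ℋ) {t : ℝ}
    (ht : 0 ≤ t) : (t : ℂ) • φ ∈ cpMaps d ℋ := by
  intro n a ha x
  have h := mul_nonneg (Complex.zero_le_real.mpr ht) (hφ n a ha x)
  simpa [inner_smul_right, Finset.mul_sum] using h

variable {𝒦 : Type*} [NormedAddCommGroup 𝒦] [InnerProductSpace ℂ 𝒦] [CompleteSpace 𝒦]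

/-- The map `a ↦ ∑ ⟨e_α, a e_β⟩ A_α^* A_β`, with the sum over a finite set of words. -/
def gramMap (s : Finset (Word d)) (A : Word d → ℋ →L[ℂ] 𝒦) :
    diskSystem d →ₗ[ℂ] (ℋ →L[ℂ] ℋ) where
  toFun a := ∑ α ∈ s, ∑ β ∈ s, (inner ℂ (fockBasis α) (a.1 (fockBasis β)) : ℂ) •
    (ContinuousLinearMap.adjoint (A α) ∘L A β)
  map_add' a b := by
    simp [add_smul, Finset.sum_add_distrib]
  map_smul' c a := by
    simp [mul_smul, Finset.smul_sum]

theorem gramMap_apply (s : Finset (Word d)) (A : Word d → ℋ →L[ℂ] 𝒦) (a : diskSystem d) :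
    gramMap s A a = ∑ α ∈ s, ∑ β ∈ s, (inner ℂ (fockBasis α) (a.1 (fockBasis β)) : ℂ) •
      (ContinuousLinearMap.adjoint (A α) ∘L A β) := rfl

/-- In an orthonormal basis `b_l` of the finite-dimensional span of the `A_α x_i`, the quadratic
form splits into `∑_l ∑_{i,j} ⟨X_{l,i}, a_{ij} X_{l,j}⟩` with `X_{l,i} = ∑_α ⟨b_l, A_α x_i⟩ e_α`,
and each `l` contributes a nonnegative amount. -/
theorem gramMap_mem_cpMaps (s : Finset (Word d)) (A : Word d → ℋ →L[ℂ] 𝒦) :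
    gramMap s A ∈ cpMaps d ℋ := by
  intro n a ha x
  let U : Submodule ℂ 𝒦 := Submodule.span ℂ
    (Set.range fun p : Fin n × s => A p.2.1 (x p.1))
  have hU : ∀ i, ∀ α ∈ s, A α (x i) ∈ U := fun i α hα =>
    Submodule.subset_span ⟨(i, ⟨α, hα⟩), rfl⟩
  have : FiniteDimensional ℂ U := FiniteDimensional.span_of_finite ℂ (Set.finite_range _)
  let b := stdOrthonormalBasis ℂ U
  have hinner : ∀ i j, ∀ α ∈ s, ∀ β ∈ s, (inner ℂ (A α (x i)) (A β (x j)) : ℂ) =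
      ∑ l, starRingEnd ℂ (inner ℂ (b l : 𝒦) (A α (x i))) * inner ℂ (b l : 𝒦) (A β (x j)) := by
    intro i j α hα β hβ
    have h := b.sum_inner_mul_inner ⟨_, hU i α hα⟩ ⟨_, hU j β hβ⟩
    simp only [Submodule.coe_inner] at h
    rw [← h]
    exact Finset.sum_congr rfl fun l _ => by rw [inner_conj_symm]
  let X : _ → Fin n → Fock d ℂ := fun l i => ∑ α ∈ s, (inner ℂ (b l : 𝒦) (A α (x i)) : ℂ) •
    fockBasis α
  have hsum : ∑ i, ∑ j, inner ℂ (x i) ((a.map (gramMap s A)) i j (x j)) =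
      ∑ l, ∑ i, ∑ j, inner ℂ (X l i) ((a i j).1 (X l j)) := by
    have hX : ∀ l i j, (inner ℂ (X l i) ((a i j).1 (X l j)) : ℂ) = ∑ α ∈ s, ∑ β ∈ s,
        starRingEnd ℂ (inner ℂ (b l : 𝒦) (A α (x i))) * inner ℂ (b l : 𝒦) (A β (x j)) *
          inner ℂ (fockBasis α) ((a i j).1 (fockBasis β)) := by
      intro l i j
      simp only [X, map_sum, map_smul, sum_inner, inner_sum, inner_smul_left, inner_smul_right]
      refine Eq.trans (Finset.sum_congr rfl fun β _ => ?_) Finset.sum_comm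
      rw [Finset.mul_sum]
      refine Finset.sum_congr rfl fun α _ => ?_
      ring
    simp only [hX]
    refine Eq.trans (Finset.sum_congr rfl fun i _ => ?_) Finset.sum_comm
    refine Eq.trans (Finset.sum_congr rfl fun j _ => ?_) Finset.sum_comm
    rw [Matrix.map_apply, gramMap_apply]
    simp only [_root_.sum_apply, inner_sum]
    refine Eq.trans (Finset.sum_congr rfl fun α hα => ?_) Finset.sum_comm
    refine Eq.trans (Finset.sum_congr rfl fun β hβ => ?_) Finset.sum_comm
    rw [_root_.smul_apply, inner_smul_right, ContinuousLinearMap.comp_apply,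
      ContinuousLinearMap.adjoint_inner_right, hinner i j α hα β hβ, Finset.mul_sum]
    refine Finset.sum_congr rfl fun l _ => ?_
    ring
  rw [hsum]
  exact Finset.sum_nonneg fun l _ => ha (X l)

end CPMaps

/-! ### Kernels and their dilations -/

section Dilation

variable {d : ℕ} {ℋ : Type*} [NormedAddCommGroup ℋ] [InnerProductSpace ℂ ℋ] [CompleteSpace ℋ]

theorem star_szego (α β : Word d) : star (szego α β : ℋ →L[ℂ] ℋ) = szego β α := by
  by_cases h : α = β
  · simp [szego, h]
  · simp [szego, h, Ne.symm h]

theorem star_rightHerglotzKernel (F : FreeSeries d (ℋ →L[ℂ] ℋ)) (α β : Word d) :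
    star (rightHerglotzKernel F α β) = rightHerglotzKernel F β α := by
  simp only [rightHerglotzKernel, star_smul, star_add, star_sum, star_mul, star_star, star_szego]
  rw [add_comm]
  simp

/-- The right kernel cuts words from the left, so the empty prefix meets a nonempty word and
contributes nothing; in all other terms the first letters are compared by the Szegő delta. This
invariance under left shifts produces the row isometry. -/
theorem rightHerglotzKernel_cons_cons (F : FreeSeries d (ℋ →L[ℂ] ℋ)) (i j : Fin d)
    (α β : Word d) : rightHerglotzKernel F (i :: α) (j :: β) =
      if i = j then rightHerglotzKernel F α β else 0 := by
  have hs : ∀ (i j : Fin d) (γ δ : Word d), (szego (i :: γ) (j :: δ) : ℋ →L[ℂ] ℋ) =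
      if i = j then szego γ δ else 0 := by
    intro i j γ δ
    by_cases h : i = j <;> simp [szego, h]
  have hnil : ∀ (j : Fin d) (δ : Word d), (szego [] (j :: δ) : ℋ →L[ℂ] ℋ) = 0 := by
    intro j δ
    simp [szego]
  have hnil' : ∀ (j : Fin d) (δ : Word d), (szego (j :: δ) [] : ℋ →L[ℂ] ℋ) = 0 := by
    intro j δ
    simp [szego]
  simp only [rightHerglotzKernel, List.length_cons]
  rw [Finset.sum_range_succ', Finset.sum_range_succ' _ (β.length + 1)]
  simp only [List.drop_succ_cons, List.take_succ_cons, List.take_zero, hs, hnil, hnil', mul_zero,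
    zero_mul, add_zero]
  by_cases h : i = j <;> simp [h]

theorem rightHerglotzKernel_nil (F : FreeSeries d (ℋ →L[ℂ] ℋ)) (γ : Word d) :
    rightHerglotzKernel F [] γ =
      (2⁻¹ : ℂ) • ((if γ = [] then F [] else 0) + star (F γ)) := by
  rw [rightHerglotzKernel]
  congr 2
  · by_cases h : γ = []
    · simp [szego, h]
    · simp [szego, h, Ne.symm h]
  · rw [Finset.sum_eq_single 0]
    · simp [szego]
    · intro i hi h0
      have hi := Finset.mem_range.mp hi
      have : ([] : Word d) ≠ γ.take i := by
        intro h
        have := congrArg List.length h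
        simp only [List.length_nil, List.length_take] at this
        omega
      simp [szego, this]
    · simp

universe u

/-- The dilation space is the reproducing kernel Hilbert space of `K`, with the kernel functions as
the maps `v x`. -/
theorem exists_kolmogorov_decomposition {X : Type} {V : Type u} [NormedAddCommGroup V]
    [InnerProductSpace ℂ V] [CompleteSpace V] (K : X → X → V →L[ℂ] V)
    (hstar : ∀ x y, star (K x y) = K y x)
    (hK : ∀ (s : Finset X) (h : X → V), 0 ≤ ∑ x ∈ s, ∑ y ∈ s, inner ℂ (h x) (K x y (h y))) :
    ∃ (𝒦 : Type u) (_ : NormedAddCommGroup 𝒦) (_ : InnerProductSpace ℂ 𝒦)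
      (_ : CompleteSpace 𝒦) (v : X → V →L[ℂ] 𝒦),
      (∀ x y, ContinuousLinearMap.adjoint (v x) ∘L v y = K x y) ∧
        Dense (Submodule.span ℂ {z | ∃ x h, v x h = z} : Set 𝒦) := by
  have hpos : Matrix.PosSemidef (Matrix.of K) := by
    have hiff := (RKHS.posSemidef_tfae (K := Matrix.of K)).out 0 2
    refine hiff.mpr ⟨?_, fun vv => ?_⟩
    · exact Matrix.ext fun x y => hstar y x
    · have h := (Complex.nonneg_iff.mp (hK vv.support vv)).1
      rw [Finset.sum_comm] at h
      simp only [Complex.re_sum] at h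
      simp only [Finsupp.sum, map_sum, Matrix.of_apply]
      refine h.trans_eq (Finset.sum_congr rfl fun x _ => Finset.sum_congr rfl fun y _ => ?_)
      exact inner_re_symm (𝕜 := ℂ) _ _
  have : Fact (Matrix.PosSemidef (Matrix.of K)) := ⟨hpos⟩
  refine ⟨RKHS.OfKernel (Matrix.of K), inferInstance, inferInstance, inferInstance,
    RKHS.kerFun _, fun x y => ?_, ?_⟩
  · rw [← RKHS.kernel_apply, RKHS.OfKernel.kernel_ofKernel, Matrix.of_apply]
  · rw [Submodule.dense_iff_topologicalClosure_eq_top]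
    exact RKHS.kerFun_dense _

/-- The recursion for `K` says that `v_α h ↦ v_{iα} h` preserves inner products and that different
`i` give orthogonal images. Working with finitely supported combinations `e`, `f i` avoids checking
that the map is well defined on the span before extending by density. -/
theorem exists_rowIsometry {𝒦 : Type*} [NormedAddCommGroup 𝒦] [InnerProductSpace ℂ 𝒦]
    [CompleteSpace 𝒦] {K : Word d → Word d → ℋ →L[ℂ] ℋ} {v : Word d → ℋ →L[ℂ] 𝒦}
    (hv : ∀ α β, ContinuousLinearMap.adjoint (v α) ∘L v β = K α β)
    (hdense : Dense (Submodule.span ℂ {z | ∃ x h, v x h = z} : Set 𝒦))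
    (hK : ∀ i j α β, K (i :: α) (j :: β) = if i = j then K α β else 0) :
    ∃ V : Fin d → 𝒦 →L[ℂ] 𝒦, IsRowIsometry V ∧ ∀ i α h, V i (v α h) = v (i :: α) h := by
  have hin : ∀ α β x y, (inner ℂ (v α x) (v β y) : ℂ) = inner ℂ x (K α β y) := by
    intro α β x y
    rw [← hv, ContinuousLinearMap.comp_apply, ContinuousLinearMap.adjoint_inner_right]
  let e : (Word d × ℋ →₀ ℂ) →ₗ[ℂ] 𝒦 := Finsupp.linearCombination ℂ fun p => v p.1 p.2
  let f : Fin d → (Word d × ℋ →₀ ℂ) →ₗ[ℂ] 𝒦 := fun i =>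
    Finsupp.linearCombination ℂ fun p => v (i :: p.1) p.2
  have he : DenseRange e := by
    have h1 : (LinearMap.range e : Submodule ℂ 𝒦) =
        Submodule.span ℂ {z | ∃ x h, v x h = z} := by
      rw [Finsupp.range_linearCombination]
      congr 1
      ext z
      simp
    have h2 : Set.range e = (LinearMap.range e : Submodule ℂ 𝒦) := rfl
    rw [DenseRange, h2, h1]
    exact hdense
  have hf : ∀ i j x y, (inner ℂ (f i x) (f j y) : ℂ) =
      if i = j then inner ℂ (e x) (e y) else 0 := by
    intro i j x y
    simp only [f, e, Finsupp.linearCombination_apply, Finsupp.sum, sum_inner, inner_sum,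
      inner_smul_left, inner_smul_right, hin, hK]
    by_cases h : i = j <;> simp [h]
  have hnorm : ∀ i x, ‖f i x‖ ≤ 1 * ‖e x‖ := by
    intro i x
    have h := hf i i x x
    rw [if_pos rfl, inner_self_eq_norm_sq_to_K, inner_self_eq_norm_sq_to_K] at h
    have h2 : ‖f i x‖ ^ 2 = ‖e x‖ ^ 2 := by exact_mod_cast h
    rw [one_mul]
    exact ((sq_eq_sq₀ (norm_nonneg _) (norm_nonneg _)).mp h2).le
  have hext : ∀ i x, (f i).extendOfNorm e (e x) = f i x := fun i x =>
    LinearMap.extendOfNorm_eq he ⟨1, hnorm i⟩ x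
  refine ⟨fun i => (f i).extendOfNorm e, fun i j => ?_, fun i α h => ?_⟩
  · have h1 : ∀ ξ η, (inner ℂ ((f i).extendOfNorm e ξ) ((f j).extendOfNorm e η) : ℂ) =
        if i = j then inner ℂ ξ η else 0 := by
      intro ξ η
      refine he.induction_on₂ (p := fun ξ η => (inner ℂ ((f i).extendOfNorm e ξ)
        ((f j).extendOfNorm e η) : ℂ) = if i = j then inner ℂ ξ η else 0) ?_ ?_ ξ η
      · refine isClosed_eq (by fun_prop) ?_
        by_cases h : i = j
        · simp only [h, if_true]
          fun_prop
        · simp only [h, if_false]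
          fun_prop
      · intro x y
        rw [hext, hext, hf]
    refine ContinuousLinearMap.ext fun η => ext_inner_left ℂ fun ξ => ?_
    rw [mul_apply_eq_comp, inner_star_right, h1]
    by_cases h : i = j <;> simp [h]
  · have h1 := hext i (Finsupp.single (α, h) 1)
    simpa [e, f] using h1

end Dilation

/-! ### Fejér means of a row isometry -/

section Fejer

variable {d : ℕ} {𝒦 : Type*} [NormedAddCommGroup 𝒦] [InnerProductSpace ℂ 𝒦] [CompleteSpace 𝒦]

/-- The projection `∑_{|β| = k} V^β V^{β*}`. -/
def rangeProj (V : Fin d → 𝒦 →L[ℂ] 𝒦) (k : ℕ) : 𝒦 →L[ℂ] 𝒦 :=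
  ∑ β ∈ wordsOf d k, wordPow V β * star (wordPow V β)

theorem rangeProj_zero (V : Fin d → 𝒦 →L[ℂ] 𝒦) : rangeProj V 0 = 1 := by
  simp [rangeProj, sum_wordsOf_zero]

theorem rangeProj_one (V : Fin d → 𝒦 →L[ℂ] 𝒦) : rangeProj V 1 = ∑ i, V i * star (V i) := by
  rw [rangeProj, sum_wordsOf_succ]
  refine Finset.sum_congr rfl fun i _ => ?_
  rw [sum_wordsOf_zero, wordPow_cons, wordPow_nil, mul_one]

theorem sum_wordPow_mul_rangeProj_one (V : Fin d → 𝒦 →L[ℂ] 𝒦) (k : ℕ) :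
    ∑ β ∈ wordsOf d k, wordPow V β * rangeProj V 1 * star (wordPow V β) =
      rangeProj V (k + 1) := by
  have h := sum_wordsOf_add (d := d) k 1 fun α β =>
    wordPow V (α ++ β) * star (wordPow V (α ++ β))
  simp only [List.take_append_drop] at h
  rw [rangeProj, rangeProj, h]
  refine Finset.sum_congr rfl fun β _ => ?_
  rw [Finset.mul_sum, Finset.sum_mul]
  refine Finset.sum_congr rfl fun γ _ => ?_
  rw [wordPow_append, star_mul]
  simp only [mul_assoc]

/-- The complement of the ranges is cut out by a projection, so it can be written as `T^* T` and
enter a Gram sum. -/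
theorem IsRowIsometry.star_one_sub_rangeProj_mul {V : Fin d → 𝒦 →L[ℂ] 𝒦}
    (hV : IsRowIsometry V) :
    star (1 - rangeProj V 1) * (1 - rangeProj V 1) = 1 - rangeProj V 1 := by
  have h1 : star (rangeProj V 1) = rangeProj V 1 := by
    simp [rangeProj_one, star_sum]
  have h2 : rangeProj V 1 * rangeProj V 1 = rangeProj V 1 := by
    rw [rangeProj_one, Finset.sum_mul_sum]
    refine Finset.sum_congr rfl fun i _ => ?_
    rw [Finset.sum_eq_single i]
    · rw [mul_assoc, ← mul_assoc (star (V i)), hV, if_pos rfl, one_mul]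
    · intro j _ hj
      rw [mul_assoc, ← mul_assoc (star (V i)), hV, if_neg hj.symm, zero_mul, mul_zero]
    · simp
  rw [star_sub, star_one, h1, sub_mul, mul_sub, mul_sub, h2]
  simp

theorem sum_wordsLt_one_sub_rangeProj (V : Fin d → 𝒦 →L[ℂ] 𝒦) (m : ℕ) :
    ∑ β ∈ wordsLt d m, wordPow V β * (1 - rangeProj V 1) * star (wordPow V β) =
      1 - rangeProj V m := by
  rw [sum_wordsLt]
  have h : ∀ k, ∑ β ∈ wordsOf d k, wordPow V β * (1 - rangeProj V 1) * star (wordPow V β) =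
      rangeProj V k - rangeProj V (k + 1) := by
    intro k
    simp only [mul_sub, sub_mul, mul_one, Finset.sum_sub_distrib, sum_wordPow_mul_rangeProj_one]
    rfl
  simp only [h, Finset.sum_range_sub', rangeProj_zero]

theorem IsRowIsometry.norm_inner_rangeProj_le {V : Fin d → 𝒦 →L[ℂ] 𝒦} (hV : IsRowIsometry V)
    (k : ℕ) (x y : 𝒦) : ‖(inner ℂ y (rangeProj V k x) : ℂ)‖ ≤ ‖y‖ * ‖x‖ := by
  have h1 : (inner ℂ y (rangeProj V k x) : ℂ) =
      ∑ β ∈ wordsOf d k, inner ℂ (star (wordPow V β) y) (star (wordPow V β) x) := by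
    rw [rangeProj, _root_.sum_apply, inner_sum]
    refine Finset.sum_congr rfl fun β _ => ?_
    rw [inner_star_left, mul_apply_eq_comp]
  rw [h1]
  calc _ ≤ ∑ β ∈ wordsOf d k, ‖star (wordPow V β) y‖ * ‖star (wordPow V β) x‖ :=
        (norm_sum_le _ _).trans (Finset.sum_le_sum fun β _ => norm_inner_le_norm _ _)
    _ ≤ √(∑ β ∈ wordsOf d k, ‖star (wordPow V β) y‖ ^ 2) *
        √(∑ β ∈ wordsOf d k, ‖star (wordPow V β) x‖ ^ 2) := Real.sum_mul_le_sqrt_mul_sqrt _ _ _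
    _ ≤ √(‖y‖ ^ 2) * √(‖x‖ ^ 2) :=
        mul_le_mul (Real.sqrt_le_sqrt (hV.sum_norm_star_wordPow_sq_le k y))
          (Real.sqrt_le_sqrt (hV.sum_norm_star_wordPow_sq_le k x)) (Real.sqrt_nonneg _)
          (Real.sqrt_nonneg _)
    _ = ‖y‖ * ‖x‖ := by rw [Real.sqrt_sq (norm_nonneg _), Real.sqrt_sq (norm_nonneg _)]

theorem IsRowIsometry.norm_rangeProj_le {V : Fin d → 𝒦 →L[ℂ] 𝒦} (hV : IsRowIsometry V) (k : ℕ) :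
    ‖rangeProj V k‖ ≤ 1 := by
  refine ContinuousLinearMap.opNorm_le_bound _ zero_le_one fun x => ?_
  have h := hV.norm_inner_rangeProj_le k x (rangeProj V k x)
  generalize rangeProj V k x = y at h ⊢
  rw [inner_self_eq_norm_sq_to_K, norm_pow, RCLike.norm_ofReal, abs_norm] at h
  by_contra hlt
  push Not at hlt
  nlinarith [norm_nonneg x]

/-- Each projection from the first sum cancels against the second, except at the two ends. For `s +
1 ≤ g` the truncated subtraction gives `1 - rangeProj V 0 = 0`. -/
theorem sum_fejer (V : Fin d → 𝒦 →L[ℂ] 𝒦) (g M : ℕ) :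
    ∑ s ∈ Finset.range M, (1 - rangeProj V (s + 1 - g)) +
      ∑ k ∈ Finset.range (M - g), rangeProj V k =
      ((M - g : ℕ) : ℂ) • (1 : 𝒦 →L[ℂ] 𝒦) + 1 - rangeProj V (M - g) := by
  induction M with
  | zero => simp [rangeProj_zero]
  | succ M ih =>
    rw [Finset.sum_range_succ]
    by_cases h : g ≤ M
    · have h1 : M + 1 - g = (M - g) + 1 := by omega
      rw [h1, Finset.sum_range_succ]
      push_cast
      rw [add_smul, one_smul]
      calc _ = (∑ s ∈ Finset.range M, (1 - rangeProj V (s + 1 - g)) +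
            ∑ k ∈ Finset.range (M - g), rangeProj V k) +
            (1 - rangeProj V (M - g + 1)) + rangeProj V (M - g) := by abel
        _ = _ := by rw [ih]; abel
    · have h1 : M + 1 - g = 0 := by omega
      have h2 : M - g = 0 := by omega
      rw [h1]
      rw [h2] at ih
      rw [rangeProj_zero, sub_self, add_zero, ih, rangeProj_zero]

variable {ℋ : Type*} [NormedAddCommGroup ℋ] [InnerProductSpace ℂ ℋ] [CompleteSpace ℋ]

/-- The entry of `L^γ` at `(α, β)` is nonzero only for `α = γβ`, which must again have length less
than `M`. -/
theorem gramMap_wordsLt_wordPow (A : Word d → ℋ →L[ℂ] 𝒦) (M : ℕ) (γ : Word d) :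
    gramMap (wordsLt d M) A ⟨_, wordPow_mem_diskSystem γ⟩ =
      ∑ β ∈ wordsLt d (M - γ.length),
        ContinuousLinearMap.adjoint (A (γ ++ β)) ∘L A β := by
  rw [gramMap_apply, Finset.sum_comm]
  simp only [wordPow_leftCreation_fockBasis, inner_fockBasis, ite_smul, one_smul, zero_smul,
    Finset.sum_ite_eq']
  rw [← Finset.sum_filter]
  refine Finset.sum_congr ?_ fun _ _ => rfl
  ext β
  simp only [Finset.mem_filter, mem_wordsLt, List.length_append]
  omega

theorem gramMap_compression {V : Fin d → 𝒦 →L[ℂ] 𝒦} {T R : 𝒦 →L[ℂ] 𝒦} (hT : star T * T = R)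
    (w : ℋ →L[ℂ] 𝒦) (M : ℕ) (γ : Word d) :
    gramMap (wordsLt d M) (fun β => (T * star (wordPow V β)) ∘L w)
      ⟨_, wordPow_mem_diskSystem γ⟩ =
      ContinuousLinearMap.adjoint w ∘L (wordPow V γ * ∑ β ∈ wordsLt d (M - γ.length),
        wordPow V β * R * star (wordPow V β)) ∘L w := by
  rw [gramMap_wordsLt_wordPow]
  refine ContinuousLinearMap.ext fun x => ext_inner_left ℂ fun y => ?_
  simp only [Finset.mul_sum, _root_.sum_apply, inner_sum, ContinuousLinearMap.comp_apply,
    ContinuousLinearMap.adjoint_inner_right, ← hT, mul_apply_eq_comp, wordPow_append, star_mul]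
  refine Finset.sum_congr rfl fun β _ => ?_
  rw [← inner_star_left (wordPow V γ), ← inner_star_left (wordPow V β), inner_star_right]

/-- The Fejér means of the compression of a row isometry. -/
def fejerMap (V : Fin d → 𝒦 →L[ℂ] 𝒦) (w : ℋ →L[ℂ] 𝒦) (N : ℕ) :
    diskSystem d →ₗ[ℂ] (ℋ →L[ℂ] ℋ) :=
  (((N + 1 : ℝ)⁻¹ : ℝ) : ℂ) • (∑ s ∈ Finset.range (N + 1),
    gramMap (wordsLt d (s + 1)) (fun β => ((1 - rangeProj V 1) * star (wordPow V β)) ∘L w) +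
    gramMap (wordsLt d (N + 1)) (fun β => (1 * star (wordPow V β)) ∘L w))

theorem fejerMap_mem_cpMaps (V : Fin d → 𝒦 →L[ℂ] 𝒦) (w : ℋ →L[ℂ] 𝒦) (N : ℕ) :
    fejerMap V w N ∈ cpMaps d ℋ :=
  cpMaps.smul_mem (cpMaps.add_mem (cpMaps.sum_mem _ fun _ _ => gramMap_mem_cpMaps _ _)
    (gramMap_mem_cpMaps _ _)) (by positivity)

/-- The Gram sums with `1 - rangeProj V 1` see the shift part of `V`, while the last Gram sum
accounts for the part on which the ranges of the `V_i` fill the space. Together they give the Fejér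
weight of `V^γ`, up to a bounded operator divided by `N + 1`; no Wold decomposition is involved. -/
theorem IsRowIsometry.fejerMap_wordPow {V : Fin d → 𝒦 →L[ℂ] 𝒦} (hV : IsRowIsometry V)
    (w : ℋ →L[ℂ] 𝒦) (N : ℕ) (γ : Word d) :
    fejerMap V w N ⟨_, wordPow_mem_diskSystem γ⟩ = (((N + 1 : ℝ)⁻¹ : ℝ) : ℂ) •
      (ContinuousLinearMap.adjoint w ∘L (wordPow V γ *
        (((N + 1 - γ.length : ℕ) : ℂ) • (1 : 𝒦 →L[ℂ] 𝒦) + 1 -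
          rangeProj V (N + 1 - γ.length))) ∘L w) := by
  have h1 : ∀ m, ∑ β ∈ wordsLt d m, wordPow V β * 1 * star (wordPow V β) =
      ∑ k ∈ Finset.range m, rangeProj V k := by
    intro m
    simp only [mul_one]
    exact sum_wordsLt m _
  rw [fejerMap, LinearMap.smul_apply, LinearMap.add_apply, LinearMap.sum_apply,
    gramMap_compression (R := 1) (by simp), h1]
  simp only [gramMap_compression hV.star_one_sub_rangeProj_mul, sum_wordsLt_one_sub_rangeProj]
  rw [← sum_fejer, mul_add, Finset.mul_sum, Finset.mul_sum]
  refine congrArg _ (ContinuousLinearMap.ext fun x => ?_)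
  simp only [_root_.sum_apply, map_sum, _root_.add_apply, ContinuousLinearMap.comp_apply, map_add]

theorem IsRowIsometry.tendsto_fejerMap {V : Fin d → 𝒦 →L[ℂ] 𝒦} (hV : IsRowIsometry V)
    (w : ℋ →L[ℂ] 𝒦) (γ : Word d) :
    Filter.Tendsto (fun N => fejerMap V w N ⟨_, wordPow_mem_diskSystem γ⟩) Filter.atTop
      (𝓝 (ContinuousLinearMap.adjoint w ∘L wordPow V γ ∘L w)) := by
  have hinv : Filter.Tendsto (fun N : ℕ => (((N + 1 : ℝ)⁻¹ : ℝ) : ℂ)) Filter.atTop (𝓝 0) := by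
    have h := tendsto_one_div_add_atTop_nhds_zero_nat (𝕜 := ℝ)
    simp only [one_div] at h
    exact (Complex.continuous_ofReal.tendsto' 0 0 Complex.ofReal_zero).comp h
  have hE : Filter.Tendsto (fun N : ℕ => (((N + 1 : ℝ)⁻¹ : ℝ) : ℂ) •
      ((1 - γ.length : ℂ) • (1 : 𝒦 →L[ℂ] 𝒦) - rangeProj V (N + 1 - γ.length)))
      Filter.atTop (𝓝 0) := by
    refine hinv.zero_smul_isBoundedUnder_le
      (Filter.isBoundedUnder_of ⟨‖(1 - γ.length : ℂ) • (1 : 𝒦 →L[ℂ] 𝒦)‖ + 1, fun N => ?_⟩)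
    refine (norm_sub_le _ _).trans ?_
    gcongr
    exact hV.norm_rangeProj_le _
  have hlim : Filter.Tendsto (fun N : ℕ => ContinuousLinearMap.adjoint w ∘L (wordPow V γ *
      ((1 : 𝒦 →L[ℂ] 𝒦) + (((N + 1 : ℝ)⁻¹ : ℝ) : ℂ) •
      ((1 - γ.length : ℂ) • (1 : 𝒦 →L[ℂ] 𝒦) - rangeProj V (N + 1 - γ.length)))) ∘L w)
      Filter.atTop (𝓝 (ContinuousLinearMap.adjoint w ∘L (wordPow V γ * (1 + 0)) ∘L w)) := by
    have hc : Continuous fun X : 𝒦 →L[ℂ] 𝒦 =>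
        ContinuousLinearMap.adjoint w ∘L (wordPow V γ * (1 + X)) ∘L w := by
      fun_prop
    exact (hc.tendsto 0).comp hE
  rw [add_zero, mul_one] at hlim
  refine hlim.congr' ?_
  -- From here on `N + 1 - |γ|` is a genuine subtraction and casts to `ℂ`.
  filter_upwards [Filter.eventually_ge_atTop γ.length] with N hN
  rw [hV.fejerMap_wordPow]
  refine ContinuousLinearMap.ext fun x => ?_
  have hN1 : ((N : ℂ) + 1) ≠ 0 := by exact_mod_cast Nat.succ_ne_zero N
  have hX : (1 : 𝒦 →L[ℂ] 𝒦) + (((N + 1 : ℝ)⁻¹ : ℝ) : ℂ) •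
      ((1 - γ.length : ℂ) • (1 : 𝒦 →L[ℂ] 𝒦) - rangeProj V (N + 1 - γ.length)) =
      (((N + 1 : ℝ)⁻¹ : ℝ) : ℂ) • (((N + 1 - γ.length : ℕ) : ℂ) • (1 : 𝒦 →L[ℂ] 𝒦) + 1 -
          rangeProj V (N + 1 - γ.length)) := by
    rw [Nat.cast_sub (by omega)]
    push_cast
    have h1 : (1 : 𝒦 →L[ℂ] 𝒦) = ((N : ℂ) + 1)⁻¹ • ((N : ℂ) + 1) • (1 : 𝒦 →L[ℂ] 𝒦) := by
      rw [smul_smul, inv_mul_cancel₀ hN1, one_smul]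
    nth_rewrite 1 [h1]
    rw [← smul_add]
    congr 1
    module
  rw [hX]
  simp

theorem exists_cpMap_of_rowIsometry {V : Fin d → 𝒦 →L[ℂ] 𝒦} (hV : IsRowIsometry V)
    (w : ℋ →L[ℂ] 𝒦) : ∃ φ ∈ cpMaps d ℋ, ∀ γ, φ ⟨_, wordPow_mem_diskSystem γ⟩ =
      ContinuousLinearMap.adjoint w ∘L wordPow V γ ∘L w := by
  obtain ⟨C, hC⟩ := (hV.tendsto_fejerMap w []).norm.bddAbove_range
  refine cpMaps.exists_limit (fejerMap_mem_cpMaps V w) (C := C) (fun N => ?_) _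
    (hV.tendsto_fejerMap w)
  have h1 : diskOne d = ⟨_, wordPow_mem_diskSystem []⟩ := Subtype.ext (wordPow_nil leftCreation).symm
  rw [h1]
  exact hC ⟨N, rfl⟩

end Fejer

/-! ### From positive kernels to completely positive maps -/

section Existence

variable {d : ℕ} {ℋ : Type*} [NormedAddCommGroup ℋ] [InnerProductSpace ℂ ℋ] [CompleteSpace ℋ]

/-- Iterating the shift relation gives `v_γ = V^γ v_∅`, so the compression of `V^γ` to `v_∅` is the
first row of the kernel. -/
theorem exists_cpMap_of_posKernel {F : FreeSeries d (ℋ →L[ℂ] ℋ)}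
    (hF : IsPosKernel (rightHerglotzKernel F)) :
    ∃ φ ∈ cpMaps d ℋ, ∀ γ, φ ⟨_, wordPow_mem_diskSystem γ⟩ = rightHerglotzKernel F [] γ := by
  obtain ⟨𝒦, _, _, _, v, hv, hdense⟩ := exists_kolmogorov_decomposition (rightHerglotzKernel F)
    (star_rightHerglotzKernel F) hF
  obtain ⟨V, hV, hVv⟩ := exists_rowIsometry hv hdense (rightHerglotzKernel_cons_cons F)
  obtain ⟨φ, hφ, h⟩ := exists_cpMap_of_rowIsometry hV (v [])
  refine ⟨φ, hφ, fun γ => ?_⟩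
  have hpow : ∀ γ : Word d, wordPow V γ ∘L v [] = v γ := by
    intro γ
    induction γ with
    | nil =>
      rw [wordPow_nil]
      rfl
    | cons k γ ih =>
      refine ContinuousLinearMap.ext fun x => ?_
      rw [← hVv, ← ih, wordPow_cons]
      rfl
  rw [h, hpow, hv]

end Existence

/-! ### The Herglotz representation of formal series -/

section Representation

variable {d : ℕ} {ℋ : Type*} [NormedAddCommGroup ℋ] [InnerProductSpace ℂ ℋ] [CompleteSpace ℋ]

theorem isSelfAdjoint_im (T : ℋ →L[ℂ] ℋ) : IsSelfAdjoint (im T) := by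
  rw [isSelfAdjoint_iff, im, star_smul, star_sub, star_star, ← neg_sub T, smul_neg, ← neg_smul]
  congr 1
  simp

theorem I_smul_im (T : ℋ →L[ℂ] ℋ) : Complex.I • im T = (2⁻¹ : ℂ) • (T - star T) := by
  rw [im, smul_smul]
  congr 1
  rw [mul_inv, mul_comm, mul_assoc, inv_mul_cancel₀ Complex.I_ne_zero, mul_one]

theorem im_add_I_smul {P C : ℋ →L[ℂ] ℋ} (hP : IsSelfAdjoint P) (hC : IsSelfAdjoint C) :
    im (P + Complex.I • C) = C := by
  rw [im, star_add, star_smul, hP.star_eq, hC.star_eq]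
  have h : P + Complex.I • C - (P + star Complex.I • C) = (2 * Complex.I) • C := by
    have hI : star Complex.I = -Complex.I := Complex.conj_I
    rw [hI]
    module
  rw [h, smul_smul, inv_mul_cancel₀ (mul_ne_zero two_ne_zero Complex.I_ne_zero), one_smul]

theorem cpMaps.map_herglotzSeries {φ : diskSystem d →ₗ[ℂ] (ℋ →L[ℂ] ℋ)} (hφ : φ ∈ cpMaps d ℋ)
    {α : Word d} (hα : α ≠ []) : φ ⟨herglotzSeries d α, herglotzSeries_mem α⟩ =
      (2 : ℂ) • star (φ ⟨_, wordPow_mem_diskSystem α.reverse⟩) := by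
  have h : (⟨herglotzSeries d α, herglotzSeries_mem α⟩ : diskSystem d) =
      (2 : ℂ) • diskStar ⟨_, wordPow_mem_diskSystem α.reverse⟩ := by
    refine Subtype.ext ?_
    show herglotzSeries d α = (2 : ℂ) • star (wordPow leftCreation α.reverse)
    rw [herglotzSeries_eq, if_neg hα, cauchySeries, ← star_wordPow]
  rw [h, map_smul, cpMaps.map_star hφ]

theorem map_herglotzSeries_nil (φ : diskSystem d →ₗ[ℂ] (ℋ →L[ℂ] ℋ)) :
    φ ⟨herglotzSeries d [], herglotzSeries_mem []⟩ = φ ⟨_, wordPow_mem_diskSystem []⟩ := by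
  congr 1
  refine Subtype.ext ?_
  show herglotzSeries d [] = wordPow leftCreation []
  rw [herglotzSeries_eq, if_pos rfl, wordPow_nil]

theorem cpMaps.isSelfAdjoint_map_one {φ : diskSystem d →ₗ[ℂ] (ℋ →L[ℂ] ℋ)}
    (hφ : φ ∈ cpMaps d ℋ) : IsSelfAdjoint (φ ⟨_, wordPow_mem_diskSystem []⟩) := by
  rw [isSelfAdjoint_iff, ← cpMaps.map_star hφ]
  congr 1
  refine Subtype.ext ?_
  show star (wordPow leftCreation []) = wordPow leftCreation []
  rw [wordPow_nil, star_one]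

theorem herglotzTransform_nil (φ : diskSystem d →ₗ[ℂ] (ℋ →L[ℂ] ℋ)) (C : ℋ →L[ℂ] ℋ) :
    herglotzTransform φ C [] = φ ⟨_, wordPow_mem_diskSystem []⟩ + Complex.I • C := by
  rw [herglotzTransform, Pi.add_apply, map_herglotzSeries_nil]
  simp [const]

theorem cpMaps.herglotzTransform_apply {φ : diskSystem d →ₗ[ℂ] (ℋ →L[ℂ] ℋ)}
    (hφ : φ ∈ cpMaps d ℋ) (C : ℋ →L[ℂ] ℋ) {α : Word d} (hα : α ≠ []) :
    herglotzTransform φ C α = (2 : ℂ) • star (φ ⟨_, wordPow_mem_diskSystem α.reverse⟩) := by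
  rw [herglotzTransform, Pi.add_apply, cpMaps.map_herglotzSeries hφ hα]
  simp [const, hα]

theorem cpMaps.herglotzTransform_injective {φ ψ : diskSystem d →ₗ[ℂ] (ℋ →L[ℂ] ℋ)}
    (hφ : φ ∈ cpMaps d ℋ) (hψ : ψ ∈ cpMaps d ℋ) {C : ℋ →L[ℂ] ℋ}
    (h : herglotzTransform φ C = herglotzTransform ψ C) : φ = ψ := by
  refine cpMaps.ext_wordPow hφ hψ fun γ => ?_
  by_cases hγ : γ = []
  · subst hγ
    have h1 := congrFun h []
    rw [herglotzTransform_nil, herglotzTransform_nil] at h1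
    exact add_right_cancel h1
  · have hγ' : γ.reverse ≠ [] := by simpa using hγ
    have h1 := congrFun h γ.reverse
    rw [cpMaps.herglotzTransform_apply hφ C hγ', cpMaps.herglotzTransform_apply hψ C hγ'] at h1
    have h2 := star_injective (smul_right_injective _ (two_ne_zero (α := ℂ)) h1)
    simpa only [List.reverse_reverse] using h2

/-- The first row of the kernel of the transpose carries `½ H_α^*` at the reversed word of `α ≠ ∅`,
and the real part of `H_∅` at the empty word. The imaginary part of `H_∅` is the constant left over.
-/
theorem IsAccretiveAct.exists_cpMap {H : FreeSeries d (ℋ →L[ℂ] ℋ)} (hH : IsAccretiveAct H) :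
    ∃ φ ∈ cpMaps d ℋ, H = herglotzTransform φ (im (H [])) := by
  obtain ⟨φ, hφ, h⟩ := exists_cpMap_of_posKernel
    (isPosKernel_rightHerglotzKernel ((isPosKernel_leftHerglotzKernel_iff H).mpr hH))
  refine ⟨φ, hφ, funext fun α => ?_⟩
  by_cases hα : α = []
  · subst hα
    rw [herglotzTransform_nil, h, rightHerglotzKernel_nil, I_smul_im, if_pos rfl]
    show H [] = (2⁻¹ : ℂ) • (H [] + star (H [])) + (2⁻¹ : ℂ) • (H [] - star (H []))
    rw [← smul_add, add_add_sub_cancel, ← two_smul ℂ (H []), smul_smul,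
      inv_mul_cancel₀ two_ne_zero, one_smul]
  · have hα' : α.reverse ≠ [] := by simpa using hα
    rw [cpMaps.herglotzTransform_apply hφ _ hα, h, rightHerglotzKernel_nil, if_neg hα', zero_add,
      star_smul, star_star, smul_smul, transpose, List.reverse_reverse]
    simp

/-- Both sides obey the same recursion: `L_i^* L_j = δ_ij` cancels first letters just as in the
kernel. It remains to compare words against the empty word. Membership in the operator system is
carried along the same induction. -/
theorem cpMaps.rightHerglotzKernel_eq {φ : diskSystem d →ₗ[ℂ] (ℋ →L[ℂ] ℋ)}
    (hφ : φ ∈ cpMaps d ℋ) {C : ℋ →L[ℂ] ℋ} (hC : IsSelfAdjoint C) (α β : Word d) :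
    ∃ h : star (wordPow leftCreation α) * wordPow leftCreation β ∈ diskSystem d,
      φ ⟨_, h⟩ = rightHerglotzKernel (transpose (herglotzTransform φ C)) α β := by
  have hnil : ∀ β : Word d, φ ⟨_, wordPow_mem_diskSystem β⟩ =
      rightHerglotzKernel (transpose (herglotzTransform φ C)) [] β := by
    intro β
    rw [rightHerglotzKernel_nil]
    by_cases hβ : β = []
    · subst hβ
      rw [if_pos rfl]
      show _ = (2⁻¹ : ℂ) • (herglotzTransform φ C [] + star (herglotzTransform φ C []))
      have hI : star Complex.I = -Complex.I := Complex.conj_I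
      rw [herglotzTransform_nil, star_add, star_smul, hC.star_eq,
        (cpMaps.isSelfAdjoint_map_one hφ).star_eq, hI]
      module
    · have hβ' : β.reverse ≠ [] := by simpa using hβ
      rw [if_neg hβ, zero_add, transpose, cpMaps.herglotzTransform_apply hφ C hβ', star_smul,
        star_star, smul_smul]
      simp
  induction α generalizing β with
  | nil =>
    have h1 : star (wordPow leftCreation []) * wordPow leftCreation β =
        wordPow (leftCreation (d := d)) β := by
      rw [wordPow_nil, star_one, one_mul]
    refine ⟨by rw [h1]; exact wordPow_mem_diskSystem β, ?_⟩
    rw [← hnil β]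
    exact congrArg φ (Subtype.ext h1)
  | cons i α ih =>
    cases β with
    | nil =>
      have h1 : star (wordPow leftCreation (i :: α)) * wordPow leftCreation [] =
          star (wordPow (leftCreation (d := d)) (i :: α)) := by
        rw [wordPow_nil, mul_one]
      refine ⟨by rw [h1]; exact star_wordPow_mem_diskSystem (i :: α), ?_⟩
      rw [← star_rightHerglotzKernel, ← hnil, ← cpMaps.map_star hφ]
      exact congrArg φ (Subtype.ext h1)
    | cons j β =>
      have h1 : star (wordPow leftCreation (i :: α)) * wordPow leftCreation (j :: β) =
          if i = j then star (wordPow (leftCreation (d := d)) α) * wordPow leftCreation β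
          else 0 := by
        rw [wordPow_cons, wordPow_cons, star_mul, mul_assoc, ← mul_assoc (star (leftCreation i)),
          isRowIsometry_leftCreation]
        by_cases h : i = j <;> simp [h]
      rw [rightHerglotzKernel_cons_cons]
      by_cases hij : i = j
      · rw [if_pos hij] at h1
        obtain ⟨h2, h3⟩ := ih β
        refine ⟨by rw [h1]; exact h2, ?_⟩
        rw [if_pos hij, ← h3]
        exact congrArg φ (Subtype.ext h1)
      · rw [if_neg hij] at h1
        refine ⟨by rw [h1]; exact Submodule.zero_mem _, ?_⟩
        rw [if_neg hij, ← map_zero φ]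
        exact congrArg φ (Subtype.ext h1)

/-- The matrix of products `(L^α)^* L^β` is a Gram matrix, with quadratic form `‖∑ L^α x_α‖²`;
complete positivity transfers this to the kernel. -/
theorem cpMaps.isAccretiveAct_herglotzTransform {φ : diskSystem d →ₗ[ℂ] (ℋ →L[ℂ] ℋ)}
    (hφ : φ ∈ cpMaps d ℋ) {C : ℋ →L[ℂ] ℋ} (hC : IsSelfAdjoint C) :
    IsAccretiveAct (herglotzTransform φ C) := by
  rw [← isPosKernel_leftHerglotzKernel_iff]
  intro s h
  choose hmem hval using cpMaps.rightHerglotzKernel_eq hφ hC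
  let e : Fin s.card ≃ s := s.equivFin.symm
  have hsum : ∀ g : Word d → ℂ, ∑ α ∈ s, g α = ∑ p, g (e p) := fun g => by
    rw [← Finset.sum_coe_sort, ← Equiv.sum_comp e]
  have hpos := hφ s.card (Matrix.of fun p q =>
    ⟨_, hmem (e p : Word d).reverse (e q : Word d).reverse⟩) (fun x => by
      have h1 : ∑ p, ∑ q, (inner ℂ (x p) ((star (wordPow leftCreation (e p : Word d).reverse) *
          wordPow leftCreation (e q : Word d).reverse) (x q)) : ℂ) =
          ((‖∑ p, wordPow leftCreation (e p : Word d).reverse (x p)‖ ^ 2 : ℝ) : ℂ) := by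
        have h0 : ∀ z : Fock d ℂ, (inner ℂ z z : ℂ) = ((‖z‖ ^ 2 : ℝ) : ℂ) := fun z => by
          rw [inner_self_eq_norm_sq_to_K]
          norm_cast
        rw [← h0, sum_inner]
        refine Finset.sum_congr rfl fun p _ => ?_
        rw [inner_sum]
        refine Finset.sum_congr rfl fun q _ => ?_
        rw [mul_apply_eq_comp, inner_star_right]
      refine le_of_le_of_eq ?_ h1.symm
      rw [Complex.zero_le_real]
      positivity) fun p => h (e p)
  have hK : ∀ α β : Word d, leftHerglotzKernel (herglotzTransform φ C) α β =
      φ ⟨_, hmem α.reverse β.reverse⟩ := by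
    intro α β
    rw [hval, rightHerglotzKernel_transpose, List.reverse_reverse, List.reverse_reverse]
  simp only [hsum, hK]
  exact hpos

theorem cpMaps.im_herglotzTransform {φ : diskSystem d →ₗ[ℂ] (ℋ →L[ℂ] ℋ)}
    (hφ : φ ∈ cpMaps d ℋ) {C : ℋ →L[ℂ] ℋ} (hC : IsSelfAdjoint C) :
    im (herglotzTransform φ C []) = C := by
  rw [herglotzTransform_nil]
  exact im_add_I_smul (cpMaps.isSelfAdjoint_map_one hφ) hC

theorem herglotzTransform_add_const (φ : diskSystem d →ₗ[ℂ] (ℋ →L[ℂ] ℋ)) (C C' : ℋ →L[ℂ] ℋ) :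
    herglotzTransform φ C + const (Complex.I • C') = herglotzTransform φ (C + C') := by
  rw [herglotzTransform, herglotzTransform, add_assoc]
  congr 1
  funext α
  by_cases h : α = [] <;> simp [const, h]

end Representation

/-! ### The Herglotz representation of values -/

section Values

variable {d n : ℕ}

theorem colBdd_shiftSeries : ColBdd (shiftSeries d) :=
  colBdd_of_length_le 2 fun α hα => shiftSeries_of_length_ne_one (by omega)

theorem eval_shiftSeries (Z : Fin d → Matrix (Fin n) (Fin n) ℂ) :
    eval (shiftSeries d) Z = shiftAt Z := by
  rw [eval, tsum_eq_single 1]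
  · rw [homPart_eq, sum_wordsOf_succ, shiftAt]
    refine Finset.sum_congr rfl fun k _ => ?_
    rw [sum_wordsOf_zero, wordPow_cons, wordPow_nil, mul_one]
    rfl
  · intro k hk
    rw [homPart_eq]
    refine Finset.sum_eq_zero fun α hα => ?_
    rw [mem_wordsOf] at hα
    rw [shiftSeries_of_length_ne_one (by omega)]
    ext i j : 2
    simp [tensor]

theorem one_sub_mul_cauchySeries :
    lmul (const 1 - shiftSeries d) (cauchySeries d) = const 1 := by
  obtain ⟨G, h1, -⟩ := exists_lmul_inverse (F := const 1 - shiftSeries d)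
    (by simp [const, shiftSeries])
  rwa [← left_eq_right_inv cauchySeries_mul_one_sub h1] at h1

theorem herglotzSeries_eq_sub : herglotzSeries d = (2 : ℂ) • cauchySeries d - const 1 := by
  funext α
  rw [herglotzSeries_eq]
  by_cases h : α = []
  · subst h
    simp only [if_true, Pi.sub_apply, Pi.smul_apply, cauchySeries, wordPow_nil, const]
    rw [two_smul, add_sub_cancel_right]
  · simp [const, h]

theorem colBdd_herglotzSeries : ColBdd (herglotzSeries d) := by
  rw [herglotzSeries_eq_sub]
  exact (colBdd_cauchySeries.smul 2).sub (colBdd_const 1)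

theorem eval_herglotzSeries {Z : Fin d → Matrix (Fin n) (Fin n) ℂ} (hZ : Z ∈ ncBall d n) :
    IsUnit (1 - shiftAt Z) ∧
      eval (herglotzSeries d) Z = Ring.inverse (1 - shiftAt Z) * (1 + shiftAt Z) := by
  have h1 := colBdd_const (d := d) (1 : Fock d ℂ →L[ℂ] Fock d ℂ)
  have hs := colBdd_shiftSeries (d := d)
  have hsub := h1.eval_sub hs hZ
  have hadd := h1.eval_add hs hZ
  rw [eval_const_one, eval_shiftSeries] at hsub hadd
  have hl := colBdd_cauchySeries.eval_lmul (h1.sub hs) hZ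
  have hr := (h1.sub hs).eval_lmul colBdd_cauchySeries hZ
  rw [cauchySeries_mul_one_sub, eval_const_one, hsub] at hl
  rw [one_sub_mul_cauchySeries, eval_const_one, hsub] at hr
  let u : (Matrix (Fin n) (Fin n) (Fock d ℂ →L[ℂ] Fock d ℂ))ˣ :=
    ⟨1 - shiftAt Z, eval (cauchySeries d) Z, hr.symm, hl.symm⟩
  have hinv : Ring.inverse (1 - shiftAt Z) = eval (cauchySeries d) Z := Ring.inverse_unit u
  refine ⟨⟨u, rfl⟩, ?_⟩
  rw [hinv, ← hadd, ← colBdd_cauchySeries.eval_lmul (h1.add hs) hZ, herglotzSeries]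

variable {ℋ : Type*} [NormedAddCommGroup ℋ] [InnerProductSpace ℂ ℋ] [CompleteSpace ℋ]

/-- The entries of the series converge absolutely inside the operator system, which is closed and
hence complete, and the bounded map `φ` commutes with the sums. -/
theorem cpMaps.eval_herglotzTransform {φ : diskSystem d →ₗ[ℂ] (ℋ →L[ℂ] ℋ)}
    (hφ : φ ∈ cpMaps d ℋ) (C : ℋ →L[ℂ] ℋ) {Z : Fin d → Matrix (Fin n) (Fin n) ℂ}
    (hZ : Z ∈ ncBall d n) :
    ∃ X : Matrix (Fin n) (Fin n) (diskSystem d),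
      X.map (fun x => (x : Fock d ℂ →L[ℂ] Fock d ℂ)) = eval (herglotzSeries d) Z ∧
      eval (herglotzTransform φ C) Z = X.map φ + Complex.I • tensor 1 C := by
  have : CompleteSpace (diskSystem d) := isClosed_diskSystem.completeSpace_coe
  let x : Fin n → Fin n → ℕ → diskSystem d := fun i j k =>
    ∑ α ∈ wordsOf d k, wordPow Z α i j • ⟨herglotzSeries d α, herglotzSeries_mem α⟩
  have hx : ∀ i j k, (x i j k : Fock d ℂ →L[ℂ] Fock d ℂ) =
      homPart (herglotzSeries d) k Z i j := by
    intro i j k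
    simp only [x, homPart_apply, Submodule.coe_sum, Submodule.coe_smul]
  have hsum : ∀ i j, HasSum (x i j) (∑' k, x i j k) := by
    intro i j
    refine Summable.hasSum (Summable.of_norm ?_)
    refine (colBdd_herglotzSeries.summable_norm hZ i j).congr fun k => ?_
    rw [← hx]
    rfl
  have hacc := cpMaps.isAccretiveAct_herglotzTransform hφ (IsSelfAdjoint.zero (ℋ →L[ℂ] ℋ))
  have hzero : herglotzTransform φ 0 =
      fun α => φ ⟨herglotzSeries d α, herglotzSeries_mem α⟩ := by
    funext α
    simp [herglotzTransform, const]
  refine ⟨Matrix.of fun i j => ∑' k, x i j k, ?_, ?_⟩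
  · refine Matrix.ext fun i j => ?_
    rw [Matrix.map_apply, Matrix.of_apply, colBdd_herglotzSeries.eval_apply hZ]
    have h1 := (hsum i j).map (diskSystem d).subtype continuous_subtype_val
    refine h1.tsum_eq.symm.trans (tsum_congr fun k => ?_)
    exact hx i j k
  · have h1 : herglotzTransform φ C = herglotzTransform φ 0 + const (Complex.I • C) := by
      rw [herglotzTransform_add_const, zero_add]
    rw [h1, hacc.colBdd.eval_add (colBdd_const _) hZ, eval_const]
    congr 1
    · refine Matrix.ext fun i j => ?_
      rw [Matrix.map_apply, Matrix.of_apply, hacc.colBdd.eval_apply hZ]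
      have h2 := (hsum i j).map φ (cpMaps.continuous hφ)
      refine Eq.trans (tsum_congr fun k => ?_) h2.tsum_eq
      rw [homPart_apply, hzero]
      simp only [x, Function.comp_apply, map_sum, map_smul]
    · refine Matrix.ext fun i j => ?_
      simp [tensor, smul_comm Complex.I]

theorem cpMaps.herglotzFormulaAt_iff {φ : diskSystem d →ₗ[ℂ] (ℋ →L[ℂ] ℋ)}
    (hφ : φ ∈ cpMaps d ℋ) (C : ℋ →L[ℂ] ℋ) (f : GradedFun d ℋ) :
    HerglotzFormulaAt φ C f ↔
      ∀ n, ∀ Z ∈ ncBall d n, f n Z = eval (herglotzTransform φ C) Z := by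
  constructor
  · intro h n Z hZ
    obtain ⟨-, X, hX, hf⟩ := h n Z hZ
    obtain ⟨Y, hY, he⟩ := cpMaps.eval_herglotzTransform hφ C hZ
    have hXY : X = Y := by
      refine Matrix.ext fun i j => ?_
      have h1 := hX.trans ((eval_herglotzSeries hZ).2.symm.trans hY.symm)
      exact Subtype.ext (congrFun (congrFun h1 i) j)
    rw [hf, he, hXY]
  · intro h n Z hZ
    obtain ⟨Y, hY, he⟩ := cpMaps.eval_herglotzTransform hφ C hZ
    obtain ⟨hu, hs⟩ := eval_herglotzSeries hZ
    exact ⟨hu, Y, hY.trans hs, (h n Z hZ).trans he⟩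

/-! ### The completely positive map of a Herglotz pair -/

theorem exists_cpMap_of_herglotzPair (H : herglotzPairs d ℋ) :
    ∃ φ ∈ cpMaps d ℋ, H.1.1 = herglotzTransform φ (im (H.1.1 [])) :=
  (isAccretiveAct_of_mem_herglotzPairs H).exists_cpMap

/-- The completely positive map that represents a Herglotz pair. -/
def herglotzMap (H : herglotzPairs d ℋ) : cpMaps d ℋ :=
  ⟨(exists_cpMap_of_herglotzPair H).choose, (exists_cpMap_of_herglotzPair H).choose_spec.1⟩

theorem herglotzTransform_herglotzMap (H : herglotzPairs d ℋ) :
    H.1.1 = herglotzTransform (herglotzMap H).1 (im (H.1.1 [])) :=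
  (exists_cpMap_of_herglotzPair H).choose_spec.2

theorem eq_herglotzTransform_iff (H : herglotzPairs d ℋ) (φ : cpMaps d ℋ) :
    H.1.1 = herglotzTransform φ.1 (im (H.1.1 [])) ↔ φ = herglotzMap H := by
  constructor
  · intro h
    exact Subtype.ext (cpMaps.herglotzTransform_injective φ.2 (herglotzMap H).2
      (h.symm.trans (herglotzTransform_herglotzMap H)))
  · rintro rfl
    exact herglotzTransform_herglotzMap H

theorem herglotzFormulaAt_eval_iff (H : herglotzPairs d ℋ) (φ : cpMaps d ℋ) :
    HerglotzFormulaAt φ.1 (im (H.1.1 [])) (fun _ Z => eval H.1.1 Z) ↔ φ = herglotzMap H := by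
  rw [cpMaps.herglotzFormulaAt_iff φ.2, ← eq_herglotzTransform_iff]
  constructor
  · exact (isAccretiveAct_of_mem_herglotzPairs H).colBdd.ext_eval
      (cpMaps.isAccretiveAct_herglotzTransform φ.2 (isSelfAdjoint_im _)).colBdd
  · intro h n Z _
    exact congrArg (fun F => eval F Z) h

theorem existsUnique_herglotzPair (φ : cpMaps d ℋ) (C : ℋ →L[ℂ] ℋ) (hC : IsSelfAdjoint C) :
    ∃! H : herglotzPairs d ℋ, herglotzMap H = φ ∧ im (H.1.1 []) = C ∧
      H.1 = (herglotzTransform φ.1 C, transpose (herglotzTransform φ.1 C)) := by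
  have him := cpMaps.im_herglotzTransform φ.2 hC
  refine ⟨⟨_, mem_herglotzPairs (cpMaps.isAccretiveAct_herglotzTransform φ.2 hC)⟩,
    ⟨?_, him, rfl⟩, fun H hH => Subtype.ext hH.2.2⟩
  refine ((eq_herglotzTransform_iff _ φ).mp ?_).symm
  exact congrArg (herglotzTransform φ.1) him.symm

theorem surjective_herglotzMap : Function.Surjective (herglotzMap (d := d) (ℋ := ℋ)) := fun φ => by
  obtain ⟨H, ⟨h, -⟩, -⟩ := existsUnique_herglotzPair φ 0 (IsSelfAdjoint.zero _)
  exact ⟨H, h⟩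

theorem herglotzMap_eq_iff (H H' : herglotzPairs d ℋ) : herglotzMap H = herglotzMap H' ↔
    ∃ C : ℋ →L[ℂ] ℋ, IsSelfAdjoint C ∧
      H'.1 = (H.1.1 + const (Complex.I • C), H.1.2 + const (Complex.I • C)) := by
  constructor
  · intro h
    have h1 := herglotzTransform_herglotzMap H
    have h2 := herglotzTransform_herglotzMap H'
    rw [← h] at h2
    refine ⟨im (H'.1.1 []) - im (H.1.1 []), (isSelfAdjoint_im _).sub (isSelfAdjoint_im _), ?_⟩
    have h3 : H'.1.1 =
        H.1.1 + const (Complex.I • (im (H'.1.1 []) - im (H.1.1 []))) := by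
      conv_rhs => lhs; rw [h1]
      rw [herglotzTransform_add_const, add_sub_cancel]
      exact h2
    refine Prod.ext h3 ?_
    rw [H'.2.2.2, H.2.2.2]
    conv_lhs => rw [h3]
    rw [transpose_add, transpose_const]
  · rintro ⟨C, hC, h⟩
    have h1 := herglotzTransform_herglotzMap H
    have h2 : H'.1.1 = herglotzTransform (herglotzMap H).1 (im (H.1.1 []) + C) := by
      rw [← herglotzTransform_add_const, ← h1, h]
    refine (eq_herglotzTransform_iff H' _).mp ?_
    have h3 := cpMaps.im_herglotzTransform (herglotzMap H).2 ((isSelfAdjoint_im (H.1.1 [])).add hC)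
    rw [h2, h3]

/-- The Cayley relation at the empty word identifies `(1 - B_∅)⁻¹ (1 + B_∅)` with `H_∅`, and on the
ball the Cayley function of `B` is the value of `H`. Both the constants and the functions of the two
formulas therefore agree. -/
theorem isACMap_iff (B : schurPairs d ℋ) (φ : cpMaps d ℋ) :
    IsACMap φ.1 B.1 ↔ φ = herglotzMap (cayleyEquiv d ℋ B) := by
  have hrel := cayleyRel_cayleyEquiv B
  have h1 := congrFun hrel.1 []
  have h2 := congrFun hrel.2 []
  rw [lmul_eq_lact, lact_nil] at h1 h2
  have hnil := (cayley_of_mul_eq_two (a := B.1.1 []) (b := (cayleyEquiv d ℋ B).1.1 [])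
    (by simpa [const] using h1) (by simpa [const] using h2)).1.2
  have hcay := (isCayley_cayleyEquiv B).1
  rw [IsACMap, ← hnil, ← herglotzFormulaAt_eval_iff, cpMaps.herglotzFormulaAt_iff φ.2,
    cpMaps.herglotzFormulaAt_iff φ.2]
  refine forall_congr' fun n => forall₂_congr fun Z hZ => ?_
  rw [(hcay n Z hZ).2]

end Values

end FreeAC

end

theorem mainTheorem1 (d : ℕ) (ℋ : Type*) [NormedAddCommGroup ℋ] [InnerProductSpace ℂ ℋ]
    [CompleteSpace ℋ] :
    ∃ (cayley : schurPairs d ℋ ≃ herglotzPairs d ℋ) (ac : herglotzPairs d ℋ → cpMaps d ℋ),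
      -- the bijection between Schur pairs and Herglotz pairs is `B ↦ H_B`, with inverse `H ↦ B_H`
      (∀ B : schurPairs d ℋ, IsCayley B.1 (cayley B).1) ∧
      (∀ H : herglotzPairs d ℋ, IsInverseCayley H.1 (cayley.symm H).1) ∧
      -- `ac H` is the unique completely positive map that represents `H`, as a formal power
      -- series and as a function on `Ω`
      (∀ (H : herglotzPairs d ℋ) (φ : cpMaps d ℋ),
        H.1.1 = herglotzTransform φ.1 (im (H.1.1 [])) ↔ φ = ac H) ∧
      (∀ (H : herglotzPairs d ℋ) (φ : cpMaps d ℋ),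
        HerglotzFormulaAt φ.1 (im (H.1.1 [])) (fun _ Z => eval H.1.1 Z) ↔ φ = ac H) ∧
      -- conversely, every completely positive map and every imaginary constant give a pair
      (∀ (φ : cpMaps d ℋ) (C : ℋ →L[ℂ] ℋ), IsSelfAdjoint C →
        ∃! H : herglotzPairs d ℋ, ac H = φ ∧ im (H.1.1 []) = C ∧
          H.1 = (herglotzTransform φ.1 C, transpose (herglotzTransform φ.1 C))) ∧
      -- `ac` is a bijection modulo imaginary constants
      Function.Surjective ac ∧
      (∀ H H' : herglotzPairs d ℋ, ac H = ac H' ↔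
        ∃ C : ℋ →L[ℂ] ℋ, IsSelfAdjoint C ∧
          H'.1 = (H.1.1 + const (Complex.I • C), H.1.2 + const (Complex.I • C))) ∧
      -- the completely positive map attached to `B` is its Aleksandrov–Clark map
      (∀ (B : schurPairs d ℋ) (φ : cpMaps d ℋ), IsACMap φ.1 B.1 ↔ φ = ac (cayley B)) := by
  exact ⟨cayleyEquiv d ℋ, herglotzMap, isCayley_cayleyEquiv, isInverseCayley_cayleyEquiv_symm,
    eq_herglotzTransform_iff, herglotzFormulaAt_eval_iff, existsUnique_herglotzPair,
    surjective_herglotzMap, herglotzMap_eq_iff, isACMap_iff⟩
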